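/- Let $M$ be a smooth manifold of dimension $n$ and let $F,F'$ be Finsler structures on $M$: nonnegative functions on $TM$ that are $C^\infty$ on $TM_0=TM\setminus 0$, positively homogeneous of degree one in $y$, with $g_{ij}=\tfrac12\,\partial^2F^2/\partial y^i\partial y^j$ positive definite on $TM_0$. Write $G^i=\tfrac14 g^{il}\big([F^2]_{x^ky^l}y^k-[F^2]_{x^l}\big)$, $N^i_j=\partial G^i/\partial y^j$, $\frac{\delta}{\delta x^i}=\frac{\partial}{\partial x^i}-N^j_i\frac{\partial}{\partial y^j}$, and let $\nabla$ be the Cartan connection on the pull-back bundle $\pi^*TM$ over $TM_0$, with connection form $\omega^i_j=\Gamma^i_{jk}dx^k+C^i_{jk}(dy^k+N^k_l dx^l)$, where $\Gamma^i_{jk}=\tfrac12 g^{il}\big(\frac{\delta g_{lk}}{\delta x^j}+\frac{\delta g_{jl}}{\delta x^k}-\frac{\delta g_{jk}}{\delta x^l}\big)$ and $C^i_{jk}=\tfrac12 g^{il}\,\partial g_{lj}/\partial y^k$. A diffeomorphism $f:(M,F)\to(M,F')$ is a conformal transformation if $F'(f(x),df_x y)=e^{\varphi(x)}F(x,y)$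 for some smooth function $\varphi$ on $M$. Its Schwarzian tensor is $$B_F(\varphi)(\hat X,Y)=g(Y,\nabla_{\hat X}\operatorname{grad}\varphi)-d\varphi(\pi_*\hat X)\,d\varphi(Y)-\tfrac1n\big(\Delta\varphi-\|\operatorname{grad}\varphi\|^2\big)\,g(\pi_*\hat X,Y)$$ for all vectors $\hat X$ tangent to $TM_0$ (horizontal and vertical) and all $Y\in\pi^*TM$, where $\operatorname{grad}\varphi=g^{ij}\frac{\partial\varphi}{\partial x^j}\frac{\partial}{\partial x^i}$, $\|\operatorname{grad}\varphi\|^2=g(\operatorname{grad}\varphi,\operatorname{grad}\varphi)$, and $\Delta\varphi$ is the trace of $v\mapsto\nabla_{v^i\delta/\delta x^i}\operatorname{grad}\varphi$. The conformal transformation $f$ is called Möbius if $B_F(\varphi)=0$ on $TM_0$. Let $c$ be a smooth regular curve with arc length $s$, $ds=F(c,\dot c)\,dt$, unit tangent $X=dc/ds$, and let $\nabla/ds$ be the Cartan covariant derivative along its lift $(c,X)$. Its first Frenet curvature is $\kappa_1=\|\nabla X/ds\|$; where $\kappa_1\neq0$ its second Frenet curvature is $\kappa_2=\|\nabla Y/ds+\kappa_1X\|$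 with $Y=\kappa_1^{-1}\nabla X/ds$, and $\kappa_2=0$ if $\kappa_1\equiv0$; lengths are taken with respect to $g$ at $(c,X)$. The curve $c$ is a geodesic circle of $(M,F)$ if $\kappa_1$ is constant and $\kappa_2=0$. **Theorem.** (i) A conformal transformation $f:(M,F)\to(M,F')$ is Möbius if and only if it maps every geodesic circle of $(M,F)$ to a geodesic circle of $(M,F')$. (ii) In particular, all conformal transformations of $(M,F)$, i.e. conformal transformations $(M,F)\to(M,F)$, are Möbius (the conformal group coincides with the Möbius group) if and only if every conformal transformation of $(M,F)$ maps all geodesic circles to geodesic circles. -/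

import Mathlib

open scoped Manifold ContDiff Topology

noncomputable section

namespace FinslerGeom

/-! ### Finsler geometry in one coordinate system

In a chart the slit tangent bundle is a subset of `E × E`; a point is `z = (x, y)` and
`L : E × E → ℝ` is the coordinate expression of the Finsler structure. All objects below are
meant at points with `y ≠ 0`. -/

section Local

variable {E : Type*} [NormedAddCommGroup E] [NormedSpace ℝ E]
variable {V : Type*} [NormedAddCommGroup V] [NormedSpace ℝ V]

/-- The partial derivatives `∂/∂xⁱ`: `xDeriv h z v = vⁱ ∂h/∂xⁱ (z)`. -/
def xDeriv (h : E × E → V) (z : E × E) : E →L[ℝ] V :=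
  (fderiv ℝ h z).comp (ContinuousLinearMap.inl ℝ E E)

/-- The partial derivatives `∂/∂yⁱ`: `yDeriv h z v = vⁱ ∂h/∂yⁱ (z)`. -/
def yDeriv (h : E × E → V) (z : E × E) : E →L[ℝ] V :=
  (fderiv ℝ h z).comp (ContinuousLinearMap.inr ℝ E E)

/-- The fundamental tensor `g_ij = (1/2) ∂²(L²)/∂yⁱ∂yʲ`. -/
def metric (L : E × E → ℝ) (z : E × E) : E →L[ℝ] E →L[ℝ] ℝ :=
  (1 / 2 : ℝ) • yDeriv (yDeriv (fun w => L w ^ 2)) z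

/-- Raising an index with the inverse `g^ij` of the fundamental tensor. -/
def sharp (L : E × E → ℝ) (z : E × E) : (E →L[ℝ] ℝ) →L[ℝ] E :=
  (metric L z).inverse

/-- The spray coefficients
`Gⁱ = (1/4) g^il ([L²]_{x^k y^l} y^k - [L²]_{x^l})`. -/
def spray (L : E × E → ℝ) (z : E × E) : E :=
  (1 / 4 : ℝ) • sharp L z
    (xDeriv (yDeriv (fun w => L w ^ 2)) z z.2 - xDeriv (fun w => L w ^ 2) z)

/-- The nonlinear connection `Nⁱ_j = ∂Gⁱ/∂yʲ`. -/
def nonlinConn (L : E × E → ℝ) (z : E × E) : E →L[ℝ] E :=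
  yDeriv (spray L) z

/-- The horizontal derivatives `δ/δxⁱ = ∂/∂xⁱ - Nʲ_i ∂/∂yʲ`. -/
def hDeriv (L : E × E → ℝ) (h : E × E → V) (z : E × E) : E →L[ℝ] V :=
  xDeriv h z - (yDeriv h z).comp (nonlinConn L z)

/-- The horizontal coefficients of the Cartan connection
`Γⁱ_jk = (1/2) g^il (δ_j g_lk + δ_k g_jl - δ_l g_jk)`;
`cartanH L z u v = Γⁱ_jk uʲ vᵏ`. -/
def cartanH (L : E × E → ℝ) (z : E × E) (u : E) : E →L[ℝ] E :=
  (1 / 2 : ℝ) • (sharp L z).comp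
    (hDeriv L (metric L) z u + (hDeriv L (metric L) z).flip u
      - ((hDeriv L (metric L) z).flip u).flip)

/-- The vertical coefficients of the Cartan connection (the Cartan tensor)
`Cⁱ_jk = (1/2) g^il ∂g_lj/∂yᵏ`; `cartanV L z u v = Cⁱ_jk uʲ vᵏ`. -/
def cartanV (L : E × E → ℝ) (z : E × E) (u : E) : E →L[ℝ] E :=
  (1 / 2 : ℝ) • (sharp L z).comp ((yDeriv (metric L) z).flip u)

/-- The connection form `ωⁱ_j = Γⁱ_jk dxᵏ + Cⁱ_jk δyᵏ`, `δyᵏ = dyᵏ + Nᵏ_l dxˡ`, of the Cartan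
connection, contracted with `u`, as a function of a tangent vector of the slit tangent bundle. -/
def connForm (L : E × E → ℝ) (z : E × E) (u : E) : E × E →L[ℝ] E :=
  (cartanH L z u).comp (ContinuousLinearMap.fst ℝ E E)
    + (cartanV L z u).comp
      (ContinuousLinearMap.snd ℝ E E
        + (nonlinConn L z).comp (ContinuousLinearMap.fst ℝ E E))

/-- The Cartan covariant derivative `ξ ↦ ∇_ξ σ` of a section `σ` of `π^*TM`,
with `ξ` any (horizontal, vertical or mixed) tangent vector of the slit tangent bundle at `z`. -/
def cartanDeriv (L : E × E → ℝ) (σ : E × E → E) (z : E × E) : E × E →L[ℝ] E :=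
  fderiv ℝ σ z + connForm L z (σ z)

/-- The gradient `φⁱ = g^ij φ_j` of a function of `x`, as a section of `π^*TM`. -/
def grad (L : E × E → ℝ) (φ : E → ℝ) (z : E × E) : E :=
  sharp L z (fderiv ℝ φ z.1)

/-- The Hessian `Hess(φ)(ξ, w) = g(w, ∇_ξ (grad φ))` for the Cartan connection. -/
def hess (L : E × E → ℝ) (φ : E → ℝ) (z : E × E) (ξ : E × E) (w : E) : ℝ :=
  metric L z w (cartanDeriv L (grad L φ) z ξ)

/-- The horizontal lift `vⁱ ↦ vⁱ δ/δxⁱ`. -/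
def hLift (L : E × E → ℝ) (z : E × E) : E →L[ℝ] E × E :=
  (ContinuousLinearMap.id ℝ E).prod (-(nonlinConn L z))

/-- The Laplacian `Δφ`: the `g`-trace `g^ij Hess(φ)(δ/δxⁱ, ∂/∂xʲ)` of the horizontal Hessian,
i.e. the trace of the endomorphism `v ↦ ∇_{hLift v} (grad φ)`. -/
def laplacian (L : E × E → ℝ) (φ : E → ℝ) (z : E × E) : ℝ :=
  LinearMap.trace ℝ E
    ((cartanDeriv L (grad L φ) z).comp (hLift L z) : E →L[ℝ] E).toLinearMap

/-- The Schwarzian tensor `B_F(φ)(ξ, w) = Hess(φ)(ξ, w) - dφ(ρξ) dφ(w)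
- (1/n) (Δφ - ‖grad φ‖²) g(ρξ, w)`, where `ρ ξ = ξ.1`. -/
def schwarzian (L : E × E → ℝ) (φ : E → ℝ) (z : E × E) (ξ : E × E) (w : E) : ℝ :=
  hess L φ z ξ w - fderiv ℝ φ z.1 ξ.1 * fderiv ℝ φ z.1 w
    - (1 / (Module.finrank ℝ E : ℝ))
      * (laplacian L φ z - metric L z (grad L φ z) (grad L φ z)) * metric L z ξ.1 w

/-- The unit tangent `X = dc/ds` of a regular curve, `ds = L(c, ċ) dt`. -/
def unitTangent (L : E × E → ℝ) (c : ℝ → E) (t : ℝ) : E :=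
  (L (c t, deriv c t))⁻¹ • deriv c t

/-- The canonical lift `(c, dc/ds)` of a regular curve to the slit tangent bundle. -/
def curveLift (L : E × E → ℝ) (c : ℝ → E) (t : ℝ) : E × E :=
  (c t, unitTangent L c t)

/-- The Cartan covariant derivative `∇W/ds`, with respect to the arc length `s`, of a vector
field `W` along a regular curve (the derivative along the canonical lift of the curve). -/
def covDeriv (L : E × E → ℝ) (c : ℝ → E) (W : ℝ → E) (t : ℝ) : E :=
  (L (c t, deriv c t))⁻¹ •
    (deriv W t + connForm L (curveLift L c t) (W t) (deriv (curveLift L c) t))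

/-- The length `√(g_z(w, w))` of `w`. -/
def gNorm (L : E × E → ℝ) (z : E × E) (w : E) : ℝ :=
  Real.sqrt (metric L z w w)

/-- The first Frenet curvature `κ₁ = ‖∇X/ds‖`. -/
def curvature₁ (L : E × E → ℝ) (c : ℝ → E) (t : ℝ) : ℝ :=
  gNorm L (curveLift L c t) (covDeriv L c (unitTangent L c) t)

/-- The principal normal `Y`, `∇X/ds = κ₁ Y` (zero where `κ₁ = 0`). -/
def principalNormal (L : E × E → ℝ) (c : ℝ → E) (t : ℝ) : E :=
  (curvature₁ L c t)⁻¹ • covDeriv L c (unitTangent L c) t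

/-- The second Frenet curvature `κ₂ = ‖∇Y/ds + κ₁ X‖`. It is zero along a geodesic, where
`κ₁ = 0` identically. -/
def curvature₂ (L : E × E → ℝ) (c : ℝ → E) (t : ℝ) : ℝ :=
  gNorm L (curveLift L c t)
    (covDeriv L c (principalNormal L c) t + curvature₁ L c t • unitTangent L c t)

end Local

/-! ### Finsler manifolds -/

/-- A Finsler structure on a smooth manifold modelled on `E`. -/
structure FinslerStructure (E : Type*) [NormedAddCommGroup E] [NormedSpace ℝ E]
    (M : Type*) [TopologicalSpace M] [ChartedSpace E M] [IsManifold 𝓘(ℝ, E) ∞ M] where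
  /-- The function `F` on the tangent bundle. -/
  toFun : TangentBundle 𝓘(ℝ, E) M → ℝ
  nonneg : ∀ v, 0 ≤ toFun v
  smooth : ∀ v : TangentBundle 𝓘(ℝ, E) M, v.2 ≠ 0 →
    ContMDiffAt 𝓘(ℝ, E).tangent 𝓘(ℝ, ℝ) ∞ toFun v
  homogeneous : ∀ (x : M) (y : TangentSpace 𝓘(ℝ, E) x) (r : ℝ), 0 < r →
    toFun ⟨x, r • y⟩ = r * toFun ⟨x, y⟩
  /-- The Hessian of `F²/2` on each punctured tangent space is positive definite. -/
  posDef : ∀ (x : M) (y w : E), y ≠ 0 → w ≠ 0 →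
    0 < (1 / 2 : ℝ) * fderiv ℝ
      (fderiv ℝ (fun y' : E => toFun ⟨x, (y' : TangentSpace 𝓘(ℝ, E) x)⟩ ^ 2)) y w w

section Manifold

variable {E : Type*} [NormedAddCommGroup E] [NormedSpace ℝ E]
  {M : Type*} [TopologicalSpace M] [ChartedSpace E M] [IsManifold 𝓘(ℝ, E) ∞ M]

/-- The expression `F(xⁱ, yⁱ)` of a Finsler structure in the coordinates of a chart. -/
def FinslerStructure.inChart (F : FinslerStructure E M) (e : OpenPartialHomeomorph M E)
    (z : E × E) : ℝ :=
  F.toFun ⟨e.symm z.1, mfderiv 𝓘(ℝ, E) 𝓘(ℝ, E) e.symm z.1 z.2⟩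

/-- The diffeomorphism `f : (M, F) → (M, F')` is conformal with factor `e^φ`:
`F'(f x, df_x y) = e^{φ(x)} F(x, y)`. -/
def IsConformalWith (F F' : FinslerStructure E M) (f : M ≃ₘ⟮𝓘(ℝ, E), 𝓘(ℝ, E)⟯ M)
    (φ : M → ℝ) : Prop :=
  ContMDiff 𝓘(ℝ, E) 𝓘(ℝ, ℝ) ∞ φ ∧
    ∀ (x : M) (y : TangentSpace 𝓘(ℝ, E) x),
      F'.toFun ⟨f x, mfderiv 𝓘(ℝ, E) 𝓘(ℝ, E) f x y⟩ = Real.exp (φ x) * F.toFun ⟨x, y⟩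

/-- Conformal transformations `(M, F) → (M, F')`. -/
def IsConformal (F F' : FinslerStructure E M) (f : M ≃ₘ⟮𝓘(ℝ, E), 𝓘(ℝ, E)⟯ M) : Prop :=
  ∃ φ : M → ℝ, IsConformalWith F F' f φ

/-- The Schwarzian tensor `B_F(φ)` vanishes on the slit tangent bundle: in every chart of the
smooth structure, at each `(x, y)` with `y ≠ 0`, and in all directions `ξ` tangent to the slit
tangent bundle. -/
def SchwarzianVanishes (F : FinslerStructure E M) (φ : M → ℝ) : Prop :=
  ∀ e ∈ IsManifold.maximalAtlas 𝓘(ℝ, E) ∞ M, ∀ x ∈ e.target, ∀ y : E, y ≠ 0 →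
    ∀ (ξ : E × E) (w : E), schwarzian (F.inChart e) (φ ∘ e.symm) (x, y) ξ w = 0

/-- Möbius transformations: conformal transformations with vanishing Schwarzian. -/
def IsMobius (F F' : FinslerStructure E M) (f : M ≃ₘ⟮𝓘(ℝ, E), 𝓘(ℝ, E)⟯ M) : Prop :=
  ∃ φ : M → ℝ, IsConformalWith F F' f φ ∧ SchwarzianVanishes F φ

/-- Geodesic circles: smooth regular curves on an open interval `I` whose first Frenet
curvature is constant and whose second Frenet curvature vanishes. The Frenet curvatures refer
to the arc length, but the curve may carry any regular parameter. -/
def IsGeodesicCircle (F : FinslerStructure E M) (c : ℝ → M) (I : Set ℝ) : Prop :=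
  IsOpen I ∧ I.OrdConnected ∧ ContMDiffOn 𝓘(ℝ, ℝ) 𝓘(ℝ, E) ∞ c I ∧
    (∀ t ∈ I, mfderiv 𝓘(ℝ, ℝ) 𝓘(ℝ, E) c t (1 : ℝ) ≠ 0) ∧
    ∃ κ : ℝ, ∀ e ∈ IsManifold.maximalAtlas 𝓘(ℝ, E) ∞ M, ∀ t ∈ I, c t ∈ e.source →
      curvature₁ (F.inChart e) (e ∘ c) t = κ ∧ curvature₂ (F.inChart e) (e ∘ c) t = 0

/-- `f : (M, F) → (M, F')` maps every geodesic circle to a geodesic circle. -/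
def MapsGeodesicCircles (F F' : FinslerStructure E M)
    (f : M ≃ₘ⟮𝓘(ℝ, E), 𝓘(ℝ, E)⟯ M) : Prop :=
  ∀ (c : ℝ → M) (I : Set ℝ), IsGeodesicCircle F c I → IsGeodesicCircle F' (f ∘ c) I

/-- The conformal transformations of `(M, F)`. -/
def conformalGroup (F : FinslerStructure E M) : Set (M ≃ₘ⟮𝓘(ℝ, E), 𝓘(ℝ, E)⟯ M) :=
  {f | IsConformal F F f}

/-- The Möbius transformations of `(M, F)`. -/
def mobiusGroup (F : FinslerStructure E M) : Set (M ≃ₘ⟮𝓘(ℝ, E), 𝓘(ℝ, E)⟯ M) :=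
  {f | IsMobius F F f}

end Manifold

end FinslerGeom

end

noncomputable section

set_option linter.unusedSectionVars false

namespace FinslerGeom

/-! ### Partial derivatives on `E × E` and their product rules. -/

section Calculus

variable {E : Type*} [NormedAddCommGroup E] [NormedSpace ℝ E]
variable {V : Type*} [NormedAddCommGroup V] [NormedSpace ℝ V]

/-! Write X for the unit tangent of a curve, W = ∇X/ds for its acceleration, g for the fundamental
tensor at (c, X). Geodesic circles are the solutions of the third order equation ∇W/ds + g(W, W) X =
0, whose left side is `circleDefect`. Where κ₁ is constant, this equation is equivalent to κ₂ = 0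
(`curvature₂_eq_zero_iff`). Conversely, the equation forces κ₁² to be constant, because g(X, W) = 0
and the Cartan connection is metrical.

For L' = e^φ L, computing the spray, N and the Cartan covariant derivative of L' gives the
transformation law `IsConformalPair.circleDefect_eq`: the defect for L' is e^{-3φ} times the defect
for L minus the part normal to X of D = ∇(grad φ)/ds - dφ(X) grad φ. So circles are preserved
exactly when D is tangent to every geodesic circle. If the Schwarzian vanishes, evaluating it on the
velocity of the lift (c, X) gives D = ρ X, which is one implication.

For the converse, solving an ordinary differential equation gives a circle with any prescribed unit
tangent y and any acceleration w orthogonal to y (`exists_circle`). Hence ∇ grad φ in the direction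
(y, w - 2G), minus dφ(y) grad φ, is a multiple of y for all such y and w. Three steps turn this into
a vanishing Schwarzian. (a) Comparing w with 0 shows that C(grad φ, w) is a multiple of y. It is
also orthogonal to y, so it is zero, and grad φ does not depend on the direction
(`yDeriv_grad_eq_zero`). (b) The case w = 0 is then a radial equation ∇_y grad φ = dφ(y) grad φ + ρ
y (`exists_radial`). (c) The horizontal Hessian is now half a Lie derivative of g. Differentiating
the lowered radial equation along the fibre recovers the whole Hessian, as dφ ⊗ dφ + ρ g plus a term
in ∂ρ/∂y. Symmetry of the Hessian removes that term (`hess_horizontal_eq`), and the trace identifies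
ρ.

On the manifold, the defect transforms as a vector under changes of chart
(`IsCoordChange.circleDefect_eq`), so the equation may be tested in a single chart. A conformal
diffeomorphism f becomes the identity in coordinates once a chart e' is paired with the chart e' ∘
f, which reduces both implications to the local statements. -/

lemma xDeriv_apply (h : E × E → V) (z : E × E) (u : E) :
    xDeriv h z u = fderiv ℝ h z (u, 0) := rfl

lemma yDeriv_apply (h : E × E → V) (z : E × E) (u : E) :
    yDeriv h z u = fderiv ℝ h z (0, u) := rfl

lemma fderiv_eq_xDeriv_add_yDeriv (h : E × E → V) (z ξ : E × E) :
    fderiv ℝ h z ξ = xDeriv h z ξ.1 + yDeriv h z ξ.2 := by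
  rw [xDeriv_apply, yDeriv_apply, ← map_add]
  simp

lemma contDiffAt_xDeriv {h : E × E → V} {z : E × E} (hh : ContDiffAt ℝ ∞ h z) :
    ContDiffAt ℝ ∞ (xDeriv h) z :=
  (hh.fderiv_right (m := ∞) le_rfl).clm_comp contDiffAt_const

lemma contDiffAt_yDeriv {h : E × E → V} {z : E × E} (hh : ContDiffAt ℝ ∞ h z) :
    ContDiffAt ℝ ∞ (yDeriv h) z :=
  (hh.fderiv_right (m := ∞) le_rfl).clm_comp contDiffAt_const

lemma _root_.ContDiffAt.diffAt {P : Type*} [NormedAddCommGroup P] [NormedSpace ℝ P]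
    {h : P → V} {z : P} (hh : ContDiffAt ℝ ∞ h z) : DifferentiableAt ℝ h z :=
  hh.differentiableAt (by simp)

lemma fderiv_xDeriv_apply {h : E × E → V} {z : E × E} (hh : ContDiffAt ℝ ∞ h z)
    (ξ : E × E) (u : E) :
    fderiv ℝ (xDeriv h) z ξ u = fderiv ℝ (fderiv ℝ h) z ξ (u, 0) := by
  have hd := (hh.fderiv_right (m := ∞) le_rfl).diffAt
  have := (hd.hasFDerivAt.clm_comp
    (hasFDerivAt_const (ContinuousLinearMap.inl ℝ E E) z)).fderiv
  change fderiv ℝ (fun w => (fderiv ℝ h w).comp (ContinuousLinearMap.inl ℝ E E)) z ξ u = _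
  rw [this]
  simp

lemma fderiv_yDeriv_apply {h : E × E → V} {z : E × E} (hh : ContDiffAt ℝ ∞ h z)
    (ξ : E × E) (u : E) :
    fderiv ℝ (yDeriv h) z ξ u = fderiv ℝ (fderiv ℝ h) z ξ (0, u) := by
  have hd := (hh.fderiv_right (m := ∞) le_rfl).diffAt
  have := (hd.hasFDerivAt.clm_comp
    (hasFDerivAt_const (ContinuousLinearMap.inr ℝ E E) z)).fderiv
  change fderiv ℝ (fun w => (fderiv ℝ h w).comp (ContinuousLinearMap.inr ℝ E E)) z ξ u = _
  rw [this]
  simp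

lemma fderiv_fderiv_symm {P : Type*} [NormedAddCommGroup P] [NormedSpace ℝ P]
    {h : P → V} {z : P} (hh : ContDiffAt ℝ ∞ h z) (ξ η : P) :
    fderiv ℝ (fderiv ℝ h) z ξ η = fderiv ℝ (fderiv ℝ h) z η ξ :=
  (hh.isSymmSndFDerivAt (by simpa using ENat.LEInfty.out)).eq ξ η

/-- Schwarz's theorem for the mixed derivatives `∂²/∂x∂y`. -/
lemma xDeriv_yDeriv_comm {h : E × E → V} {z : E × E} (hh : ContDiffAt ℝ ∞ h z) (u v : E) :
    xDeriv (yDeriv h) z u v = yDeriv (xDeriv h) z v u := by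
  rw [xDeriv_apply, yDeriv_apply, fderiv_xDeriv_apply hh, fderiv_yDeriv_apply hh,
    fderiv_fderiv_symm hh]

lemma yDeriv_yDeriv_comm {h : E × E → V} {z : E × E} (hh : ContDiffAt ℝ ∞ h z) (u v : E) :
    yDeriv (yDeriv h) z u v = yDeriv (yDeriv h) z v u := by
  rw [yDeriv_apply, yDeriv_apply, fderiv_yDeriv_apply hh, fderiv_yDeriv_apply hh,
    fderiv_fderiv_symm hh]

/-- The product rule for the evaluation of a family of bilinear forms. -/
lemma fderiv_bilin {P : Type*} [NormedAddCommGroup P] [NormedSpace ℝ P]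
    {m : P → E →L[ℝ] E →L[ℝ] V} {a b : P → E} {z : P} (hm : DifferentiableAt ℝ m z)
    (ha : DifferentiableAt ℝ a z) (hb : DifferentiableAt ℝ b z) (ξ : P) :
    fderiv ℝ (fun w => m w (a w) (b w)) z ξ
      = fderiv ℝ m z ξ (a z) (b z) + m z (fderiv ℝ a z ξ) (b z) + m z (a z) (fderiv ℝ b z ξ) := by
  rw [((hm.hasFDerivAt.clm_apply ha.hasFDerivAt).clm_apply hb.hasFDerivAt).fderiv]
  simp
  abel

/-- The product rule for the evaluation of a family of linear maps. -/
lemma fderiv_lin {P : Type*} [NormedAddCommGroup P] [NormedSpace ℝ P]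
    {m : P → E →L[ℝ] V} {a : P → E} {z : P} (hm : DifferentiableAt ℝ m z)
    (ha : DifferentiableAt ℝ a z) (ξ : P) :
    fderiv ℝ (fun w => m w (a w)) z ξ = fderiv ℝ m z ξ (a z) + m z (fderiv ℝ a z ξ) := by
  rw [(hm.hasFDerivAt.clm_apply ha.hasFDerivAt).fderiv]
  simp
  abel

lemma yDeriv_bilin {m : E × E → E →L[ℝ] E →L[ℝ] V} {a b : E × E → E} {z : E × E}
    (hm : DifferentiableAt ℝ m z)
    (ha : DifferentiableAt ℝ a z) (hb : DifferentiableAt ℝ b z) (u : E) :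
    yDeriv (fun w => m w (a w) (b w)) z u
      = yDeriv m z u (a z) (b z) + m z (yDeriv a z u) (b z) + m z (a z) (yDeriv b z u) :=
  fderiv_bilin hm ha hb _

lemma xDeriv_bilin {m : E × E → E →L[ℝ] E →L[ℝ] V} {a b : E × E → E} {z : E × E}
    (hm : DifferentiableAt ℝ m z)
    (ha : DifferentiableAt ℝ a z) (hb : DifferentiableAt ℝ b z) (u : E) :
    xDeriv (fun w => m w (a w) (b w)) z u
      = xDeriv m z u (a z) (b z) + m z (xDeriv a z u) (b z) + m z (a z) (xDeriv b z u) :=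
  fderiv_bilin hm ha hb _

lemma yDeriv_lin {m : E × E → E →L[ℝ] V} {a : E × E → E} {z : E × E}
    (hm : DifferentiableAt ℝ m z) (ha : DifferentiableAt ℝ a z) (u : E) :
    yDeriv (fun w => m w (a w)) z u = yDeriv m z u (a z) + m z (yDeriv a z u) :=
  fderiv_lin hm ha _

lemma xDeriv_lin {m : E × E → E →L[ℝ] V} {a : E × E → E} {z : E × E}
    (hm : DifferentiableAt ℝ m z) (ha : DifferentiableAt ℝ a z) (u : E) :
    xDeriv (fun w => m w (a w)) z u = xDeriv m z u (a z) + m z (xDeriv a z u) :=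
  fderiv_lin hm ha _

lemma yDeriv_congr {h k : E × E → V} {z : E × E} (hk : h =ᶠ[𝓝 z] k) :
    yDeriv h z = yDeriv k z := by
  rw [yDeriv, yDeriv, hk.fderiv_eq]

lemma xDeriv_congr {h k : E × E → V} {z : E × E} (hk : h =ᶠ[𝓝 z] k) :
    xDeriv h z = xDeriv k z := by
  rw [xDeriv, xDeriv, hk.fderiv_eq]

@[simp] lemma xDeriv_snd (z : E × E) : xDeriv (fun w : E × E => w.2) z = 0 := by
  ext u; simp [xDeriv_apply, fderiv_snd]

@[simp] lemma yDeriv_snd (z : E × E) :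
    yDeriv (fun w : E × E => w.2) z = ContinuousLinearMap.id ℝ E := by
  ext u; simp [yDeriv_apply, fderiv_snd]

@[simp] lemma xDeriv_const (c : V) (z : E × E) : xDeriv (fun _ : E × E => c) z = 0 := by
  ext u; simp [xDeriv_apply]

@[simp] lemma yDeriv_const (c : V) (z : E × E) : yDeriv (fun _ : E × E => c) z = 0 := by
  ext u; simp [yDeriv_apply]

lemma xDeriv_comp_fst {φ : E → V} {z : E × E} (h : DifferentiableAt ℝ φ z.1) :
    xDeriv (fun w : E × E => φ w.1) z = fderiv ℝ φ z.1 := by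
  ext u
  rw [xDeriv_apply, fderiv_fun_comp z h differentiableAt_fst]
  simp [fderiv_fst]

lemma yDeriv_comp_fst {φ : E → V} {z : E × E} (h : DifferentiableAt ℝ φ z.1) :
    yDeriv (fun w : E × E => φ w.1) z = 0 := by
  ext u
  rw [yDeriv_apply, fderiv_fun_comp z h differentiableAt_fst]
  simp [fderiv_fst]

end Calculus

/-! ### Finsler structures on an open set: homogeneity identities, spray and Cartan connection. -/

section LocalFinsler

variable {E : Type*} [NormedAddCommGroup E] [NormedSpace ℝ E]
variable {V : Type*} [NormedAddCommGroup V] [NormedSpace ℝ V]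

/-- The slit tangent bundle of an open subset `U` of `E`. -/
def slit (U : Set E) : Set (E × E) := {z | z.1 ∈ U ∧ z.2 ≠ 0}

/-- `L` is a Finsler structure on the open subset `U` of the model space. -/
structure IsLocalFinsler (L : E × E → ℝ) (U : Set E) : Prop where
  isOpen : IsOpen U
  smooth : ∀ z ∈ slit U, ContDiffAt ℝ ∞ L z
  nonneg : ∀ z, 0 ≤ L z
  homogeneous : ∀ x ∈ U, ∀ (y : E) (r : ℝ), 0 < r → L (x, r • y) = r * L (x, y)
  posDef : ∀ z ∈ slit U, ∀ w : E, w ≠ 0 → 0 < metric L z w w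

lemma isOpen_slit {U : Set E} (hU : IsOpen U) : IsOpen (slit U) :=
  (hU.preimage continuous_fst).inter (isOpen_ne.preimage continuous_snd)

lemma smul_mem_slit {U : Set E} {z : E × E} (hz : z ∈ slit U) {r : ℝ} (hr : r ≠ 0) :
    (z.1, r • z.2) ∈ slit U :=
  ⟨hz.1, smul_ne_zero hr hz.2⟩

variable {L : E × E → ℝ} {U : Set E} {z : E × E}

namespace IsLocalFinsler

lemma eventually (hL : IsLocalFinsler L U) (hz : z ∈ slit U) : ∀ᶠ w in 𝓝 z, w ∈ slit U :=
  (isOpen_slit hL.isOpen).mem_nhds hz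

lemma eventuallyEq (hL : IsLocalFinsler L U) (hz : z ∈ slit U) {h k : E × E → V}
    (hk : ∀ w ∈ slit U, h w = k w) : h =ᶠ[𝓝 z] k :=
  (hL.eventually hz).mono hk

lemma smooth_sq (hL : IsLocalFinsler L U) (hz : z ∈ slit U) :
    ContDiffAt ℝ ∞ (fun w => L w ^ 2) z :=
  (hL.smooth z hz).pow 2

lemma smooth_ySq (hL : IsLocalFinsler L U) (hz : z ∈ slit U) :
    ContDiffAt ℝ ∞ (yDeriv fun w => L w ^ 2) z :=
  contDiffAt_yDeriv (hL.smooth_sq hz)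

lemma smooth_xSq (hL : IsLocalFinsler L U) (hz : z ∈ slit U) :
    ContDiffAt ℝ ∞ (xDeriv fun w => L w ^ 2) z :=
  contDiffAt_xDeriv (hL.smooth_sq hz)

lemma smooth_metric (hL : IsLocalFinsler L U) (hz : z ∈ slit U) :
    ContDiffAt ℝ ∞ (metric L) z :=
  (contDiffAt_yDeriv (hL.smooth_ySq hz)).const_smul (1 / 2 : ℝ)

lemma metric_symm (hL : IsLocalFinsler L U) (hz : z ∈ slit U) (u v : E) :
    metric L z u v = metric L z v u := by
  simp only [metric, smul_apply]
  rw [yDeriv_yDeriv_comm (hL.smooth_sq hz)]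

/-- Euler's identity for `L²`. -/
lemma yDeriv_sq_self (hL : IsLocalFinsler L U) (hz : z ∈ slit U) :
    yDeriv (fun w => L w ^ 2) z z.2 = 2 * L z ^ 2 := by
  have h1 : HasDerivAt (fun r : ℝ => (z.1, r • z.2)) ((0 : E), z.2) 1 := by
    simpa using (hasDerivAt_const (1 : ℝ) z.1).prodMk ((hasDerivAt_id (1 : ℝ)).smul_const z.2)
  have h2 : HasFDerivAt (fun w => L w ^ 2) (fderiv ℝ (fun w => L w ^ 2) z)
      ((fun r : ℝ => (z.1, r • z.2)) 1) := by
    simpa using (hL.smooth_sq hz).diffAt.hasFDerivAt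
  have h3 := h2.comp_hasDerivAt (1 : ℝ) h1
  have h4 : HasDerivAt (fun r : ℝ => (r * L z) ^ 2) (2 * L z ^ 2) 1 := by
    have := ((hasDerivAt_id (1 : ℝ)).mul_const (L z)).pow 2
    exact this.congr_deriv (by simp; ring)
  have h5 : ((fun w => L w ^ 2) ∘ fun r : ℝ => (z.1, r • z.2)) =ᶠ[𝓝 1]
      fun r : ℝ => (r * L z) ^ 2 := by
    filter_upwards [lt_mem_nhds (zero_lt_one' ℝ)] with r hr
    simp [hL.homogeneous z.1 hz.1 z.2 r hr]
  exact h3.unique (h4.congr_of_eventuallyEq h5)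

/-- Differentiating Euler's identity once more along the fibre. -/
lemma metric_self_right (hL : IsLocalFinsler L U) (hz : z ∈ slit U) (u : E) :
    metric L z u z.2 = (1 / 2) * yDeriv (fun w => L w ^ 2) z u := by
  have h1 := yDeriv_congr (hL.eventuallyEq hz
    (h := fun w => yDeriv (fun w => L w ^ 2) w w.2) (k := fun w => 2 * L w ^ 2)
    fun w hw => hL.yDeriv_sq_self hw)
  have h2 := congrArg (fun T => T u) h1
  rw [yDeriv_lin (hL.smooth_ySq hz).diffAt differentiableAt_snd, yDeriv_snd] at h2
  have h3 : yDeriv (fun w => 2 * L w ^ 2) z u = 2 * yDeriv (fun w => L w ^ 2) z u := by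
    rw [yDeriv_apply, yDeriv_apply, fderiv_const_mul (hL.smooth_sq hz).diffAt]
    simp
  rw [h3] at h2
  simp only [metric, smul_apply, smul_eq_mul]
  simp only [ContinuousLinearMap.id_apply] at h2
  linarith

lemma metric_self_left (hL : IsLocalFinsler L U) (hz : z ∈ slit U) (u : E) :
    metric L z z.2 u = (1 / 2) * yDeriv (fun w => L w ^ 2) z u := by
  rw [hL.metric_symm hz, hL.metric_self_right hz]

lemma metric_self_self (hL : IsLocalFinsler L U) (hz : z ∈ slit U) :
    metric L z z.2 z.2 = L z ^ 2 := by
  rw [hL.metric_self_left hz, hL.yDeriv_sq_self hz]; ring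

/-- Only nonnegativity is assumed; strict positivity comes from g(y, y) = L² and positive
definiteness of g. -/
lemma pos (hL : IsLocalFinsler L U) (hz : z ∈ slit U) : 0 < L z := by
  have := hL.posDef z hz z.2 hz.2
  rw [hL.metric_self_self hz] at this
  exact (hL.nonneg z).lt_of_ne' (by rintro h; simp [h] at this)

lemma apply_zero (hL : IsLocalFinsler L U) {x : E} (hx : x ∈ U) : L (x, 0) = 0 := by
  have := hL.homogeneous x hx 0 2 two_pos
  rw [smul_zero] at this; linarith

lemma yDeriv_metric_symm₂₃ (hL : IsLocalFinsler L U) (hz : z ∈ slit U) (u v w : E) :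
    yDeriv (metric L) z u v w = yDeriv (metric L) z u w v := by
  have h := yDeriv_congr (hL.eventuallyEq hz (h := fun q => metric L q v w)
    (k := fun q => metric L q w v) fun q hq => hL.metric_symm hq v w)
  have h := congrArg (fun T => T u) h
  rw [yDeriv_bilin (hL.smooth_metric hz).diffAt (differentiableAt_const _)
    (differentiableAt_const _), yDeriv_bilin (hL.smooth_metric hz).diffAt
    (differentiableAt_const _) (differentiableAt_const _)] at h
  simpa using h

lemma xDeriv_metric_symm₂₃ (hL : IsLocalFinsler L U) (hz : z ∈ slit U) (u v w : E) :
    xDeriv (metric L) z u v w = xDeriv (metric L) z u w v := by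
  have h := xDeriv_congr (hL.eventuallyEq hz (h := fun q => metric L q v w)
    (k := fun q => metric L q w v) fun q hq => hL.metric_symm hq v w)
  have h := congrArg (fun T => T u) h
  rw [xDeriv_bilin (hL.smooth_metric hz).diffAt (differentiableAt_const _)
    (differentiableAt_const _), xDeriv_bilin (hL.smooth_metric hz).diffAt
    (differentiableAt_const _) (differentiableAt_const _)] at h
  simpa using h

lemma xDeriv_metric (hL : IsLocalFinsler L U) (hz : z ∈ slit U) :
    xDeriv (metric L) z = (1 / 2 : ℝ) • xDeriv (yDeriv (yDeriv fun w => L w ^ 2)) z := by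
  ext u : 1
  change fderiv ℝ ((1 / 2 : ℝ) • yDeriv (yDeriv fun w => L w ^ 2)) z (u, 0) = _
  rw [fderiv_const_smul (contDiffAt_yDeriv (hL.smooth_ySq hz)).diffAt]
  rfl

lemma yDeriv_metric (hL : IsLocalFinsler L U) (hz : z ∈ slit U) :
    yDeriv (metric L) z = (1 / 2 : ℝ) • yDeriv (yDeriv (yDeriv fun w => L w ^ 2)) z := by
  ext u : 1
  change fderiv ℝ ((1 / 2 : ℝ) • yDeriv (yDeriv fun w => L w ^ 2)) z (0, u) = _
  rw [fderiv_const_smul (contDiffAt_yDeriv (hL.smooth_ySq hz)).diffAt]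
  rfl

/-- The derivative of g along the fibre is a third derivative of L²/2. Together with the symmetry of
g this makes the Cartan tensor totally symmetric. -/
lemma yDeriv_metric_symm₁₂ (hL : IsLocalFinsler L U) (hz : z ∈ slit U) (u v w : E) :
    yDeriv (metric L) z u v w = yDeriv (metric L) z v u w := by
  rw [hL.yDeriv_metric hz]
  simp only [smul_apply]
  rw [yDeriv_yDeriv_comm (hL.smooth_ySq hz)]

/-- The Cartan tensor is annihilated by the canonical section. -/
lemma yDeriv_metric_self (hL : IsLocalFinsler L U) (hz : z ∈ slit U) (u v : E) :
    yDeriv (metric L) z u v z.2 = 0 := by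
  have h := yDeriv_congr (hL.eventuallyEq hz (h := fun q => metric L q v q.2)
    (k := fun q => (1 / 2) * yDeriv (fun w => L w ^ 2) q v) fun q hq => hL.metric_self_right hq v)
  have h := congrArg (fun T => T u) h
  rw [yDeriv_bilin (hL.smooth_metric hz).diffAt (differentiableAt_const _)
    differentiableAt_snd, yDeriv_snd, yDeriv_const] at h
  have h3 : yDeriv (fun q => (1 / 2) * yDeriv (fun w => L w ^ 2) q v) z u
      = (1 / 2) * yDeriv (yDeriv fun w => L w ^ 2) z u v := by
    have hd := (hL.smooth_ySq hz).diffAt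
    rw [yDeriv_apply, fderiv_const_mul (hd.clm_apply (differentiableAt_const _))]
    rw [smul_apply, fderiv_lin hd (differentiableAt_const _)]
    simp only [yDeriv_apply, fderiv_fun_const, Pi.zero_apply, zero_apply, map_zero, add_zero,
      smul_eq_mul]
  rw [h3] at h
  have h4 : metric L z v u = (1 / 2) * yDeriv (yDeriv fun w => L w ^ 2) z u v := by
    rw [hL.metric_symm hz]; rfl
  simp only [ContinuousLinearMap.id_apply, zero_apply, map_zero] at h
  linarith

/-- `∂_x g(v, y)` in terms of the mixed second derivatives of `L²`. -/
lemma xDeriv_metric_self (hL : IsLocalFinsler L U) (hz : z ∈ slit U) (u v : E) :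
    xDeriv (metric L) z u v z.2 = (1 / 2) * xDeriv (yDeriv fun w => L w ^ 2) z u v := by
  have h := xDeriv_congr (hL.eventuallyEq hz (h := fun q => metric L q v q.2)
    (k := fun q => (1 / 2) * yDeriv (fun w => L w ^ 2) q v) fun q hq => hL.metric_self_right hq v)
  have h := congrArg (fun T => T u) h
  rw [xDeriv_bilin (hL.smooth_metric hz).diffAt (differentiableAt_const _)
    differentiableAt_snd, xDeriv_snd, xDeriv_const] at h
  have h3 : xDeriv (fun q => (1 / 2) * yDeriv (fun w => L w ^ 2) q v) z u
      = (1 / 2) * xDeriv (yDeriv fun w => L w ^ 2) z u v := by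
    have hd := (hL.smooth_ySq hz).diffAt
    rw [xDeriv_apply, fderiv_const_mul (hd.clm_apply (differentiableAt_const _))]
    rw [smul_apply, fderiv_lin hd (differentiableAt_const _)]
    simp [xDeriv_apply]
  rw [h3] at h
  simpa using h

lemma xDeriv_ySq_self (hL : IsLocalFinsler L U) (hz : z ∈ slit U) (u : E) :
    xDeriv (yDeriv fun w => L w ^ 2) z u z.2 = 2 * xDeriv (fun w => L w ^ 2) z u := by
  have h := xDeriv_congr (hL.eventuallyEq hz
    (h := fun w => yDeriv (fun w => L w ^ 2) w w.2) (k := fun w => 2 * L w ^ 2)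
    fun w hw => hL.yDeriv_sq_self hw)
  have h := congrArg (fun T => T u) h
  rw [xDeriv_lin (hL.smooth_ySq hz).diffAt differentiableAt_snd, xDeriv_snd] at h
  have h3 : xDeriv (fun w => 2 * L w ^ 2) z u = 2 * xDeriv (fun w => L w ^ 2) z u := by
    rw [xDeriv_apply, xDeriv_apply, fderiv_const_mul (hL.smooth_sq hz).diffAt]
    simp
  rw [h3] at h
  simpa using h

/-! ### Raising indices -/

/-- Nondegeneracy of g. Identities between vectors are generally proved by lowering an index, which
avoids differentiating the inverse metric. -/
lemma metric_ext (hL : IsLocalFinsler L U) (hz : z ∈ slit U) {u v : E}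
    (h : ∀ w, metric L z u w = metric L z v w) : u = v := by
  by_contra hne
  have := hL.posDef z hz (u - v) (sub_ne_zero.2 hne)
  have h2 := h (u - v)
  simp only [map_sub, sub_apply] at this h2
  linarith

variable [FiniteDimensional ℝ E]

/-- `sharp` is defined through `inverse`, which is meaningful only for invertible maps. Positive
definiteness gives injectivity, and equality of dimensions does the rest. -/
lemma exists_equiv (hL : IsLocalFinsler L U) (hz : z ∈ slit U) :
    ∃ e : E ≃L[ℝ] (E →L[ℝ] ℝ), (e : E →L[ℝ] E →L[ℝ] ℝ) = metric L z := by
  have hinj : Function.Injective (metric L z).toLinearMap := fun u v h =>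
    hL.metric_ext hz fun w => congrArg (fun T : E →L[ℝ] ℝ => T w) h
  have hdim : Module.finrank ℝ E = Module.finrank ℝ (E →L[ℝ] ℝ) := by
    rw [← (LinearMap.toContinuousLinearMap : (E →ₗ[ℝ] ℝ) ≃ₗ[ℝ] _).finrank_eq]
    exact (Subspace.dual_finrank_eq).symm
  refine ⟨(LinearEquiv.ofInjectiveOfFinrankEq _ hinj hdim).toContinuousLinearEquiv, ?_⟩
  ext u v
  rfl
 
lemma metric_sharp (hL : IsLocalFinsler L U) (hz : z ∈ slit U) (α : E →L[ℝ] ℝ) :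
    metric L z (sharp L z α) = α := by
  obtain ⟨e, he⟩ := hL.exists_equiv hz
  rw [sharp, ← he, ContinuousLinearMap.inverse_equiv]
  simp

lemma smooth_sharp (hL : IsLocalFinsler L U) (hz : z ∈ slit U) :
    ContDiffAt ℝ ∞ (sharp L) z := by
  obtain ⟨e, he⟩ := hL.exists_equiv hz
  have : CompleteSpace E := FiniteDimensional.complete ℝ E
  have h := contDiffAt_map_inverse (n := ∞) (𝕜 := ℝ) e
  rw [he] at h
  exact h.comp z (hL.smooth_metric hz)

lemma smooth_spray (hL : IsLocalFinsler L U) (hz : z ∈ slit U) :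
    ContDiffAt ℝ ∞ (spray L) z :=
  ((hL.smooth_sharp hz).clm_apply
    (((contDiffAt_xDeriv (hL.smooth_ySq hz)).clm_apply contDiffAt_snd).sub
      (hL.smooth_xSq hz))).const_smul (1 / 4 : ℝ)

lemma smooth_nonlinConn (hL : IsLocalFinsler L U) (hz : z ∈ slit U) :
    ContDiffAt ℝ ∞ (nonlinConn L) z :=
  contDiffAt_yDeriv (hL.smooth_spray hz)

lemma metric_spray (hL : IsLocalFinsler L U) (hz : z ∈ slit U) (v : E) :
    4 * metric L z (spray L z) v
      = xDeriv (yDeriv fun w => L w ^ 2) z z.2 v - xDeriv (fun w => L w ^ 2) z v := by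
  rw [spray, map_smul, hL.metric_sharp hz]
  simp

/-- The derivative of the definition of the spray in the direction of the fibre. -/
lemma metric_nonlinConn (hL : IsLocalFinsler L U) (hz : z ∈ slit U) (u v : E) :
    4 * (yDeriv (metric L) z u (spray L z) v + metric L z (nonlinConn L z u) v)
      = 2 * xDeriv (metric L) z z.2 u v
        + xDeriv (yDeriv fun w => L w ^ 2) z u v - xDeriv (yDeriv fun w => L w ^ 2) z v u := by
  have h := yDeriv_congr (hL.eventuallyEq hz (h := fun q => 4 * metric L q (spray L q) v)
    (k := fun q => xDeriv (yDeriv fun w => L w ^ 2) q q.2 v - xDeriv (fun w => L w ^ 2) q v)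
    fun q hq => hL.metric_spray hq v)
  have h := congrArg (fun T => T u) h
  have hs := (hL.smooth_spray hz).diffAt
  have hm := (hL.smooth_metric hz).diffAt
  have hxy := (contDiffAt_xDeriv (hL.smooth_ySq hz)).diffAt
  have hx := (hL.smooth_xSq hz).diffAt
  have h1 : yDeriv (fun q => 4 * metric L q (spray L q) v) z u
      = 4 * (yDeriv (metric L) z u (spray L z) v + metric L z (nonlinConn L z u) v) := by
    rw [yDeriv_apply, fderiv_const_mul ((hm.clm_apply hs).clm_apply (differentiableAt_const _)),
      smul_apply, fderiv_bilin hm hs (differentiableAt_const _)]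
    simp [yDeriv_apply, nonlinConn]
  have h2 : yDeriv (fun q => xDeriv (yDeriv fun w => L w ^ 2) q q.2 v
        - xDeriv (fun w => L w ^ 2) q v) z u
      = yDeriv (xDeriv (yDeriv fun w => L w ^ 2)) z u z.2 v
        + xDeriv (yDeriv fun w => L w ^ 2) z u v - yDeriv (xDeriv fun w => L w ^ 2) z u v := by
    rw [yDeriv_apply, fderiv_fun_sub
      ((hxy.clm_apply differentiableAt_snd).clm_apply (differentiableAt_const _))
      (hx.clm_apply (differentiableAt_const _)), sub_apply,
      fderiv_bilin hxy differentiableAt_snd (differentiableAt_const _),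
      fderiv_lin hx (differentiableAt_const _)]
    simp [yDeriv_apply, fderiv_snd]
  rw [h1, h2, ← xDeriv_yDeriv_comm (hL.smooth_ySq hz), ← xDeriv_yDeriv_comm (hL.smooth_sq hz)] at h
  rw [h, hL.xDeriv_metric hz]
  simp

/-- This is Euler's identity for the spray, of degree two. It is read off from the lowered formula
for N at u = y, where the Cartan tensor drops out. -/
lemma nonlinConn_self (hL : IsLocalFinsler L U) (hz : z ∈ slit U) :
    nonlinConn L z z.2 = (2 : ℝ) • spray L z := by
  refine hL.metric_ext hz fun v => ?_
  have h1 := hL.metric_nonlinConn hz z.2 v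
  have h2 := hL.metric_spray hz v
  have h3 := hL.xDeriv_ySq_self hz v
  have h4 := hL.xDeriv_metric_self hz z.2 v
  rw [hL.yDeriv_metric_symm₁₂ hz, hL.yDeriv_metric_symm₂₃ hz, hL.yDeriv_metric_self hz,
    hL.xDeriv_metric_symm₂₃ hz] at h1
  simp only [map_smul, smul_apply, smul_eq_mul]
  linarith

/-! ### The Cartan connection -/

lemma hDeriv_metric_apply (u v w : E) :
    hDeriv L (metric L) z u v w
      = xDeriv (metric L) z u v w - yDeriv (metric L) z (nonlinConn L z u) v w := by
  simp [hDeriv]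

lemma hDeriv_metric_symm (hL : IsLocalFinsler L U) (hz : z ∈ slit U) (u v w : E) :
    hDeriv L (metric L) z u v w = hDeriv L (metric L) z u w v := by
  rw [hDeriv_metric_apply, hDeriv_metric_apply, hL.yDeriv_metric_symm₂₃ hz,
    hL.xDeriv_metric_symm₂₃ hz]

lemma metric_cartanH (hL : IsLocalFinsler L U) (hz : z ∈ slit U) (u v w : E) :
    2 * metric L z (cartanH L z u v) w
      = hDeriv L (metric L) z u v w + hDeriv L (metric L) z v u w
        - hDeriv L (metric L) z w u v := by
  simp only [cartanH, smul_apply, ContinuousLinearMap.comp_apply, map_smul]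
  rw [hL.metric_sharp hz]
  simp

lemma metric_cartanV (hL : IsLocalFinsler L U) (hz : z ∈ slit U) (u v w : E) :
    2 * metric L z (cartanV L z u v) w = yDeriv (metric L) z v u w := by
  simp only [cartanV, smul_apply, ContinuousLinearMap.comp_apply, map_smul]
  rw [hL.metric_sharp hz]
  simp

lemma cartanV_symm (hL : IsLocalFinsler L U) (hz : z ∈ slit U) (u v : E) :
    cartanV L z u v = cartanV L z v u := by
  refine hL.metric_ext hz fun w => ?_
  have h1 := hL.metric_cartanV hz u v w
  have h2 := hL.metric_cartanV hz v u w
  rw [hL.yDeriv_metric_symm₁₂ hz] at h2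
  linarith

lemma cartanV_self_left (hL : IsLocalFinsler L U) (hz : z ∈ slit U) (v : E) :
    cartanV L z z.2 v = 0 := by
  refine hL.metric_ext hz fun w => ?_
  have h1 := hL.metric_cartanV hz z.2 v w
  rw [hL.yDeriv_metric_symm₂₃ hz, hL.yDeriv_metric_self hz] at h1
  simp only [map_zero, zero_apply]
  linarith

lemma cartanV_self_right (hL : IsLocalFinsler L U) (hz : z ∈ slit U) (v : E) :
    cartanV L z v z.2 = 0 := by
  rw [hL.cartanV_symm hz, hL.cartanV_self_left hz]

lemma metric_cartanV_self (hL : IsLocalFinsler L U) (hz : z ∈ slit U) (u v : E) :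
    metric L z (cartanV L z u v) z.2 = 0 := by
  have h1 := hL.metric_cartanV hz u v z.2
  rw [hL.yDeriv_metric_self hz] at h1
  linarith

/-- The horizontal part of the Cartan connection contracted with the canonical section is the
nonlinear connection. -/
lemma cartanH_self (hL : IsLocalFinsler L U) (hz : z ∈ slit U) (u : E) :
    cartanH L z u z.2 = nonlinConn L z u := by
  refine hL.metric_ext hz fun w => ?_
  have h1 := hL.metric_cartanH hz u z.2 w
  have h2 := hL.metric_nonlinConn hz u w
  simp only [hDeriv_metric_apply] at h1
  -- Of the three vertical terms in the horizontal derivatives, two contain the Cartan tensor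
  -- contracted with y and vanish. The third, along N y = 2G, is the one occurring in `h2`.
  rw [hL.nonlinConn_self hz, hL.yDeriv_metric_self hz, hL.yDeriv_metric_symm₂₃ hz,
    hL.yDeriv_metric_self hz, hL.xDeriv_metric_symm₂₃ hz u, hL.xDeriv_metric_self hz,
    hL.xDeriv_metric_self hz] at h1
  simp only [map_smul, smul_apply, smul_eq_mul] at h1
  rw [hL.yDeriv_metric_symm₁₂ hz] at h2
  linarith

/-- The Cartan connection along the canonical direction is metrical. -/
lemma metric_nonlinConn_add (hL : IsLocalFinsler L U) (hz : z ∈ slit U) (u v : E) :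
    metric L z (nonlinConn L z u) v + metric L z u (nonlinConn L z v)
      = xDeriv (metric L) z z.2 u v - 2 * yDeriv (metric L) z (spray L z) u v := by
  -- In the sum of these two formulas the derivatives along u and v cancel, and only the derivative
  -- of g along y survives.
  have h1 := hL.metric_cartanH hz u z.2 v
  have h2 := hL.metric_cartanH hz v z.2 u
  rw [hL.cartanH_self hz] at h1 h2
  rw [hL.metric_symm hz u]
  have h3 := hDeriv_metric_apply (L := L) (z := z) z.2 u v
  rw [hL.nonlinConn_self hz] at h3
  simp only [map_smul, smul_apply, smul_eq_mul] at h3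
  have h4 := hL.hDeriv_metric_symm hz z.2 u v
  have h5 := hL.hDeriv_metric_symm hz u v z.2
  have h6 := hL.hDeriv_metric_symm hz v u z.2
  linarith

lemma smooth_cartanV (hL : IsLocalFinsler L U) (hz : z ∈ slit U) {P : Type*}
    [NormedAddCommGroup P] [NormedSpace ℝ P] {p : P} {a : P → E × E} {b c : P → E}
    (hp : a p = z) (ha : ContDiffAt ℝ ∞ a p)
    (hb : ContDiffAt ℝ ∞ b p) (hc : ContDiffAt ℝ ∞ c p) :
    ContDiffAt ℝ ∞ (fun q => cartanV L (a q) (b q) (c q)) p := by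
  subst hp
  have h1 : ContDiffAt ℝ ∞ (fun q => sharp L (a q)) p := (hL.smooth_sharp hz).comp p ha
  have h2 : ContDiffAt ℝ ∞ (fun q => yDeriv (metric L) (a q)) p :=
    (contDiffAt_yDeriv (hL.smooth_metric hz)).comp p ha
  exact (h1.clm_apply ((h2.clm_apply hc).clm_apply hb)).const_smul (1 / 2 : ℝ)

end IsLocalFinsler

end LocalFinsler

/-! ### Homogeneity in the fibre variable. -/

section Scaling

variable {E : Type*} [NormedAddCommGroup E] [NormedSpace ℝ E]
variable {V : Type*} [NormedAddCommGroup V] [NormedSpace ℝ V]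
variable {L : E × E → ℝ} {U : Set E} {z : E × E}

namespace IsLocalFinsler

/-- The chain rule for the dilation (x, y) ↦ (x, r y). Consequently x-derivatives keep the degree of
homogeneity and y-derivatives lower it by one; this determines how all the local objects scale. -/
lemma fderiv_scale (hL : IsLocalFinsler L U) (hz : z ∈ slit U) {h : E × E → V} {r a : ℝ}
    (hr : 0 < r) (hh : ∀ w ∈ slit U, DifferentiableAt ℝ h w)
    (hs : ∀ w ∈ slit U, h (w.1, r • w.2) = a • h w) (ξ : E × E) :
    fderiv ℝ h (z.1, r • z.2) (ξ.1, r • ξ.2) = a • fderiv ℝ h z ξ := by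
  have h1 : HasFDerivAt (fun w : E × E => (w.1, r • w.2))
      ((ContinuousLinearMap.fst ℝ E E).prod (r • ContinuousLinearMap.snd ℝ E E)) z :=
    hasFDerivAt_fst.prodMk (hasFDerivAt_snd.const_smul r)
  have h2 := (hh _ (smul_mem_slit hz hr.ne')).hasFDerivAt.comp z h1
  have h3 := ((hh z hz).hasFDerivAt.const_smul a).congr_of_eventuallyEq
    (hL.eventuallyEq hz (h := h ∘ fun w : E × E => (w.1, r • w.2)) hs)
  have := congrArg (fun T => T ξ) (h2.unique h3)
  simpa using this

lemma xDeriv_scale (hL : IsLocalFinsler L U) (hz : z ∈ slit U) {h : E × E → V} {r a : ℝ}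
    (hr : 0 < r) (hh : ∀ w ∈ slit U, DifferentiableAt ℝ h w)
    (hs : ∀ w ∈ slit U, h (w.1, r • w.2) = a • h w) :
    xDeriv h (z.1, r • z.2) = a • xDeriv h z := by
  ext u
  simpa [xDeriv_apply] using hL.fderiv_scale hz hr hh hs (u, 0)

lemma yDeriv_scale (hL : IsLocalFinsler L U) (hz : z ∈ slit U) {h : E × E → V} {r a : ℝ}
    (hr : 0 < r) (hh : ∀ w ∈ slit U, DifferentiableAt ℝ h w)
    (hs : ∀ w ∈ slit U, h (w.1, r • w.2) = a • h w) :
    yDeriv h (z.1, r • z.2) = (a * r⁻¹) • yDeriv h z := by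
  ext u
  have := hL.fderiv_scale hz hr hh hs (0, r⁻¹ • u)
  rw [smul_smul, mul_inv_cancel₀ hr.ne', one_smul] at this
  rw [yDeriv_apply, this, smul_apply, yDeriv_apply, mul_smul, ← map_smul (fderiv ℝ h z) r⁻¹]
  simp

variable {r : ℝ}

lemma sq_scale (hL : IsLocalFinsler L U) (hz : z ∈ slit U) (hr : 0 < r) :
    L (z.1, r • z.2) ^ 2 = (r ^ 2) • L z ^ 2 := by
  rw [hL.homogeneous _ hz.1 _ _ hr, mul_pow, smul_eq_mul]

lemma ySq_scale (hL : IsLocalFinsler L U) (hz : z ∈ slit U) (hr : 0 < r) :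
    yDeriv (fun w => L w ^ 2) (z.1, r • z.2) = r • yDeriv (fun w => L w ^ 2) z := by
  rw [hL.yDeriv_scale hz hr (fun w hw => (hL.smooth_sq hw).diffAt)
    (fun w hw => hL.sq_scale hw hr)]
  congr 1
  field_simp

lemma metric_scale (hL : IsLocalFinsler L U) (hz : z ∈ slit U) (hr : 0 < r) :
    metric L (z.1, r • z.2) = metric L z := by
  rw [metric, hL.yDeriv_scale hz hr (fun w hw => (hL.smooth_ySq hw).diffAt)
    (fun w hw => hL.ySq_scale hw hr), mul_inv_cancel₀ hr.ne', one_smul]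
  rfl

lemma sharp_scale (hL : IsLocalFinsler L U) (hz : z ∈ slit U) (hr : 0 < r) :
    sharp L (z.1, r • z.2) = sharp L z := by
  rw [sharp, sharp, hL.metric_scale hz hr]

lemma spray_scale (hL : IsLocalFinsler L U) (hz : z ∈ slit U) (hr : 0 < r) :
    spray L (z.1, r • z.2) = r ^ 2 • spray L z := by
  rw [spray, spray, hL.sharp_scale hz hr,
    hL.xDeriv_scale hz hr (fun w hw => (hL.smooth_ySq hw).diffAt)
      (fun w hw => hL.ySq_scale hw hr),
    hL.xDeriv_scale hz hr (fun w hw => (hL.smooth_sq hw).diffAt)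
      (fun w hw => hL.sq_scale hw hr)]
  rw [smul_apply, map_smul, smul_smul, ← pow_two, ← smul_sub, map_smul, smul_comm]

lemma yDeriv_metric_scale (hL : IsLocalFinsler L U) (hz : z ∈ slit U) (hr : 0 < r) :
    yDeriv (metric L) (z.1, r • z.2) = r⁻¹ • yDeriv (metric L) z := by
  rw [hL.yDeriv_scale (a := 1) hz hr (fun w hw => (hL.smooth_metric hw).diffAt)
    (fun w hw => by rw [hL.metric_scale hw hr, one_smul]), one_mul]

lemma cartanV_scale (hL : IsLocalFinsler L U) (hz : z ∈ slit U) (hr : 0 < r) (u v : E) :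
    cartanV L (z.1, r • z.2) u v = r⁻¹ • cartanV L z u v := by
  simp only [cartanV, hL.sharp_scale hz hr, hL.yDeriv_metric_scale hz hr]
  simp only [smul_apply, ContinuousLinearMap.comp_apply, ContinuousLinearMap.flip_apply, map_smul]
  rw [smul_comm]

variable [FiniteDimensional ℝ E]

lemma nonlinConn_scale (hL : IsLocalFinsler L U) (hz : z ∈ slit U) (hr : 0 < r) :
    nonlinConn L (z.1, r • z.2) = r • nonlinConn L z := by
  rw [nonlinConn, hL.yDeriv_scale hz hr (fun w hw => (hL.smooth_spray hw).diffAt)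
    (fun w hw => hL.spray_scale hw hr)]
  rw [nonlinConn]
  congr 1
  field_simp

end IsLocalFinsler

end Scaling

/-! ### Curves, the Cartan derivative along their lifts, and the equation of geodesic circles. -/

section Curves

variable {E : Type*} [NormedAddCommGroup E] [NormedSpace ℝ E]
variable {L : E × E → ℝ} {U : Set E} {c : ℝ → E} {t : ℝ}

/-- `c` is smooth near `t`, lies in `U` and is regular at `t`. -/
structure IsRegularAt (U : Set E) (c : ℝ → E) (t : ℝ) : Prop where
  smooth : ∀ᶠ s in 𝓝 t, ContDiffAt ℝ ∞ c s
  mem : c t ∈ U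
  ne : deriv c t ≠ 0

/-- The acceleration `∇X/ds` of a curve. -/
def accel (L : E × E → ℝ) (c : ℝ → E) (t : ℝ) : E :=
  covDeriv L c (unitTangent L c) t

/-- The vector `∇∇X/ds² + ‖∇X/ds‖² X`, which vanishes along geodesic circles. -/
def circleDefect (L : E × E → ℝ) (c : ℝ → E) (t : ℝ) : E :=
  covDeriv L c (accel L c) t
    + metric L (curveLift L c t) (accel L c t) (accel L c t) • unitTangent L c t

/-- The speed of a curve. -/
def speed (L : E × E → ℝ) (c : ℝ → E) (t : ℝ) : ℝ := L (c t, deriv c t)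

namespace IsRegularAt

lemma contDiffAt (hc : IsRegularAt U c t) : ContDiffAt ℝ ∞ c t := hc.smooth.self_of_nhds

lemma contDiffAt_deriv' {c : ℝ → E} (h : ContDiffAt ℝ ∞ c t) : ContDiffAt ℝ ∞ (deriv c) t := by
  have := (h.fderiv_right (m := ∞) le_rfl).clm_apply (contDiffAt_const (c := (1 : ℝ)))
  exact this

lemma contDiffAt_deriv (hc : IsRegularAt U c t) : ContDiffAt ℝ ∞ (deriv c) t :=
  contDiffAt_deriv' hc.contDiffAt

lemma eventually (hc : IsRegularAt U c t) (hU : IsOpen U) : ∀ᶠ s in 𝓝 t, IsRegularAt U c s := by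
  have h1 := hc.contDiffAt.continuousAt.eventually_mem (hU.mem_nhds hc.mem)
  have h2 := hc.contDiffAt_deriv.continuousAt.eventually_ne hc.ne
  filter_upwards [eventually_eventually_nhds.2 hc.smooth, h1, h2] with s hs1 hs2 hs3
  exact ⟨hs1, hs2, hs3⟩

lemma mem_slit (hc : IsRegularAt U c t) : (c t, deriv c t) ∈ slit U := ⟨hc.mem, hc.ne⟩

lemma speed_pos (hc : IsRegularAt U c t) (hL : IsLocalFinsler L U) : 0 < speed L c t :=
  hL.pos hc.mem_slit

lemma contDiffAt_speed (hc : IsRegularAt U c t) (hL : IsLocalFinsler L U) :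
    ContDiffAt ℝ ∞ (speed L c) t :=
  (hL.smooth _ hc.mem_slit).comp (f := fun s => (c s, deriv c s)) t
    (hc.contDiffAt.prodMk hc.contDiffAt_deriv)

lemma contDiffAt_unitTangent (hc : IsRegularAt U c t) (hL : IsLocalFinsler L U) :
    ContDiffAt ℝ ∞ (unitTangent L c) t :=
  ((hc.contDiffAt_speed hL).inv (hc.speed_pos hL).ne').smul hc.contDiffAt_deriv

lemma contDiffAt_curveLift (hc : IsRegularAt U c t) (hL : IsLocalFinsler L U) :
    ContDiffAt ℝ ∞ (curveLift L c) t :=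
  hc.contDiffAt.prodMk (hc.contDiffAt_unitTangent hL)

lemma curveLift_mem (hc : IsRegularAt U c t) (hL : IsLocalFinsler L U) :
    curveLift L c t ∈ slit U :=
  smul_mem_slit hc.mem_slit (inv_ne_zero (hc.speed_pos hL).ne')

lemma deriv_eq (hc : IsRegularAt U c t) (hL : IsLocalFinsler L U) :
    deriv c t = speed L c t • unitTangent L c t := by
  rw [unitTangent, smul_smul]
  change _ = (speed L c t * (speed L c t)⁻¹) • _
  rw [mul_inv_cancel₀ (hc.speed_pos hL).ne', one_smul]

lemma deriv_curveLift (hc : IsRegularAt U c t) (hL : IsLocalFinsler L U) :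
    deriv (curveLift L c) t = (deriv c t, deriv (unitTangent L c) t) :=
  (hc.contDiffAt.diffAt.hasDerivAt.prodMk
    (hc.contDiffAt_unitTangent hL).diffAt.hasDerivAt).deriv

lemma curveLift_unit (hc : IsRegularAt U c t) (hL : IsLocalFinsler L U) :
    L (curveLift L c t) = 1 := by
  change L (c t, (speed L c t)⁻¹ • deriv c t) = 1
  rw [hL.homogeneous _ hc.mem _ _ (inv_pos.2 (hc.speed_pos hL))]
  exact inv_mul_cancel₀ (hc.speed_pos hL).ne'

lemma metric_unitTangent (hc : IsRegularAt U c t) (hL : IsLocalFinsler L U) :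
    metric L (curveLift L c t) (unitTangent L c t) (unitTangent L c t) = 1 := by
  have := hL.metric_self_self (hc.curveLift_mem hL)
  rw [hc.curveLift_unit hL, one_pow] at this
  exact this

variable [FiniteDimensional ℝ E]

/-- The velocity is a multiple of X, so Γ enters only contracted with the canonical section, where
it equals N. The full coefficients Γ are therefore never needed along curves. -/
lemma covDeriv_eq_aux (hc : IsRegularAt U c t) (hL : IsLocalFinsler L U) (W : ℝ → E) :
    covDeriv L c W t = (speed L c t)⁻¹ • deriv W t + nonlinConn L (curveLift L c t) (W t)
      + cartanV L (curveLift L c t) (W t) ((speed L c t)⁻¹ • deriv (unitTangent L c) t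
        + (2 : ℝ) • spray L (curveLift L c t)) := by
  have hz := hc.curveLift_mem hL
  have h1 : cartanH L (curveLift L c t) (W t) (unitTangent L c t)
      = nonlinConn L (curveLift L c t) (W t) := hL.cartanH_self hz _
  have h2 : nonlinConn L (curveLift L c t) (unitTangent L c t)
      = (2 : ℝ) • spray L (curveLift L c t) := hL.nonlinConn_self hz
  have hs := (hc.speed_pos hL).ne'
  rw [covDeriv, hc.deriv_curveLift hL, ← h2]
  change (speed L c t)⁻¹ • _ = _
  simp only [connForm, add_apply, ContinuousLinearMap.comp_apply,
    ContinuousLinearMap.coe_fst', ContinuousLinearMap.coe_snd']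
  rw [hc.deriv_eq hL, map_smul, map_smul, h1, smul_add, smul_add, smul_smul,
    inv_mul_cancel₀ hs, one_smul, ← add_assoc, ← map_smul, smul_add, smul_smul,
    inv_mul_cancel₀ hs, one_smul]

/-- The Cartan tensor annihilates X and N X = 2G, which leaves the left side of the geodesic
equation. -/
lemma accel_eq (hc : IsRegularAt U c t) (hL : IsLocalFinsler L U) :
    accel L c t = (speed L c t)⁻¹ • deriv (unitTangent L c) t
      + (2 : ℝ) • spray L (curveLift L c t) := by
  have hz := hc.curveLift_mem hL
  have h2 : nonlinConn L (curveLift L c t) (unitTangent L c t)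
      = (2 : ℝ) • spray L (curveLift L c t) := hL.nonlinConn_self hz
  have h3 (v : E) : cartanV L (curveLift L c t) (unitTangent L c t) v = 0 :=
    hL.cartanV_self_left hz v
  rw [accel, hc.covDeriv_eq_aux hL, h2, h3, add_zero]

/-- The Cartan covariant derivative along a curve in terms of the nonlinear connection and the
Cartan tensor. -/
lemma covDeriv_eq (hc : IsRegularAt U c t) (hL : IsLocalFinsler L U) (W : ℝ → E) :
    covDeriv L c W t = (speed L c t)⁻¹ • deriv W t + nonlinConn L (curveLift L c t) (W t)
      + cartanV L (curveLift L c t) (W t) (accel L c t) := by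
  rw [hc.covDeriv_eq_aux hL, hc.accel_eq hL]

lemma contDiffAt_accel (hc : IsRegularAt U c t) (hL : IsLocalFinsler L U) :
    ContDiffAt ℝ ∞ (accel L c) t := by
  have h1 : accel L c =ᶠ[𝓝 t] fun t => (speed L c t)⁻¹ • deriv (unitTangent L c) t
      + (2 : ℝ) • spray L (curveLift L c t) :=
    (hc.eventually hL.isOpen).mono fun s hs => hs.accel_eq hL
  refine ContDiffAt.congr_of_eventuallyEq ?_ h1
  refine (((hc.contDiffAt_speed hL).inv (hc.speed_pos hL).ne').smul
    (contDiffAt_deriv' (hc.contDiffAt_unitTangent hL))).add (ContDiffAt.const_smul _ ?_)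
  exact (hL.smooth_spray (hc.curveLift_mem hL)).comp t (hc.contDiffAt_curveLift hL)

end IsRegularAt

lemma HasDerivAt.bilin {m : ℝ → E →L[ℝ] E →L[ℝ] ℝ} {a b : ℝ → E}
    {m' : E →L[ℝ] E →L[ℝ] ℝ} {a' b' : E}
    (hm : HasDerivAt m m' t) (ha : HasDerivAt a a' t) (hb : HasDerivAt b b' t) :
    HasDerivAt (fun s => m s (a s) (b s))
      (m' (a t) (b t) + m t a' (b t) + m t (a t) b') t := by
  have := (hm.clm_apply ha).clm_apply hb
  exact this.congr_deriv (by simp)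

variable [FiniteDimensional ℝ E]

/-- Metric compatibility of the Cartan connection along a curve `z` in the slit tangent bundle
that lifts its projection. -/
lemma IsLocalFinsler.hasDerivAt_metric (hL : IsLocalFinsler L U) {z : ℝ → E × E} {lam : ℝ} {w : E}
    (hz : z t ∈ slit U)
    (hd : HasDerivAt z (lam • ((z t).2, w - (2 : ℝ) • spray L (z t))) t)
    {a b : ℝ → E} {a' b' : E}
    (ha : HasDerivAt a (lam • (a' - nonlinConn L (z t) (a t) - cartanV L (z t) (a t) w)) t)
    (hb : HasDerivAt b (lam • (b' - nonlinConn L (z t) (b t) - cartanV L (z t) (b t) w)) t) :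
    HasDerivAt (fun s => metric L (z s) (a s) (b s))
      (lam * (metric L (z t) a' (b t) + metric L (z t) (a t) b')) t := by
  have hm := (hL.smooth_metric hz).diffAt.hasFDerivAt.comp_hasDerivAt t hd
  refine (HasDerivAt.bilin hm ha hb).congr_deriv ?_
  rw [fderiv_eq_xDeriv_add_yDeriv]
  -- `h1` matches the derivative of g along (y, -2G) with the terms in N; `h2` and `h3` each account
  -- for half of the remaining vertical derivative along w.
  have h1 := hL.metric_nonlinConn_add hz (a t) (b t)
  have h2 := hL.metric_cartanV hz (a t) w (b t)
  have h3 := hL.metric_cartanV hz (b t) w (a t)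
  rw [hL.yDeriv_metric_symm₂₃ hz, hL.metric_symm hz] at h3
  simp only [Prod.smul_fst, Prod.smul_snd, map_smul, map_sub, smul_apply, sub_apply,
    add_apply, smul_eq_mul, Function.comp_apply]
  linear_combination (-lam) * h1 - (lam / 2) * h2 - (lam / 2) * h3

namespace IsRegularAt

/-- Solves the formula for ∇a/ds for the ordinary derivative, in the shape required by
`IsLocalFinsler.hasDerivAt_metric`. -/
lemma hasDerivAt_field (hc : IsRegularAt U c t) (hL : IsLocalFinsler L U) {a : ℝ → E}
    (ha : DifferentiableAt ℝ a t) :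
    HasDerivAt a (speed L c t • (covDeriv L c a t - nonlinConn L (curveLift L c t) (a t)
      - cartanV L (curveLift L c t) (a t) (accel L c t))) t := by
  refine ha.hasDerivAt.congr_deriv ?_
  rw [hc.covDeriv_eq hL, add_sub_right_comm, add_sub_cancel_right, add_sub_cancel_right,
    smul_smul, mul_inv_cancel₀ (hc.speed_pos hL).ne', one_smul]

lemma hasDerivAt_curveLift (hc : IsRegularAt U c t) (hL : IsLocalFinsler L U) :
    HasDerivAt (curveLift L c) (speed L c t • ((curveLift L c t).2,
      accel L c t - (2 : ℝ) • spray L (curveLift L c t))) t := by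
  refine (hc.contDiffAt_curveLift hL).diffAt.hasDerivAt.congr_deriv ?_
  rw [hc.deriv_curveLift hL, hc.accel_eq hL, add_sub_cancel_right, Prod.smul_mk, smul_smul,
    mul_inv_cancel₀ (hc.speed_pos hL).ne', one_smul]
  exact congrArg (fun v => (v, _)) (hc.deriv_eq hL)

/-- Metric compatibility of the Cartan covariant derivative along a curve. -/
lemma hasDerivAt_metric (hc : IsRegularAt U c t) (hL : IsLocalFinsler L U) {a b : ℝ → E}
    (ha : DifferentiableAt ℝ a t) (hb : DifferentiableAt ℝ b t) :
    HasDerivAt (fun s => metric L (curveLift L c s) (a s) (b s))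
      (speed L c t * (metric L (curveLift L c t) (covDeriv L c a t) (b t)
        + metric L (curveLift L c t) (a t) (covDeriv L c b t))) t :=
  hL.hasDerivAt_metric (hc.curveLift_mem hL) (hc.hasDerivAt_curveLift hL)
    (hc.hasDerivAt_field hL ha) (hc.hasDerivAt_field hL hb)

/-- Differentiate g(X, X) = 1. -/
lemma metric_unitTangent_accel (hc : IsRegularAt U c t) (hL : IsLocalFinsler L U) :
    metric L (curveLift L c t) (unitTangent L c t) (accel L c t) = 0 := by
  have hX := (hc.contDiffAt_unitTangent hL).diffAt
  have h1 := hc.hasDerivAt_metric hL hX hX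
  have h2 : (fun s => metric L (curveLift L c s) (unitTangent L c s) (unitTangent L c s))
      =ᶠ[𝓝 t] fun _ => 1 :=
    (hc.eventually hL.isOpen).mono fun s hs => hs.metric_unitTangent hL
  have h3 := h1.unique ((hasDerivAt_const t (1 : ℝ)).congr_of_eventuallyEq h2)
  rw [hL.metric_symm (hc.curveLift_mem hL) (covDeriv L c _ t)] at h3
  have h4 := (mul_eq_zero.1 h3).resolve_left (hc.speed_pos hL).ne'
  change metric L (curveLift L c t) (unitTangent L c t) (covDeriv L c (unitTangent L c) t) = 0
  linarith

/-! ### Geodesic circles -/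

lemma covDeriv_congr {a b : ℝ → E} (h : a =ᶠ[𝓝 t] b) : covDeriv L c a t = covDeriv L c b t := by
  rw [covDeriv, covDeriv, h.deriv_eq, h.self_of_nhds]

lemma covDeriv_const_smul (hc : IsRegularAt U c t) (hL : IsLocalFinsler L U) {a : ℝ → E}
    (ha : DifferentiableAt ℝ a t) (k : ℝ) :
    covDeriv L c (fun s => k • a s) t = k • covDeriv L c a t := by
  rw [hc.covDeriv_eq hL, hc.covDeriv_eq hL, deriv_fun_const_smul _ ha]
  rw [hL.cartanV_symm (hc.curveLift_mem hL), hL.cartanV_symm (hc.curveLift_mem hL) (a t)]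
  simp only [map_smul, smul_add]
  rw [smul_comm]

lemma gNorm_eq_zero_iff {z : E × E} (hL : IsLocalFinsler L U) (hz : z ∈ slit U) (w : E) :
    gNorm L z w = 0 ↔ w = 0 := by
  constructor
  · intro h
    by_contra hw
    exact (Real.sqrt_pos.2 (hL.posDef z hz w hw)).ne' h
  · rintro rfl
    simp [gNorm]

lemma metric_self_nonneg {z : E × E} (hL : IsLocalFinsler L U) (hz : z ∈ slit U) (w : E) :
    0 ≤ metric L z w w := by
  by_cases hw : w = 0
  · simp [hw]
  · exact (hL.posDef z hz w hw).le

lemma curvature₁_sq (hc : IsRegularAt U c t) (hL : IsLocalFinsler L U) :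
    curvature₁ L c t ^ 2 = metric L (curveLift L c t) (accel L c t) (accel L c t) :=
  Real.sq_sqrt (metric_self_nonneg hL (hc.curveLift_mem hL) _)

/-- Where the first Frenet curvature is constant, the second Frenet curvature vanishes if and only
if the third order equation of geodesic circles holds. -/
lemma curvature₂_eq_zero_iff (hc : IsRegularAt U c t) (hL : IsLocalFinsler L U) {κ : ℝ}
    (hκ : ∀ᶠ s in 𝓝 t, curvature₁ L c s = κ) :
    curvature₂ L c t = 0 ↔ circleDefect L c t = 0 := by
  have hz := hc.curveLift_mem hL
  rw [curvature₂, gNorm_eq_zero_iff hL hz]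
  -- If κ = 0, the acceleration vanishes near t and the convention 0⁻¹ = 0 makes the principal
  -- normal vanish too, so both vectors are zero. Otherwise they differ by the factor κ⁻¹.
  by_cases h0 : κ = 0
  · have h1 : accel L c =ᶠ[𝓝 t] fun s => (0 : ℝ) • accel L c s := by
      filter_upwards [hκ, hc.eventually hL.isOpen] with s hs hcs
      rw [h0, curvature₁, gNorm_eq_zero_iff hL (hcs.curveLift_mem hL)] at hs
      simpa [accel] using hs
    have h2 : principalNormal L c =ᶠ[𝓝 t] fun s => (0 : ℝ) • accel L c s := by
      filter_upwards [hκ] with s hs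
      rw [principalNormal, hs, h0, inv_zero, accel]
    have h3 : accel L c t = 0 := by simpa using h1.self_of_nhds
    rw [circleDefect, covDeriv_congr h2, covDeriv_congr h1, hκ.self_of_nhds, h0, h3]
    simp
  · have h2 : principalNormal L c =ᶠ[𝓝 t] fun s => κ⁻¹ • accel L c s := by
      filter_upwards [hκ] with s hs
      rw [principalNormal, hs, accel]
    rw [circleDefect, covDeriv_congr h2,
      hc.covDeriv_const_smul hL (hc.contDiffAt_accel hL).diffAt, ← hc.curvature₁_sq hL,
      hκ.self_of_nhds]
    have : κ⁻¹ • covDeriv L c (accel L c) t + κ • unitTangent L c t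
        = κ⁻¹ • (covDeriv L c (accel L c) t + κ ^ 2 • unitTangent L c t) := by
      rw [smul_add, smul_smul]
      congr 2
      field_simp
    rw [this, smul_eq_zero]
    simp [h0]

/-- The first Frenet curvature of a solution of the equation of geodesic circles is constant. -/
lemma hasDerivAt_curvature₁_sq (hc : IsRegularAt U c t) (hL : IsLocalFinsler L U)
    (h : circleDefect L c t = 0) : HasDerivAt (fun s => curvature₁ L c s ^ 2) 0 t := by
  have hW := (hc.contDiffAt_accel hL).diffAt
  have hz := hc.curveLift_mem hL
  have h1 := hc.hasDerivAt_metric hL hW hW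
  have h2 : (fun s => curvature₁ L c s ^ 2)
      =ᶠ[𝓝 t] fun s => metric L (curveLift L c s) (accel L c s) (accel L c s) :=
    (hc.eventually hL.isOpen).mono fun s hs => hs.curvature₁_sq hL
  refine (h1.congr_of_eventuallyEq h2).congr_deriv ?_
  -- By the equation ∇W/ds is a multiple of X, which is orthogonal to W; hence the derivative 2
  -- g(∇W/ds, W) of κ₁² along arc length is zero.
  have h3 : covDeriv L c (accel L c) t
      = -(metric L (curveLift L c t) (accel L c t) (accel L c t) • unitTangent L c t) :=
    eq_neg_of_add_eq_zero_left h
  have h4 := hc.metric_unitTangent_accel hL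
  rw [hL.metric_symm hz (accel L c t), h3]
  simp [h4]

end IsRegularAt

end Curves

/-! ### The gradient as a direction-dependent vector field. -/

section Gradient

variable {E : Type*} [NormedAddCommGroup E] [NormedSpace ℝ E] [FiniteDimensional ℝ E]
variable {V : Type*} [NormedAddCommGroup V] [NormedSpace ℝ V]
variable {L : E × E → ℝ} {U : Set E} {z : E × E} {φ : E → ℝ}

namespace IsLocalFinsler

lemma metric_grad (hL : IsLocalFinsler L U) (hz : z ∈ slit U) (v : E) :
    metric L z (grad L φ z) v = fderiv ℝ φ z.1 v := by
  rw [grad, hL.metric_sharp hz]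

lemma metric_grad_right (hL : IsLocalFinsler L U) (hz : z ∈ slit U) (v : E) :
    metric L z v (grad L φ z) = fderiv ℝ φ z.1 v := by
  rw [hL.metric_symm hz, hL.metric_grad hz]

lemma smooth_grad (hL : IsLocalFinsler L U) (hφ : ∀ x ∈ U, ContDiffAt ℝ ∞ φ x)
    (hz : z ∈ slit U) : ContDiffAt ℝ ∞ (grad L φ) z := by
  refine (hL.smooth_sharp hz).clm_apply ?_
  have h1 : ContDiffAt ℝ ∞ (fderiv ℝ φ) z.1 := (hφ z.1 hz.1).fderiv_right (m := ∞) le_rfl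
  exact h1.comp z contDiffAt_fst

lemma metric_yDeriv_grad (hL : IsLocalFinsler L U) (hφ : ∀ x ∈ U, ContDiffAt ℝ ∞ φ x)
    (hz : z ∈ slit U) (u v : E) :
    metric L z (yDeriv (grad L φ) z u) v = - yDeriv (metric L) z u (grad L φ z) v := by
  have h := yDeriv_congr (hL.eventuallyEq hz (h := fun q => metric L q (grad L φ q) v)
    (k := fun q => fderiv ℝ φ q.1 v) fun q hq => hL.metric_grad hq v)
  have h := congrArg (fun T => T u) h
  have h1 : ContDiffAt ℝ ∞ (fderiv ℝ φ) z.1 := (hφ z.1 hz.1).fderiv_right (m := ∞) le_rfl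
  have h2 := yDeriv_comp_fst (z := z) (φ := fun x => fderiv ℝ φ x v)
    (h1.diffAt.clm_apply (differentiableAt_const v))
  rw [yDeriv_bilin (hL.smooth_metric hz).diffAt (hL.smooth_grad hφ hz).diffAt
    (differentiableAt_const _), h2, yDeriv_const] at h
  simp only [zero_apply, map_zero, add_zero] at h
  linarith

lemma metric_xDeriv_grad (hL : IsLocalFinsler L U) (hφ : ∀ x ∈ U, ContDiffAt ℝ ∞ φ x)
    (hz : z ∈ slit U) (u v : E) :
    metric L z (xDeriv (grad L φ) z u) v
      = fderiv ℝ (fderiv ℝ φ) z.1 u v - xDeriv (metric L) z u (grad L φ z) v := by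
  have h := xDeriv_congr (hL.eventuallyEq hz (h := fun q => metric L q (grad L φ q) v)
    (k := fun q => fderiv ℝ φ q.1 v) fun q hq => hL.metric_grad hq v)
  have h := congrArg (fun T => T u) h
  have h1 : ContDiffAt ℝ ∞ (fderiv ℝ φ) z.1 := (hφ z.1 hz.1).fderiv_right (m := ∞) le_rfl
  have h2 := xDeriv_comp_fst (z := z) (φ := fun x => fderiv ℝ φ x v)
    (h1.diffAt.clm_apply (differentiableAt_const v))
  rw [xDeriv_bilin (hL.smooth_metric hz).diffAt (hL.smooth_grad hφ hz).diffAt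
    (differentiableAt_const _), h2, xDeriv_const,
    fderiv_lin h1.diffAt (differentiableAt_const v)] at h
  simp only [zero_apply, map_zero, add_zero, fderiv_fun_const, Pi.zero_apply] at h
  linarith

/-- Differentiate g(grad φ, v) = dφ(v), whose right side does not involve y. Thus the gradient is
independent of direction exactly when the Cartan tensor annihilates it. -/
lemma yDeriv_grad (hL : IsLocalFinsler L U) (hφ : ∀ x ∈ U, ContDiffAt ℝ ∞ φ x)
    (hz : z ∈ slit U) (u : E) :
    yDeriv (grad L φ) z u = -((2 : ℝ) • cartanV L z (grad L φ z) u) := by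
  refine hL.metric_ext hz fun v => ?_
  rw [hL.metric_yDeriv_grad hφ hz, ← hL.metric_cartanV hz]
  simp

lemma grad_scale (hL : IsLocalFinsler L U) (hz : z ∈ slit U) {r : ℝ} (hr : 0 < r) :
    grad L φ (z.1, r • z.2) = grad L φ z := by
  rw [grad, grad, hL.sharp_scale hz hr]

end IsLocalFinsler

end Gradient

/-! ### Conformal change of the spray, the connection and the acceleration. -/

section Conformal

variable {E : Type*} [NormedAddCommGroup E] [NormedSpace ℝ E]
variable {V : Type*} [NormedAddCommGroup V] [NormedSpace ℝ V]

lemma yDeriv_fst_smul {ρ : E → ℝ} {h : E × E → V} {z : E × E} (hρ : DifferentiableAt ℝ ρ z.1)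
    (hh : DifferentiableAt ℝ h z) :
    yDeriv (fun w => ρ w.1 • h w) z = ρ z.1 • yDeriv h z := by
  ext u
  have h1 := yDeriv_comp_fst hρ
  have h2 : DifferentiableAt ℝ (fun w : E × E => ρ w.1) z := hρ.comp z differentiableAt_fst
  rw [yDeriv_apply, fderiv_fun_smul h2 hh]
  have h3 := congrArg (fun T => T u) h1
  rw [yDeriv_apply] at h3
  simp only [add_apply, smul_apply, ContinuousLinearMap.smulRight_apply, h3, zero_apply, zero_smul,
    add_zero, yDeriv_apply]

lemma xDeriv_fst_smul {ρ : E → ℝ} {h : E × E → V} {z : E × E} (hρ : DifferentiableAt ℝ ρ z.1)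
    (hh : DifferentiableAt ℝ h z) (u : E) :
    xDeriv (fun w => ρ w.1 • h w) z u = fderiv ℝ ρ z.1 u • h z + ρ z.1 • xDeriv h z u := by
  have h1 := xDeriv_comp_fst hρ
  have h2 : DifferentiableAt ℝ (fun w : E × E => ρ w.1) z := hρ.comp z differentiableAt_fst
  rw [xDeriv_apply, fderiv_fun_smul h2 hh]
  have h3 := congrArg (fun T => T u) h1
  rw [xDeriv_apply] at h3
  simp only [add_apply, smul_apply, ContinuousLinearMap.smulRight_apply, h3, xDeriv_apply]
  abel

/-- `L' = e^φ L` for two Finsler structures on `U`. -/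
structure IsConformalPair (L L' : E × E → ℝ) (U : Set E) (φ : E → ℝ) : Prop where
  left : IsLocalFinsler L U
  right : IsLocalFinsler L' U
  factor : ∀ x ∈ U, ContDiffAt ℝ ∞ φ x
  eq : ∀ x ∈ U, ∀ y, L' (x, y) = Real.exp (φ x) * L (x, y)

variable {L L' : E × E → ℝ} {U : Set E} {φ : E → ℝ} {z : E × E}

namespace IsConformalPair

lemma hasFDerivAt_exp (h : IsConformalPair L L' U φ) {x : E} (hx : x ∈ U) :
    HasFDerivAt (fun x => Real.exp (2 * φ x)) ((2 * Real.exp (2 * φ x)) • fderiv ℝ φ x) x := by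
  have h1 := (((h.factor x hx).diffAt.hasFDerivAt).const_mul 2).exp
  refine h1.congr_fderiv ?_
  ext u
  simp
  ring

lemma sq_eq (h : IsConformalPair L L' U φ) (hz : z ∈ slit U) :
    L' z ^ 2 = Real.exp (2 * φ z.1) • L z ^ 2 := by
  have := h.eq z.1 hz.1 z.2
  rw [Prod.mk.eta] at this
  rw [this, mul_pow, ← Real.exp_nat_mul, smul_eq_mul]
  simp

lemma ySq_eq (h : IsConformalPair L L' U φ) (hz : z ∈ slit U) :
    yDeriv (fun w => L' w ^ 2) z = Real.exp (2 * φ z.1) • yDeriv (fun w => L w ^ 2) z := by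
  rw [yDeriv_congr (h.left.eventuallyEq hz fun w hw => h.sq_eq hw)]
  exact yDeriv_fst_smul (h.hasFDerivAt_exp hz.1).differentiableAt (h.left.smooth_sq hz).diffAt

lemma metric_eq (h : IsConformalPair L L' U φ) (hz : z ∈ slit U) :
    metric L' z = Real.exp (2 * φ z.1) • metric L z := by
  rw [metric, metric, yDeriv_congr (h.left.eventuallyEq hz fun w hw => h.ySq_eq hw),
    yDeriv_fst_smul (h.hasFDerivAt_exp hz.1).differentiableAt (h.left.smooth_ySq hz).diffAt,
    smul_comm]

variable [FiniteDimensional ℝ E]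

/-- The two extra terms come from the x-derivatives falling on e^{2φ} in the two terms of the
lowered spray. -/
lemma spray_eq (h : IsConformalPair L L' U φ) (hz : z ∈ slit U) :
    spray L' z = spray L z + fderiv ℝ φ z.1 z.2 • z.2 - (L z ^ 2 / 2) • grad L φ z := by
  refine h.right.metric_ext hz fun v => ?_
  have h1 := h.right.metric_spray hz v
  have h2 := h.left.metric_spray hz v
  have hρ := h.hasFDerivAt_exp hz.1
  have h3 : xDeriv (fun w => L' w ^ 2) z v
      = (2 * Real.exp (2 * φ z.1) * fderiv ℝ φ z.1 v) * L z ^ 2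
        + Real.exp (2 * φ z.1) * xDeriv (fun w => L w ^ 2) z v := by
    rw [xDeriv_congr (h.left.eventuallyEq hz fun w hw => h.sq_eq hw),
      xDeriv_fst_smul hρ.differentiableAt (h.left.smooth_sq hz).diffAt, hρ.fderiv]
    simp
  have h4 : xDeriv (yDeriv fun w => L' w ^ 2) z z.2 v
      = (2 * Real.exp (2 * φ z.1) * fderiv ℝ φ z.1 z.2) * yDeriv (fun w => L w ^ 2) z v
        + Real.exp (2 * φ z.1) * xDeriv (yDeriv fun w => L w ^ 2) z z.2 v := by
    rw [xDeriv_congr (h.left.eventuallyEq hz fun w hw => h.ySq_eq hw),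
      xDeriv_fst_smul hρ.differentiableAt (h.left.smooth_ySq hz).diffAt, hρ.fderiv]
    simp
  rw [h3, h4] at h1
  have h5 := h.left.metric_self_left hz v
  have h6 := h.left.metric_grad (φ := φ) hz v
  simp only [h.metric_eq hz, map_add, map_sub, map_smul, smul_apply, add_apply, sub_apply,
    smul_eq_mul] at h1 ⊢
  rw [h5, h6]
  linear_combination (1 / 4) * h1 - (Real.exp (2 * φ z.1) / 4) * h2

/-- The fibre derivative of the law for the spray. The Cartan term appears because grad φ itself
depends on y. -/
lemma nonlinConn_eq (h : IsConformalPair L L' U φ) (hz : z ∈ slit U) (u : E) :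
    nonlinConn L' z u = nonlinConn L z u + fderiv ℝ φ z.1 u • z.2 + fderiv ℝ φ z.1 z.2 • u
      - metric L z z.2 u • grad L φ z + L z ^ 2 • cartanV L z (grad L φ z) u := by
  have e1 := yDeriv_congr (h.left.eventuallyEq hz fun w hw => h.spray_eq hw)
  have h0 : ContDiffAt ℝ ∞ (fderiv ℝ φ) z.1 := (h.factor z.1 hz.1).fderiv_right (m := ∞) le_rfl
  have hφ : DifferentiableAt ℝ (fun w : E × E => fderiv ℝ φ w.1) z :=
    h0.diffAt.comp z differentiableAt_fst
  have hφy : DifferentiableAt ℝ (fun w : E × E => fderiv ℝ φ w.1 w.2) z :=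
    hφ.clm_apply differentiableAt_snd
  have hs := (h.left.smooth_spray hz).diffAt
  have hg := (h.left.smooth_grad h.factor hz).diffAt
  have hq := (h.left.smooth_sq hz).diffAt
  have hq2 : DifferentiableAt ℝ (fun w => L w ^ 2 / 2) z := by
    simpa [div_eq_inv_mul] using hq.const_mul (2⁻¹ : ℝ)
  have h1 : fderiv ℝ (fun w : E × E => fderiv ℝ φ w.1 w.2) z (0, u) = fderiv ℝ φ z.1 u := by
    rw [fderiv_lin hφ differentiableAt_snd]
    have := congrArg (fun T => T u) (yDeriv_comp_fst (z := z) h0.diffAt)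
    rw [yDeriv_apply] at this
    rw [this]
    simp [fderiv_snd]
  have h2 : fderiv ℝ (fun w => L w ^ 2 / 2) z (0, u) = metric L z z.2 u := by
    rw [h.left.metric_self_left hz, yDeriv_apply]
    simp_rw [div_eq_inv_mul]
    rw [fderiv_const_mul hq]
    simp
  have h3 := h.left.yDeriv_grad h.factor hz u
  rw [yDeriv_apply] at h3
  rw [nonlinConn, e1, yDeriv_apply, fderiv_fun_sub (hs.fun_add (hφy.fun_smul differentiableAt_snd))
    (hq2.fun_smul hg), fderiv_fun_add hs (hφy.fun_smul differentiableAt_snd),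
    fderiv_fun_smul hφy differentiableAt_snd, fderiv_fun_smul hq2 hg]
  simp only [sub_apply, add_apply, smul_apply, ContinuousLinearMap.smulRight_apply, h1, h2, h3,
    fderiv_snd, ContinuousLinearMap.coe_snd']
  rw [nonlinConn, yDeriv_apply]
  module

/-- The factor e^{2φ} is constant along fibres, so it cancels against its inverse once the index is
raised. -/
lemma cartanV_eq (h : IsConformalPair L L' U φ) (hz : z ∈ slit U) (u v : E) :
    cartanV L' z u v = cartanV L z u v := by
  refine h.right.metric_ext hz fun w => ?_
  have h1 := h.right.metric_cartanV hz u v w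
  have h2 := h.left.metric_cartanV hz u v w
  rw [yDeriv_congr (h.left.eventuallyEq hz fun w hw => h.metric_eq hw),
    yDeriv_fst_smul (h.hasFDerivAt_exp hz.1).differentiableAt (h.left.smooth_metric hz).diffAt]
    at h1
  simp only [h.metric_eq hz, smul_apply, smul_eq_mul] at h1 ⊢
  linear_combination (1 / 2) * h1 - (Real.exp (2 * φ z.1) / 2) * h2

/-! ### Curves under a conformal change -/

variable {c : ℝ → E} {t : ℝ}

lemma speed_eq (h : IsConformalPair L L' U φ) (hc : IsRegularAt U c t) :
    speed L' c t = Real.exp (φ (c t)) * speed L c t :=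
  h.eq _ hc.mem _

lemma unitTangent_eq (h : IsConformalPair L L' U φ) (hc : IsRegularAt U c t) :
    unitTangent L' c t = Real.exp (-φ (c t)) • unitTangent L c t := by
  change (speed L' c t)⁻¹ • _ = _ • (speed L c t)⁻¹ • _
  rw [h.speed_eq hc, smul_smul, mul_inv, Real.exp_neg]

lemma curveLift_eq (h : IsConformalPair L L' U φ) (hc : IsRegularAt U c t) :
    curveLift L' c t
      = ((curveLift L c t).1, Real.exp (-φ (c t)) • (curveLift L c t).2) := by
  rw [curveLift, h.unitTangent_eq hc]
  rfl

lemma hasDerivAt_exp_neg (h : IsConformalPair L L' U φ) (hc : IsRegularAt U c t) (k : ℝ) :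
    HasDerivAt (fun s => Real.exp (-(k * φ (c s))))
      (-(k * (speed L c t * fderiv ℝ φ (c t) (unitTangent L c t))) * Real.exp (-(k * φ (c t)))) t := by
  have h1 : HasDerivAt (fun s => φ (c s)) (fderiv ℝ φ (c t) (deriv c t)) t :=
    (h.factor _ hc.mem).diffAt.hasFDerivAt.comp_hasDerivAt t hc.contDiffAt.diffAt.hasDerivAt
  refine (h1.const_mul k).neg.exp.congr_deriv ?_
  rw [hc.deriv_eq h.left]
  simp
  ring

lemma accel_eq (h : IsConformalPair L L' U φ) (hc : IsRegularAt U c t) :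
    accel L' c t = Real.exp (-(2 * φ (c t))) • (accel L c t
      + fderiv ℝ φ (c t) (unitTangent L c t) • unitTangent L c t - grad L φ (curveLift L c t)) := by
  have hz := hc.curveLift_mem h.left
  have hX := (hc.contDiffAt_unitTangent h.left).diffAt
  have h1 : deriv (unitTangent L' c) t = Real.exp (-φ (c t)) • deriv (unitTangent L c) t
      - (speed L c t * fderiv ℝ φ (c t) (unitTangent L c t) * Real.exp (-φ (c t)))
        • unitTangent L c t := by
    have e : unitTangent L' c =ᶠ[𝓝 t] fun s => Real.exp (-(1 * φ (c s))) • unitTangent L c s :=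
      (hc.eventually h.left.isOpen).mono fun s hs => by
        simpa using h.unitTangent_eq hs
    rw [e.deriv_eq, ((h.hasDerivAt_exp_neg hc 1).fun_smul hX.hasDerivAt).deriv]
    simp only [one_mul]
    module
  have hk : 0 < Real.exp (-φ (c t)) := Real.exp_pos _
  have hs := (hc.speed_pos h.left).ne'
  have e2 : Real.exp (-(2 * φ (c t))) = Real.exp (-φ (c t)) ^ 2 := by
    rw [← Real.exp_nat_mul]; congr 1; push_cast; ring
  have e3 : Real.exp (φ (c t)) = (Real.exp (-φ (c t)))⁻¹ := by rw [Real.exp_neg, inv_inv]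
  rw [hc.accel_eq h.right, hc.accel_eq h.left, h1, h.speed_eq hc, h.curveLift_eq hc,
    h.right.spray_scale hz hk, h.spray_eq hz, hc.curveLift_unit h.left, e2, e3]
  -- All exponentials have been written as powers of k = e^{-φ}, so the identity becomes one between
  -- rational coefficients.
  generalize Real.exp (-φ (c t)) = k at *
  change _ + (2 : ℝ) • k ^ 2 • (spray L (curveLift L c t) + fderiv ℝ φ (c t) (unitTangent L c t)
    • unitTangent L c t - (1 ^ 2 / 2 : ℝ) • _) = _
  have hk' := hk.ne'
  match_scalars <;> field_simp
  ring

/-- The term C(grad φ, a) in the new nonlinear connection cancels the term -C(a, grad φ) produced by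
the new acceleration, so the correction has the same form as in Riemannian geometry. -/
lemma covDeriv_eq (h : IsConformalPair L L' U φ) (hc : IsRegularAt U c t) (a : ℝ → E) :
    covDeriv L' c a t = Real.exp (-φ (c t)) • (covDeriv L c a t
      + fderiv ℝ φ (c t) (a t) • unitTangent L c t
      + fderiv ℝ φ (c t) (unitTangent L c t) • a t
      - metric L (curveLift L c t) (unitTangent L c t) (a t) • grad L φ (curveLift L c t)) := by
  have hz := hc.curveLift_mem h.left
  have hk : 0 < Real.exp (-φ (c t)) := Real.exp_pos _
  have hs := (hc.speed_pos h.left).ne'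
  have e2 : Real.exp (-(2 * φ (c t))) = Real.exp (-φ (c t)) ^ 2 := by
    rw [← Real.exp_nat_mul]; congr 1; push_cast; ring
  have e3 : Real.exp (φ (c t)) = (Real.exp (-φ (c t)))⁻¹ := by rw [Real.exp_neg, inv_inv]
  have h1 : cartanV L (curveLift L c t) (a t) (unitTangent L c t) = 0 :=
    h.left.cartanV_self_right hz (a t)
  have h2 := h.left.cartanV_symm hz (grad L φ (curveLift L c t)) (a t)
  rw [hc.covDeriv_eq h.right, hc.covDeriv_eq h.left, h.curveLift_eq hc,
    h.right.nonlinConn_scale hz hk, h.right.cartanV_scale hz hk, h.accel_eq hc, h.speed_eq hc,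
    h.cartanV_eq hz, smul_apply, h.nonlinConn_eq hz, hc.curveLift_unit h.left, h2, e2, e3]
  simp only [map_smul, map_add, map_sub, h1]
  generalize Real.exp (-φ (c t)) = k at *
  change _ + k • (_ + fderiv ℝ φ (c t) (a t) • unitTangent L c t
    + fderiv ℝ φ (c t) (unitTangent L c t) • a t
    - metric L (curveLift L c t) (unitTangent L c t) (a t) • _ + _) + _ = _
  have hk' := hk.ne'
  match_scalars <;> field_simp
  ring

end IsConformalPair

/-! ### Product rules along a curve and the conformal law for the circle equation. -/

namespace IsRegularAt

variable [FiniteDimensional ℝ E] {c : ℝ → E} {t : ℝ}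

lemma covDeriv_smul (hc : IsRegularAt U c t) (hL : IsLocalFinsler L U) {f : ℝ → ℝ} {a : ℝ → E}
    {f' : ℝ} (hf : HasDerivAt f f' t) (ha : DifferentiableAt ℝ a t) :
    covDeriv L c (fun s => f s • a s) t
      = ((speed L c t)⁻¹ * f') • a t + f t • covDeriv L c a t := by
  rw [hc.covDeriv_eq hL, hc.covDeriv_eq hL, (hf.fun_smul ha.hasDerivAt).deriv]
  rw [hL.cartanV_symm (hc.curveLift_mem hL), hL.cartanV_symm (hc.curveLift_mem hL) (a t)]
  simp only [map_smul]
  module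

lemma covDeriv_add (hc : IsRegularAt U c t) (hL : IsLocalFinsler L U) {a b : ℝ → E}
    (ha : DifferentiableAt ℝ a t) (hb : DifferentiableAt ℝ b t) :
    covDeriv L c (fun s => a s + b s) t = covDeriv L c a t + covDeriv L c b t := by
  rw [hc.covDeriv_eq hL, hc.covDeriv_eq hL, hc.covDeriv_eq hL, deriv_fun_add ha hb]
  rw [hL.cartanV_symm (hc.curveLift_mem hL), hL.cartanV_symm (hc.curveLift_mem hL) (a t),
    hL.cartanV_symm (hc.curveLift_mem hL) (b t)]
  simp only [map_add]
  module

lemma covDeriv_sub (hc : IsRegularAt U c t) (hL : IsLocalFinsler L U) {a b : ℝ → E}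
    (ha : DifferentiableAt ℝ a t) (hb : DifferentiableAt ℝ b t) :
    covDeriv L c (fun s => a s - b s) t = covDeriv L c a t - covDeriv L c b t := by
  rw [hc.covDeriv_eq hL, hc.covDeriv_eq hL, hc.covDeriv_eq hL, deriv_fun_sub ha hb]
  rw [hL.cartanV_symm (hc.curveLift_mem hL), hL.cartanV_symm (hc.curveLift_mem hL) (a t),
    hL.cartanV_symm (hc.curveLift_mem hL) (b t)]
  simp only [map_sub]
  module

/-- The covariant derivative along a curve of the restriction of a section to its lift. -/
lemma covDeriv_section (hc : IsRegularAt U c t) (hL : IsLocalFinsler L U) {σ : E × E → E}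
    (hσ : DifferentiableAt ℝ σ (curveLift L c t)) :
    covDeriv L c (fun s => σ (curveLift L c s)) t
      = cartanDeriv L σ (curveLift L c t) (unitTangent L c t,
          accel L c t - (2 : ℝ) • spray L (curveLift L c t)) := by
  have h1 := hc.hasDerivAt_curveLift hL
  have h2 := hσ.hasFDerivAt.comp_hasDerivAt t h1
  rw [covDeriv, h1.deriv]
  change (speed L c t)⁻¹ • (deriv (σ ∘ curveLift L c) t + _) = _
  rw [h2.deriv, cartanDeriv, map_smul, map_smul, ← smul_add, smul_smul,
    inv_mul_cancel₀ (hc.speed_pos hL).ne', one_smul]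
  rfl

end IsRegularAt

/-- The vector whose component normal to a curve obstructs the conformal invariance of the
equation of geodesic circles. -/
def conformalDefect (L : E × E → ℝ) (φ : E → ℝ) (c : ℝ → E) (t : ℝ) : E :=
  covDeriv L c (fun s => grad L φ (curveLift L c s)) t
    - fderiv ℝ φ (c t) (unitTangent L c t) • grad L φ (curveLift L c t)

variable [FiniteDimensional ℝ E] {c : ℝ → E} {t : ℝ}

/-- The central computation: apply the law for the covariant derivative to the law for the
acceleration. The second derivative of φ enters only through the normal part of `conformalDefect`;
the remaining first order terms cancel. -/
lemma IsConformalPair.circleDefect_eq (h : IsConformalPair L L' U φ) (hc : IsRegularAt U c t) :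
    circleDefect L' c t = Real.exp (-(3 * φ (c t))) • (circleDefect L c t
      - conformalDefect L φ c t
      + metric L (curveLift L c t) (conformalDefect L φ c t) (unitTangent L c t)
        • unitTangent L c t) := by
  have hL := h.left
  have hz := hc.curveLift_mem hL
  have hX := (hc.contDiffAt_unitTangent hL).diffAt
  have hW := (hc.contDiffAt_accel hL).diffAt
  have hG : DifferentiableAt ℝ (fun s => grad L φ (curveLift L c s)) t :=
    (hL.smooth_grad h.factor hz).diffAt.comp t (hc.contDiffAt_curveLift hL).diffAt
  have hs := (hc.speed_pos hL).ne'
  -- Writing dφ(X) as g(X, grad φ) lets metric compatibility give its derivative in terms of W and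
  -- ∇(grad φ)/ds.
  have hφX : HasDerivAt (fun s => fderiv ℝ φ (c s) (unitTangent L c s))
      (speed L c t * (fderiv ℝ φ (c t) (accel L c t)
        + metric L (curveLift L c t) (covDeriv L c (fun s => grad L φ (curveLift L c s)) t)
          (unitTangent L c t))) t := by
    have e : (fun s => fderiv ℝ φ (c s) (unitTangent L c s)) =ᶠ[𝓝 t] fun s =>
        metric L (curveLift L c s) (unitTangent L c s) (grad L φ (curveLift L c s)) :=
      (hc.eventually hL.isOpen).mono fun s hs => by
        exact (hL.metric_grad_right (hs.curveLift_mem hL) _).symm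
    refine ((hc.hasDerivAt_metric hL hX hG).congr_of_eventuallyEq e).congr_deriv ?_
    rw [hL.metric_grad_right hz, hL.metric_symm hz (unitTangent L c t)]
    rfl
  have hZ : covDeriv L c (fun s => accel L c s + fderiv ℝ φ (c s) (unitTangent L c s)
        • unitTangent L c s - grad L φ (curveLift L c s)) t
      = covDeriv L c (accel L c) t + ((fderiv ℝ φ (c t) (accel L c t)
        + metric L (curveLift L c t) (covDeriv L c (fun s => grad L φ (curveLift L c s)) t)
          (unitTangent L c t)) • unitTangent L c t
        + fderiv ℝ φ (c t) (unitTangent L c t) • accel L c t)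
        - covDeriv L c (fun s => grad L φ (curveLift L c s)) t := by
    rw [hc.covDeriv_sub hL (hW.fun_add (hφX.differentiableAt.fun_smul hX)) hG,
      hc.covDeriv_add hL hW (hφX.differentiableAt.fun_smul hX), hc.covDeriv_smul hL hφX hX,
      ← mul_assoc, inv_mul_cancel₀ hs, one_mul]
    rfl
  have hZd : DifferentiableAt ℝ (fun s => accel L c s + fderiv ℝ φ (c s) (unitTangent L c s)
        • unitTangent L c s - grad L φ (curveLift L c s)) t :=
    (hW.add (hφX.differentiableAt.smul hX)).sub hG
  have e : accel L' c =ᶠ[𝓝 t] fun s => Real.exp (-(2 * φ (c s))) • (accel L c s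
      + fderiv ℝ φ (c s) (unitTangent L c s) • unitTangent L c s
      - grad L φ (curveLift L c s)) :=
    (hc.eventually hL.isOpen).mono fun s hs => h.accel_eq hs
  have e1 : Real.exp (2 * φ (c t)) = (Real.exp (-φ (c t)) ^ 2)⁻¹ := by
    rw [← Real.exp_nat_mul, ← Real.exp_neg]; congr 1; push_cast; ring
  have e2 : Real.exp (-(2 * φ (c t))) = Real.exp (-φ (c t)) ^ 2 := by
    rw [← Real.exp_nat_mul]; congr 1; push_cast; ring
  have e3 : Real.exp (-(3 * φ (c t))) = Real.exp (-φ (c t)) ^ 3 := by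
    rw [← Real.exp_nat_mul]; congr 1; push_cast; ring
  -- The two lifts are different points of the same ray; g' is homogeneous of degree zero, so only
  -- the conformal factor remains.
  have m1 : metric L' (curveLift L' c t) = Real.exp (2 * φ (c t)) • metric L (curveLift L c t) := by
    rw [h.curveLift_eq hc, h.right.metric_scale hz (Real.exp_pos _), h.metric_eq hz]
    rfl
  have hXX := hc.metric_unitTangent hL
  have hXW := hc.metric_unitTangent_accel hL
  have hWX := hXW
  rw [hL.metric_symm hz] at hWX
  have hgv (v : E) : metric L (curveLift L c t) (grad L φ (curveLift L c t)) v
    = fderiv ℝ φ (c t) v := hL.metric_grad hz v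
  have hvg (v : E) : metric L (curveLift L c t) v (grad L φ (curveLift L c t))
    = fderiv ℝ φ (c t) v := hL.metric_grad_right hz v
  rw [circleDefect, IsRegularAt.covDeriv_congr e, h.covDeriv_eq hc,
    hc.covDeriv_smul hL (h.hasDerivAt_exp_neg hc 2) hZd, hZ, m1, h.accel_eq hc,
    h.unitTangent_eq hc, circleDefect, conformalDefect, e1, e2, e3]
  have hk : Real.exp (-φ (c t)) ≠ 0 := (Real.exp_pos _).ne'
  generalize Real.exp (-φ (c t)) = k at *
  simp only [map_smul, map_add, map_sub, smul_apply, add_apply, sub_apply, smul_eq_mul, hXX, hXW,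
    hWX, hgv, hvg]
  match_scalars <;> field_simp <;> ring

end Conformal

/-! ### The Schwarzian and the infinitesimal circle condition. -/

section Schwarzian

variable {E : Type*} [NormedAddCommGroup E] [NormedSpace ℝ E] [FiniteDimensional ℝ E]
variable {L L' : E × E → ℝ} {U : Set E} {φ : E → ℝ} {z : E × E}

/-- Where the Schwarzian vanishes, the equation of geodesic circles is conformally invariant. -/
lemma IsConformalPair.circleDefect_eq_of_schwarzian (h : IsConformalPair L L' U φ)
    (hS : ∀ z ∈ slit U, ∀ ξ w, schwarzian L φ z ξ w = 0) {c : ℝ → E} {t : ℝ}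
    (hc : IsRegularAt U c t) :
    circleDefect L' c t = Real.exp (-(3 * φ (c t))) • circleDefect L c t := by
  have hL := h.left
  have hz := hc.curveLift_mem hL
  set ρ := (1 / (Module.finrank ℝ E : ℝ)) * (laplacian L φ (curveLift L c t)
    - metric L (curveLift L c t) (grad L φ (curveLift L c t)) (grad L φ (curveLift L c t))) with hρ
  have h1 : conformalDefect L φ c t = ρ • unitTangent L c t := by
    refine hL.metric_ext hz fun w => ?_
    -- The Schwarzian is evaluated on the arc length velocity of the lift (c, X), which has a
    -- vertical component when the curve is not a geodesic.
    have h2 := hS _ hz (unitTangent L c t, accel L c t - (2 : ℝ) • spray L (curveLift L c t)) w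
    rw [schwarzian, hess, ← hρ] at h2
    rw [conformalDefect, hc.covDeriv_section hL (hL.smooth_grad h.factor hz).diffAt]
    rw [hL.metric_symm hz w] at h2
    simp only [map_sub, map_smul, sub_apply, smul_apply, smul_eq_mul, hL.metric_grad hz]
    change _ - _ * fderiv ℝ φ (c t) w = _
    change _ - fderiv ℝ φ (c t) (unitTangent L c t) * fderiv ℝ φ (c t) w - _ = 0 at h2
    linarith
  rw [h.circleDefect_eq hc, h1]
  simp [hc.metric_unitTangent hL]

namespace IsLocalFinsler

lemma cartanDeriv_apply (hL : IsLocalFinsler L U) (hφ : ∀ x ∈ U, ContDiffAt ℝ ∞ φ x)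
    (hz : z ∈ slit U) (u v : E) :
    cartanDeriv L (grad L φ) z (u, v) = xDeriv (grad L φ) z u + cartanH L z (grad L φ z) u
      - (2 : ℝ) • cartanV L z (grad L φ z) v
      + cartanV L z (grad L φ z) (v + nonlinConn L z u) := by
  simp only [cartanDeriv, connForm, add_apply, ContinuousLinearMap.comp_apply,
    ContinuousLinearMap.coe_fst', ContinuousLinearMap.coe_snd']
  rw [fderiv_eq_xDeriv_add_yDeriv, hL.yDeriv_grad hφ hz]
  simp only
  abel

/-- The condition on the vector fields along unit directions that arises from geodesic circles
forces the gradient to be independent of the direction. -/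
lemma yDeriv_grad_eq_zero (hL : IsLocalFinsler L U) (hφ : ∀ x ∈ U, ContDiffAt ℝ ∞ φ x)
    (H : ∀ z ∈ slit U, L z = 1 → ∀ w, metric L z z.2 w = 0 → ∃ k : ℝ,
      cartanDeriv L (grad L φ) z (z.2, w - (2 : ℝ) • spray L z)
        - fderiv ℝ φ z.1 z.2 • grad L φ z = k • z.2)
    (hz : z ∈ slit U) : yDeriv (grad L φ) z = 0 := by
  have key : ∀ z ∈ slit U, L z = 1 → yDeriv (grad L φ) z = 0 := by
    intro z hz h1
    -- Subtracting the condition for acceleration 0 from that for w leaves -C(grad φ, w), a multiple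
    -- of y. It is also orthogonal to y, so it vanishes.
    have hC : ∀ w, metric L z z.2 w = 0 → cartanV L z (grad L φ z) w = 0 := by
      intro w hw
      obtain ⟨k, hk⟩ := H z hz h1 w hw
      obtain ⟨k0, hk0⟩ := H z hz h1 0 (by simp)
      rw [hL.cartanDeriv_apply hφ hz] at hk hk0
      simp only [map_sub, map_add, map_smul, map_zero] at hk hk0
      have e : cartanV L z (grad L φ z) w = (k0 - k) • z.2 := by
        rw [sub_smul, ← hk, ← hk0]; module
      have e2 := hL.metric_cartanV_self hz (grad L φ z) w
      rw [e] at e2 ⊢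
      simp only [map_smul, smul_apply, hL.metric_self_self hz, h1, smul_eq_mul] at e2
      have : k0 - k = 0 := by linarith
      rw [this, zero_smul]
    ext w
    rw [hL.yDeriv_grad hφ hz]
    -- The component of w along y does not matter, since C(·, y) = 0.
    have h2 := hC (w - metric L z z.2 w • z.2)
      (by simp [hL.metric_self_self hz, h1])
    rw [map_sub, map_smul, hL.cartanV_self_right hz, smul_zero, sub_zero] at h2
    simp [h2]
  -- The gradient has degree zero in y, so the result on unit vectors extends to the whole slit
  -- bundle.
  have hr := hL.pos hz
  have hz' := smul_mem_slit hz (inv_ne_zero hr.ne')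
  have h1 := key _ hz' (by
    rw [hL.homogeneous _ hz.1 _ _ (inv_pos.2 hr)]; exact inv_mul_cancel₀ hr.ne')
  have h2 := hL.yDeriv_scale (a := 1) hz' hr (fun w hw => (hL.smooth_grad hφ hw).diffAt)
    (fun w hw => by rw [hL.grad_scale hw hr, one_smul])
  rw [h1, smul_zero] at h2
  simpa [smul_smul, mul_inv_cancel₀ hr.ne'] using h2

/-- The circle condition with w = 0, that is, for geodesics. The Cartan terms are gone by the
preceding lemma, and homogeneity removes the normalization L = 1. -/
lemma exists_radial (hL : IsLocalFinsler L U) (hφ : ∀ x ∈ U, ContDiffAt ℝ ∞ φ x)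
    (H : ∀ z ∈ slit U, L z = 1 → ∀ w, metric L z z.2 w = 0 → ∃ k : ℝ,
      cartanDeriv L (grad L φ) z (z.2, w - (2 : ℝ) • spray L z)
        - fderiv ℝ φ z.1 z.2 • grad L φ z = k • z.2)
    (hz : z ∈ slit U) :
    ∃ k : ℝ, xDeriv (grad L φ) z z.2 + nonlinConn L z (grad L φ z)
      - fderiv ℝ φ z.1 z.2 • grad L φ z = k • z.2 := by
  have hr := hL.pos hz
  have hz' := smul_mem_slit hz (inv_ne_zero hr.ne')
  obtain ⟨k, hk⟩ := H _ hz' (by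
    rw [hL.homogeneous _ hz.1 _ _ (inv_pos.2 hr)]; exact inv_mul_cancel₀ hr.ne') 0 (by simp)
  have h1 := hL.yDeriv_grad_eq_zero hφ H hz'
  have h2 (v : E) : cartanV L (z.1, (L z)⁻¹ • z.2) (grad L φ (z.1, (L z)⁻¹ • z.2)) v = 0 := by
    have := hL.yDeriv_grad hφ hz' v
    rw [h1] at this
    simpa using this
  have h3 := hL.cartanH_self hz' (grad L φ (z.1, (L z)⁻¹ • z.2))
  rw [hL.cartanDeriv_apply hφ hz', h2, h2, h3, hL.grad_scale hz (inv_pos.2 hr),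
    hL.nonlinConn_scale hz (inv_pos.2 hr),
    hL.xDeriv_scale (a := 1) hz (inv_pos.2 hr) (fun w hw => (hL.smooth_grad hφ hw).diffAt)
    (fun w hw => by rw [hL.grad_scale hw (inv_pos.2 hr), one_smul])] at hk
  refine ⟨k, ?_⟩
  have h4 := congrArg (fun v => L z • v) hk
  simp only [map_smul, smul_apply, one_smul, smul_zero, sub_zero, add_zero] at h4
  have h5 : L z • ((L z)⁻¹ • xDeriv (grad L φ) z z.2 + (L z)⁻¹ • nonlinConn L z (grad L φ z)
      - ((L z)⁻¹ • fderiv ℝ φ z.1 z.2) • grad L φ z)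
      = xDeriv (grad L φ) z z.2 + nonlinConn L z (grad L φ z)
      - fderiv ℝ φ z.1 z.2 • grad L φ z := by
    have := hr.ne'
    simp only [smul_eq_mul]
    match_scalars <;> field_simp
  rw [← h5, h4, smul_comm, smul_inv_smul₀ hr.ne']

/-- The horizontal Hessian when the gradient does not depend on the direction and satisfies the
radial equation: it is one half of the Lie derivative of the fundamental tensor. -/
lemma two_mul_hess_horizontal (hL : IsLocalFinsler L U) (hφ : ∀ x ∈ U, ContDiffAt ℝ ∞ φ x)
    (hz : z ∈ slit U) (hV : yDeriv (grad L φ) z = 0) {k : ℝ}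
    (hk : xDeriv (grad L φ) z z.2 + nonlinConn L z (grad L φ z)
      - fderiv ℝ φ z.1 z.2 • grad L φ z = k • z.2) (u w : E) :
    2 * metric L z (xDeriv (grad L φ) z u + cartanH L z (grad L φ z) u) w
      = xDeriv (metric L) z (grad L φ z) u w
        + yDeriv (metric L) z (xDeriv (grad L φ) z z.2) u w
        + metric L z (xDeriv (grad L φ) z u) w + metric L z (xDeriv (grad L φ) z w) u := by
  have h0 (a b : E) : yDeriv (metric L) z a (grad L φ z) b = 0 := by
    have := hL.metric_yDeriv_grad hφ hz a b
    rw [hV] at this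
    simpa using this
  have h1 := hL.metric_cartanH hz (grad L φ z) u w
  -- The radial equation is solved for N(grad φ). Its components along y and grad φ are both
  -- annihilated by the Cartan tensor, which leaves the derivative of g along -∂_x grad φ(y).
  have hN : nonlinConn L z (grad L φ z) = k • z.2 + fderiv ℝ φ z.1 z.2 • grad L φ z
      - xDeriv (grad L φ) z z.2 := by
    rw [← hk]; abel
  have h2 : yDeriv (metric L) z z.2 u w = 0 := by
    rw [hL.yDeriv_metric_symm₁₂ hz, hL.yDeriv_metric_symm₂₃ hz, hL.yDeriv_metric_self hz]
  have h3 : yDeriv (metric L) z (grad L φ z) u w = 0 := by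
    rw [hL.yDeriv_metric_symm₁₂ hz, h0]
  rw [hDeriv_metric_apply, hDeriv_metric_apply, hDeriv_metric_apply, h0, h0, hN] at h1
  simp only [map_sub, map_add, map_smul, sub_apply, add_apply, smul_apply, h2, h3,
    smul_eq_mul] at h1 ⊢
  have h4 := hL.metric_xDeriv_grad hφ hz u w
  have h5 := hL.metric_xDeriv_grad hφ hz w u
  rw [fderiv_fderiv_symm (hφ _ hz.1)] at h5
  linarith

/-- The radial equation gives ∇_u grad φ only for u = y. Its lowered form is differentiated along
the fibre: as grad φ does not depend on y, this reproduces the full horizontal Hessian, with an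
extra term (∂ρ/∂y)(u) g(y, w). Symmetry of the Hessian then shows that ρ is constant along fibres.
-/
lemma hess_horizontal_eq (hL : IsLocalFinsler L U) (hφ : ∀ x ∈ U, ContDiffAt ℝ ∞ φ x)
    (hV : ∀ z ∈ slit U, yDeriv (grad L φ) z = 0)
    (hP : ∀ z ∈ slit U, ∃ k : ℝ, xDeriv (grad L φ) z z.2 + nonlinConn L z (grad L φ z)
      - fderiv ℝ φ z.1 z.2 • grad L φ z = k • z.2) (hz : z ∈ slit U) :
    ∃ ρ : ℝ, ∀ u, xDeriv (grad L φ) z u + cartanH L z (grad L φ z) u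
      = fderiv ℝ φ z.1 u • grad L φ z + ρ • u := by
  -- The factor in the radial equation, given by pairing with y, so that it can be differentiated.
  let ρ : E × E → ℝ := fun q => (L q ^ 2)⁻¹ * metric L q (xDeriv (grad L φ) q q.2
    + nonlinConn L q (grad L φ q) - fderiv ℝ φ q.1 q.2 • grad L φ q) q.2
  have hρ : ∀ q ∈ slit U, xDeriv (grad L φ) q q.2 + nonlinConn L q (grad L φ q)
      - fderiv ℝ φ q.1 q.2 • grad L φ q = ρ q • q.2 := by
    intro q hq
    obtain ⟨k, hk⟩ := hP q hq
    have : ρ q = k := by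
      simp only [ρ]
      rw [hk, map_smul, smul_apply, hL.metric_self_self hq, smul_eq_mul]
      have := (hL.pos hq).ne'
      field_simp
    rw [hk, this]
  have h0 : ContDiffAt ℝ ∞ (fderiv ℝ φ) z.1 := (hφ z.1 hz.1).fderiv_right (m := ∞) le_rfl
  have hdφ : DifferentiableAt ℝ (fun w : E × E => fderiv ℝ φ w.1) z :=
    h0.diffAt.comp z differentiableAt_fst
  have hdφy : DifferentiableAt ℝ (fun w : E × E => fderiv ℝ φ w.1 w.2) z :=
    hdφ.clm_apply differentiableAt_snd
  have hg := hL.smooth_grad hφ hz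
  have hxg := (contDiffAt_xDeriv hg).diffAt
  have hm := (hL.smooth_metric hz).diffAt
  have hxy := (contDiffAt_xDeriv (hL.smooth_ySq hz)).diffAt
  have hρd : DifferentiableAt ℝ ρ z := by
    refine DifferentiableAt.mul ((hL.smooth_sq hz).diffAt.inv (pow_pos (hL.pos hz) 2).ne') ?_
    refine (hm.clm_apply ?_).clm_apply differentiableAt_snd
    exact ((hxg.clm_apply differentiableAt_snd).fun_add
      ((hL.smooth_nonlinConn hz).diffAt.clm_apply hg.diffAt)).fun_sub (hdφy.fun_smul hg.diffAt)
  have hyx (u v : E) : yDeriv (xDeriv (grad L φ)) z u v = 0 := by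
    rw [← xDeriv_yDeriv_comm hg, xDeriv_congr (k := fun _ => 0)
      (hL.eventuallyEq hz fun q hq => hV q hq)]
    simp
  -- the radial equation, lowered
  have hrad : ∀ w, ∀ q ∈ slit U, 2 * (ρ q * metric L q q.2 w + fderiv ℝ φ q.1 q.2
        * fderiv ℝ φ q.1 w)
      = (1 / 2) * xDeriv (yDeriv fun w => L w ^ 2) q (grad L φ q) w
        + metric L q (xDeriv (grad L φ) q q.2) w + metric L q (xDeriv (grad L φ) q w) q.2 := by
    intro w q hq
    have h1 := hL.two_mul_hess_horizontal hφ hq (hV q hq) (hρ q hq) q.2 w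
    rw [hL.cartanH_self hq, hL.xDeriv_metric_symm₂₃ hq, hL.xDeriv_metric_self hq,
      hL.yDeriv_metric_symm₂₃ hq, hL.yDeriv_metric_self hq] at h1
    have h2 : xDeriv (grad L φ) q q.2 + nonlinConn L q (grad L φ q)
        = ρ q • q.2 + fderiv ℝ φ q.1 q.2 • grad L φ q := by
      rw [← hρ q hq]; abel
    rw [h2] at h1
    simp only [map_add, map_smul, add_apply, smul_apply, smul_eq_mul, hL.metric_grad hq] at h1
    linarith
  -- The fibre derivative of `hrad` in the direction u: its right side becomes the Lie derivative
  -- expression for twice the Hessian.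
  have hT : ∀ u w, metric L z (xDeriv (grad L φ) z u + cartanH L z (grad L φ z) u) w
      = fderiv ℝ φ z.1 u * fderiv ℝ φ z.1 w + yDeriv ρ z u * metric L z z.2 w
        + ρ z * metric L z u w := by
    intro u w
    have h1 := congrArg (fun T => T u) (yDeriv_congr (hL.eventuallyEq hz (hrad w)))
    have hmy : DifferentiableAt ℝ (fun q : E × E => metric L q q.2 w) z :=
      (hm.clm_apply differentiableAt_snd).clm_apply (differentiableAt_const w)
    have hφw : DifferentiableAt ℝ (fun q : E × E => fderiv ℝ φ q.1 w) z :=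
      hdφ.clm_apply (differentiableAt_const w)
    have a1 : fderiv ℝ (fun q : E × E => metric L q q.2 w) z (0, u) = metric L z u w := by
      rw [fderiv_bilin hm differentiableAt_snd (differentiableAt_const w)]
      have := hL.yDeriv_metric_self hz u w
      rw [hL.yDeriv_metric_symm₂₃ hz, yDeriv_apply] at this
      simp [this, fderiv_snd]
    have a2 : fderiv ℝ (fun q : E × E => fderiv ℝ φ q.1) z (0, u) = 0 :=
      congrArg (fun T => T u) (yDeriv_comp_fst (z := z) h0.diffAt)
    have a3 : fderiv ℝ (fun q : E × E => fderiv ℝ φ q.1 q.2) z (0, u) = fderiv ℝ φ z.1 u := by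
      rw [fderiv_lin hdφ differentiableAt_snd, a2]
      simp [fderiv_snd]
    have a4 : fderiv ℝ (fun q : E × E => fderiv ℝ φ q.1 w) z (0, u) = 0 := by
      rw [fderiv_lin hdφ (differentiableAt_const w), a2]
      simp
    have l1 : yDeriv (fun q => 2 * (ρ q * metric L q q.2 w + fderiv ℝ φ q.1 q.2
        * fderiv ℝ φ q.1 w)) z u = 2 * (yDeriv ρ z u * metric L z z.2 w + ρ z * metric L z u w
          + fderiv ℝ φ z.1 u * fderiv ℝ φ z.1 w) := by
      rw [yDeriv_apply, fderiv_const_mul ((hρd.fun_mul hmy).fun_add (hdφy.fun_mul hφw)),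
        fderiv_fun_add (hρd.fun_mul hmy) (hdφy.fun_mul hφw), fderiv_fun_mul hρd hmy,
        fderiv_fun_mul hdφy hφw]
      simp only [smul_apply, add_apply, a1, a3, a4, smul_eq_mul, yDeriv_apply]
      ring
    have hxyw : DifferentiableAt ℝ (fun q => xDeriv (yDeriv fun w => L w ^ 2) q (grad L φ q) w) z :=
      (hxy.clm_apply hg.diffAt).clm_apply (differentiableAt_const w)
    have hxgy : DifferentiableAt ℝ (fun q : E × E => xDeriv (grad L φ) q q.2) z :=
      hxg.clm_apply differentiableAt_snd
    have hxgw : DifferentiableAt ℝ (fun q : E × E => xDeriv (grad L φ) q w) z :=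
      hxg.clm_apply (differentiableAt_const w)
    have r2 : DifferentiableAt ℝ (fun q => metric L q (xDeriv (grad L φ) q q.2) w) z :=
      (hm.clm_apply hxgy).clm_apply (differentiableAt_const w)
    have r3 : DifferentiableAt ℝ (fun q => metric L q (xDeriv (grad L φ) q w) q.2) z :=
      (hm.clm_apply hxgw).clm_apply differentiableAt_snd
    have b1 : fderiv ℝ (fun q => xDeriv (yDeriv fun w => L w ^ 2) q (grad L φ q) w) z (0, u)
        = 2 * xDeriv (metric L) z (grad L φ z) u w := by
      rw [fderiv_bilin hxy hg.diffAt (differentiableAt_const w)]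
      have e1 := congrArg (fun T => T u) (hV z hz)
      rw [yDeriv_apply] at e1
      have e2 := xDeriv_yDeriv_comm (hL.smooth_ySq hz) (grad L φ z) u
      rw [yDeriv_apply] at e2
      rw [e1, ← e2, hL.xDeriv_metric hz]
      simp
    have e3 (v : E) : fderiv ℝ (xDeriv (grad L φ)) z (0, u) v = 0 := hyx u v
    have b2 : fderiv ℝ (fun q => metric L q (xDeriv (grad L φ) q q.2) w) z (0, u)
        = yDeriv (metric L) z (xDeriv (grad L φ) z z.2) u w
          + metric L z (xDeriv (grad L φ) z u) w := by
      rw [fderiv_bilin hm hxgy (differentiableAt_const w), fderiv_lin hxg differentiableAt_snd, e3,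
        hL.yDeriv_metric_symm₁₂ hz]
      simp [fderiv_snd, yDeriv_apply]
    have b3 : fderiv ℝ (fun q => metric L q (xDeriv (grad L φ) q w) q.2) z (0, u)
        = metric L z (xDeriv (grad L φ) z w) u := by
      rw [fderiv_bilin hm hxgw differentiableAt_snd, fderiv_lin hxg (differentiableAt_const w), e3]
      have := hL.yDeriv_metric_self hz u (xDeriv (grad L φ) z w)
      rw [yDeriv_apply] at this
      simp [fderiv_snd, this]
    have l2 : yDeriv (fun q => (1 / 2) * xDeriv (yDeriv fun w => L w ^ 2) q (grad L φ q) w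
        + metric L q (xDeriv (grad L φ) q q.2) w + metric L q (xDeriv (grad L φ) q w) q.2) z u
        = 2 * metric L z (xDeriv (grad L φ) z u + cartanH L z (grad L φ z) u) w := by
      rw [yDeriv_apply, fderiv_fun_add ((hxyw.const_mul _).fun_add r2) r3,
        fderiv_fun_add (hxyw.const_mul _) r2, fderiv_const_mul hxyw,
        hL.two_mul_hess_horizontal hφ hz (hV z hz) (hρ z hz)]
      simp only [smul_apply, add_apply, b1, b2, b3, smul_eq_mul]
      ring
    have h1' := l1.symm.trans (h1.trans l2)
    linarith
  have hsym : ∀ u w, metric L z (xDeriv (grad L φ) z u + cartanH L z (grad L φ z) u) w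
      = metric L z (xDeriv (grad L φ) z w + cartanH L z (grad L φ z) w) u := by
    intro u w
    have h1 := hL.two_mul_hess_horizontal hφ hz (hV z hz) (hρ z hz) u w
    have h2 := hL.two_mul_hess_horizontal hφ hz (hV z hz) (hρ z hz) w u
    rw [hL.xDeriv_metric_symm₂₃ hz, hL.yDeriv_metric_symm₂₃ hz] at h2
    linarith
  have hpos := pow_pos (hL.pos hz) 2
  -- At u = w = y the formula `hT` is compared with the radial equation itself.
  have hyρ : yDeriv ρ z z.2 = 0 := by
    have h1 := hT z.2 z.2
    have h2 : xDeriv (grad L φ) z z.2 + cartanH L z (grad L φ z) z.2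
        = ρ z • z.2 + fderiv ℝ φ z.1 z.2 • grad L φ z := by
      rw [← hρ z hz, hL.cartanH_self hz]; abel
    rw [h2] at h1
    simp only [map_add, map_smul, add_apply, smul_apply, smul_eq_mul, hL.metric_grad hz,
      hL.metric_self_self hz] at h1
    have : yDeriv ρ z z.2 * L z ^ 2 = 0 := by linarith
    exact (mul_eq_zero.1 this).resolve_right hpos.ne'
  -- At w = y, symmetry moves the derivative of ρ from u to y, where it is already zero.
  have huρ : ∀ u, yDeriv ρ z u = 0 := by
    intro u
    have h1 := hT u z.2
    rw [hsym, hT, hyρ, hL.metric_self_self hz, hL.metric_symm hz u] at h1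
    have : yDeriv ρ z u * L z ^ 2 = 0 := by linarith
    exact (mul_eq_zero.1 this).resolve_right hpos.ne'
  refine ⟨ρ z, fun u => hL.metric_ext hz fun w => ?_⟩
  rw [hT, huρ]
  simp [hL.metric_grad hz]

/-- The infinitesimal condition on unit directions implies that the Schwarzian vanishes. -/
lemma schwarzian_eq_zero (hL : IsLocalFinsler L U) (hφ : ∀ x ∈ U, ContDiffAt ℝ ∞ φ x)
    (H : ∀ z ∈ slit U, L z = 1 → ∀ w, metric L z z.2 w = 0 → ∃ k : ℝ,
      cartanDeriv L (grad L φ) z (z.2, w - (2 : ℝ) • spray L z)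
        - fderiv ℝ φ z.1 z.2 • grad L φ z = k • z.2)
    (hz : z ∈ slit U) (ξ : E × E) (w : E) : schwarzian L φ z ξ w = 0 := by
  obtain ⟨ρ, hρ⟩ := hL.hess_horizontal_eq hφ (fun q hq => hL.yDeriv_grad_eq_zero hφ H hq)
    (fun q hq => hL.exists_radial hφ H hq) hz
  have hC (v : E) : cartanV L z (grad L φ z) v = 0 := by
    have := hL.yDeriv_grad hφ hz v
    rw [hL.yDeriv_grad_eq_zero hφ H hz] at this
    simpa using this
  have hD (ξ : E × E) : cartanDeriv L (grad L φ) z ξ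
      = fderiv ℝ φ z.1 ξ.1 • grad L φ z + ρ • ξ.1 := by
    rw [show ξ = (ξ.1, ξ.2) from rfl, hL.cartanDeriv_apply hφ hz, hC, hC, hρ]
    simp
  have : Nontrivial E := ⟨z.2, 0, hz.2⟩
  have hn : (Module.finrank ℝ E : ℝ) ≠ 0 := by
    exact_mod_cast (Module.finrank_pos (R := ℝ) (M := E)).ne'
  -- The trace of dφ ⊗ grad φ + ρ id; hence (Δφ - ‖grad φ‖²)/n = ρ, the coefficient subtracted in
  -- the Schwarzian.
  have hlap : laplacian L φ z
      = fderiv ℝ φ z.1 (grad L φ z) + ρ * Module.finrank ℝ E := by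
    have e : ((cartanDeriv L (grad L φ) z).comp (hLift L z) : E →L[ℝ] E).toLinearMap
        = (fderiv ℝ φ z.1).toLinearMap.smulRight (grad L φ z) + ρ • LinearMap.id := by
      ext u
      simp [hD, hLift]
    rw [laplacian, e, map_add, map_smul, LinearMap.trace_id, LinearMap.trace_smulRight]
    simp
  rw [schwarzian, hess, hD, hlap, hL.metric_grad hz, hL.metric_symm hz w]
  simp only [map_add, map_smul, add_apply, smul_apply, hL.metric_grad hz, smul_eq_mul]
  field_simp
  ring

end IsLocalFinsler

end Schwarzian

/-! ### Geodesic circles with prescribed initial data. -/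

section Existence

/-- Local existence of smooth solutions of smooth autonomous differential equations. -/
lemma exists_smooth_integralCurve {P : Type*} [NormedAddCommGroup P] [NormedSpace ℝ P]
    [CompleteSpace P] {v : P → P} {O : Set P} (hO : IsOpen O) (hv : ∀ p ∈ O, ContDiffAt ℝ ∞ v p)
    {p : P} (hp : p ∈ O) :
    ∃ γ : ℝ → P, γ 0 = p ∧ ∃ ε > (0 : ℝ), ∀ t ∈ Set.Ioo (-ε) ε,
      γ t ∈ O ∧ HasDerivAt γ (v (γ t)) t ∧ ContDiffAt ℝ ∞ γ t := by
  obtain ⟨γ, h0, ε, hε, hγ⟩ :=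
    ((hv p hp).of_le (m := 1) (by simp))
      |>.exists_forall_mem_closedBall_exists_eq_forall_mem_Ioo_hasDerivAt₀ 0
  simp only [zero_sub, zero_add] at hγ
  have hcont : ContinuousAt γ 0 := (hγ 0 ⟨by linarith, hε⟩).continuousAt
  obtain ⟨δ, hδ, hδO⟩ := Metric.eventually_nhds_iff.1
    (hcont.eventually_mem (hO.mem_nhds (by rwa [h0])))
  refine ⟨γ, h0, min ε δ, lt_min hε hδ, ?_⟩
  have hI : ∀ t ∈ Set.Ioo (-min ε δ) (min ε δ), γ t ∈ O ∧ HasDerivAt γ (v (γ t)) t := by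
    intro t ht
    have h1 := min_le_left ε δ
    have h2 := min_le_right ε δ
    refine ⟨hδO ?_, hγ t ⟨by linarith [ht.1], by linarith [ht.2]⟩⟩
    rw [Real.dist_eq, sub_zero, abs_lt]
    exact ⟨by linarith [ht.1], by linarith [ht.2]⟩
  -- Bootstrapping: if γ is of class Cⁿ, then γ' = v ∘ γ is too, so γ is of class Cⁿ⁺¹.
  have hsm : ∀ n : ℕ, ContDiffOn ℝ n γ (Set.Ioo (-min ε δ) (min ε δ)) := by
    intro n
    induction n with
    | zero =>
      exact contDiffOn_zero.2 fun t ht => (hI t ht).2.continuousAt.continuousWithinAt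
    | succ n ih =>
      push_cast
      refine (contDiffOn_succ_iff_deriv_of_isOpen isOpen_Ioo).2
        ⟨fun t ht => (hI t ht).2.differentiableAt.differentiableWithinAt, by simp, ?_⟩
      have h1 : ContDiffOn ℝ n (fun t => v (γ t)) (Set.Ioo (-min ε δ) (min ε δ)) := fun t ht =>
        ((hv _ (hI t ht).1).of_le (by exact_mod_cast le_top)).comp_contDiffWithinAt t (ih t ht)
      exact h1.congr fun t ht => (hI t ht).2.deriv
  intro t ht
  exact ⟨(hI t ht).1, (hI t ht).2, (contDiffOn_infty.2 hsm).contDiffAt (isOpen_Ioo.mem_nhds ht)⟩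

lemma eq_of_hasDerivAt_zero {f : ℝ → ℝ} {ε : ℝ} (hε : 0 < ε)
    (hf : ∀ t ∈ Set.Ioo (-ε) ε, HasDerivAt f 0 t) {t : ℝ} (ht : t ∈ Set.Ioo (-ε) ε) :
    f t = f 0 :=
  isOpen_Ioo.is_const_of_deriv_eq_zero isPreconnected_Ioo
    (fun s hs => (hf s hs).differentiableAt.differentiableWithinAt)
    (fun s hs => (hf s hs).deriv) ht ⟨by linarith, hε⟩

variable {E : Type*} [NormedAddCommGroup E] [NormedSpace ℝ E] [FiniteDimensional ℝ E]
variable {L : E × E → ℝ} {U : Set E} {z : E × E}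

/-- Geodesic circles with prescribed unit tangent and acceleration exist. -/
lemma IsLocalFinsler.exists_circle (hL : IsLocalFinsler L U) (hz : z ∈ slit U) (h1 : L z = 1)
    {w : E} (hw : metric L z z.2 w = 0) :
    ∃ c : ℝ → E, curveLift L c 0 = z ∧ accel L c 0 = w ∧ ∃ ε > (0 : ℝ), ∀ t ∈ Set.Ioo (-ε) ε,
      IsRegularAt U c t ∧ circleDefect L c t = 0 := by
  have : CompleteSpace E := FiniteDimensional.complete ℝ E
  -- The prescribed value of ∇W/ds. Dividing by L² makes g(X, W) a first integral without knowing
  -- that X is a unit vector; on L = 1 it is the circle equation.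
  let b : (E × E) × E → E := fun p =>
    -((metric L p.1 p.2 p.2 / L p.1 ^ 2) • p.1.2)
  let v : (E × E) × E → (E × E) × E := fun p =>
    ((p.1.2, p.2 - (2 : ℝ) • spray L p.1),
      b p - nonlinConn L p.1 p.2 - cartanV L p.1 p.2 p.2)
  have hO : IsOpen {p : (E × E) × E | p.1 ∈ slit U} :=
    (isOpen_slit hL.isOpen).preimage continuous_fst
  have hv : ∀ p ∈ {p : (E × E) × E | p.1 ∈ slit U}, ContDiffAt ℝ ∞ v p := by
    intro p hp
    have hp : p.1 ∈ slit U := hp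
    have hf : ContDiffAt ℝ ∞ (fun q : (E × E) × E => q.1) p := contDiffAt_fst
    have hs : ContDiffAt ℝ ∞ (fun q : (E × E) × E => q.2) p := contDiffAt_snd
    have hm : ContDiffAt ℝ ∞ (fun q : (E × E) × E => metric L q.1) p :=
      (hL.smooth_metric hp).comp p hf
    have hn : ContDiffAt ℝ ∞ (fun q : (E × E) × E => nonlinConn L q.1) p :=
      (hL.smooth_nonlinConn hp).comp p hf
    have hsp : ContDiffAt ℝ ∞ (fun q : (E × E) × E => spray L q.1) p :=
      (hL.smooth_spray hp).comp p hf
    have hq : ContDiffAt ℝ ∞ (fun q : (E × E) × E => L q.1 ^ 2) p :=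
      (hL.smooth_sq hp).comp p hf
    have hmm : ContDiffAt ℝ ∞ (fun q : (E × E) × E => metric L q.1 q.2 q.2) p :=
      (hm.clm_apply hs).clm_apply hs
    refine (hf.snd.prodMk (hs.sub (hsp.const_smul (2 : ℝ)))).prodMk ?_
    exact (((hmm.div hq (pow_pos (hL.pos hp) 2).ne').smul hf.snd).neg.sub
      (hn.clm_apply hs)).sub (hL.smooth_cartanV hp rfl hf hs hs)
  obtain ⟨γ, h0, ε, hε, hγ⟩ := exists_smooth_integralCurve hO hv (p := (z, w)) hz
  have hmem : ∀ t ∈ Set.Ioo (-ε) ε, (γ t).1 ∈ slit U := fun t ht => (hγ t ht).1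
  have hd1 : ∀ t ∈ Set.Ioo (-ε) ε, HasDerivAt (fun s => (γ s).1)
      ((γ t).1.2, (γ t).2 - (2 : ℝ) • spray L (γ t).1) t := fun t ht =>
    ((hasFDerivAt_fst (p := γ t)).comp_hasDerivAt t (hγ t ht).2.1 :)
  have hd2 : ∀ t ∈ Set.Ioo (-ε) ε, HasDerivAt (fun s => (γ s).2)
      (b (γ t) - nonlinConn L (γ t).1 (γ t).2 - cartanV L (γ t).1 (γ t).2 (γ t).2) t := fun t ht =>
    ((hasFDerivAt_snd (p := γ t)).comp_hasDerivAt t (hγ t ht).2.1 :)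
  have hdc : ∀ t ∈ Set.Ioo (-ε) ε, HasDerivAt (fun s => (γ s).1.1) (γ t).1.2 t := fun t ht =>
    ((hasFDerivAt_fst (p := (γ t).1)).comp_hasDerivAt t (hd1 t ht) :)
  have hdX : ∀ t ∈ Set.Ioo (-ε) ε, HasDerivAt (fun s => (γ s).1.2)
      ((γ t).2 - (2 : ℝ) • spray L (γ t).1) t := fun t ht =>
    ((hasFDerivAt_snd (p := (γ t).1)).comp_hasDerivAt t (hd1 t ht) :)
  have hdz : ∀ t ∈ Set.Ioo (-ε) ε, HasDerivAt (fun s => (γ s).1)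
      ((1 : ℝ) • ((γ t).1.2, (γ t).2 - (2 : ℝ) • spray L (γ t).1)) t := fun t ht => by
    simpa only [one_smul] using hd1 t ht
  have hdX' : ∀ t ∈ Set.Ioo (-ε) ε, HasDerivAt (fun s => (γ s).1.2)
      ((1 : ℝ) • ((γ t).2 - nonlinConn L (γ t).1 (γ t).1.2
        - cartanV L (γ t).1 (γ t).1.2 (γ t).2)) t := fun t ht => by
    rw [hL.nonlinConn_self (hmem t ht), hL.cartanV_self_left (hmem t ht), sub_zero, one_smul]
    exact hdX t ht
  have hdW' : ∀ t ∈ Set.Ioo (-ε) ε, HasDerivAt (fun s => (γ s).2)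
      ((1 : ℝ) • (b (γ t) - nonlinConn L (γ t).1 (γ t).2
        - cartanV L (γ t).1 (γ t).2 (γ t).2)) t := fun t ht => by
    rw [one_smul]
    exact hd2 t ht
  -- Orthogonality comes first, since the derivative of g(X, X) is 2 g(X, W). Only afterwards is the
  -- solution known to have unit speed.
  have hXW : ∀ t ∈ Set.Ioo (-ε) ε, metric L (γ t).1 (γ t).1.2 (γ t).2 = 0 := by
    intro t ht
    rw [eq_of_hasDerivAt_zero (f := fun t => metric L (γ t).1 (γ t).1.2 (γ t).2) hε ?_ ht, h0]
    · exact hw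
    · intro s hs
      refine (hL.hasDerivAt_metric (hmem s hs) (hdz s hs) (hdX' s hs) (hdW' s hs)).congr_deriv ?_
      have := (hL.pos (hmem s hs)).ne'
      simp only [b, map_neg, map_smul, hL.metric_self_self (hmem s hs), smul_eq_mul]
      field_simp
      ring
  have hXX : ∀ t ∈ Set.Ioo (-ε) ε, L (γ t).1 = 1 := by
    intro t ht
    have h2 : metric L (γ t).1 (γ t).1.2 (γ t).1.2 = 1 := by
      rw [eq_of_hasDerivAt_zero (f := fun t => metric L (γ t).1 (γ t).1.2 (γ t).1.2) hε ?_ ht, h0]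
      · rw [hL.metric_self_self hz, h1, one_pow]
      · intro s hs
        refine (hL.hasDerivAt_metric (hmem s hs) (hdz s hs) (hdX' s hs) (hdX' s hs)).congr_deriv ?_
        rw [hL.metric_symm (hmem s hs) (γ s).2, hXW s hs]
        simp
    rw [hL.metric_self_self (hmem t ht)] at h2
    exact (pow_eq_one_iff_of_nonneg (hL.nonneg _) two_ne_zero).1 h2
  let c : ℝ → E := fun s => (γ s).1.1
  have hreg : ∀ t ∈ Set.Ioo (-ε) ε, IsRegularAt U c t := by
    intro t ht
    refine ⟨?_, (hmem t ht).1, ?_⟩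
    · filter_upwards [isOpen_Ioo.mem_nhds ht] with s hs
      exact (hγ s hs).2.2.fst.fst
    · rw [(hdc t ht).deriv]
      exact (hmem t ht).2
  have hspeed : ∀ t ∈ Set.Ioo (-ε) ε, speed L c t = 1 := by
    intro t ht
    rw [speed, (hdc t ht).deriv]
    exact hXX t ht
  have htan : ∀ t ∈ Set.Ioo (-ε) ε, unitTangent L c t = (γ t).1.2 := by
    intro t ht
    have := (hreg t ht).deriv_eq hL
    rw [hspeed t ht, one_smul, (hdc t ht).deriv] at this
    exact this.symm
  have hlift : ∀ t ∈ Set.Ioo (-ε) ε, curveLift L c t = (γ t).1 := by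
    intro t ht
    rw [curveLift, htan t ht]
  have hacc : ∀ t ∈ Set.Ioo (-ε) ε, accel L c t = (γ t).2 := by
    intro t ht
    have e : unitTangent L c =ᶠ[𝓝 t] fun s => (γ s).1.2 := by
      filter_upwards [isOpen_Ioo.mem_nhds ht] with s hs using htan s hs
    rw [(hreg t ht).accel_eq hL, hspeed t ht, e.deriv_eq, (hdX t ht).deriv, hlift t ht]
    simp
  have h0I : (0 : ℝ) ∈ Set.Ioo (-ε) ε := ⟨by linarith, hε⟩
  refine ⟨c, by rw [hlift 0 h0I, h0], by rw [hacc 0 h0I, h0], ε, hε, fun t ht => ⟨hreg t ht, ?_⟩⟩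
  have e : accel L c =ᶠ[𝓝 t] fun s => (γ s).2 := by
    filter_upwards [isOpen_Ioo.mem_nhds ht] with s hs using hacc s hs
  rw [circleDefect, (hreg t ht).covDeriv_eq hL, e.deriv_eq, (hd2 t ht).deriv, hacc t ht,
    hlift t ht, htan t ht, hspeed t ht]
  simp only [b, hXX t ht]
  module

end Existence

/-! ### Behaviour under changes of coordinates. -/

section CoordinateChange

variable {E : Type*} [NormedAddCommGroup E] [NormedSpace ℝ E] [FiniteDimensional ℝ E]

/-- `h` is a change of coordinates that carries the Finsler structure `L` to `L'`. -/
structure IsCoordChange (L : E × E → ℝ) (U : Set E) (L' : E × E → ℝ) (U' : Set E) (h : E → E) :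
    Prop where
  left : IsLocalFinsler L U
  right : IsLocalFinsler L' U'
  maps : ∀ x ∈ U, h x ∈ U'
  smooth : ∀ x ∈ U, ContDiffAt ℝ ∞ h x
  eq : ∀ x ∈ U, ∀ y, L (x, y) = L' (h x, fderiv ℝ h x y)

/-- The tangent map of `h` in coordinates. -/
def tangentLift (h : E → E) (z : E × E) : E × E := (h z.1, fderiv ℝ h z.1 z.2)

variable {L L' : E × E → ℝ} {U U' : Set E} {h : E → E} {z : E × E}

namespace IsCoordChange

lemma smooth_fderiv (H : IsCoordChange L U L' U' h) {x : E} (hx : x ∈ U) :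
    ContDiffAt ℝ ∞ (fderiv ℝ h) x :=
  (H.smooth x hx).fderiv_right (m := ∞) le_rfl

/-- A nonzero vector in the kernel would have positive length for L but zero length for L'. -/
lemma injective (H : IsCoordChange L U L' U' h) {x : E} (hx : x ∈ U) :
    Function.Injective (fderiv ℝ h x) := by
  refine (injective_iff_map_eq_zero _).2 fun y hy => ?_
  by_contra hne
  have h1 := H.left.pos (z := (x, y)) ⟨hx, hne⟩
  rw [H.eq x hx, hy, H.right.apply_zero (H.maps x hx)] at h1
  exact h1.ne rfl

lemma surjective (H : IsCoordChange L U L' U' h) {x : E} (hx : x ∈ U) :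
    Function.Surjective (fderiv ℝ h x) :=
  (LinearMap.injective_iff_surjective (f := (fderiv ℝ h x).toLinearMap)).1 (H.injective hx)

lemma tangentLift_mem (H : IsCoordChange L U L' U' h) (hz : z ∈ slit U) :
    tangentLift h z ∈ slit U' :=
  ⟨H.maps _ hz.1, fun h0 => hz.2 (H.injective hz.1 (by rw [map_zero]; exact h0))⟩

lemma hasFDerivAt_jacobian (H : IsCoordChange L U L' U' h) (hz : z ∈ slit U) :
    HasFDerivAt (fun q : E × E => fderiv ℝ h q.1)
      ((fderiv ℝ (fderiv ℝ h) z.1).comp (ContinuousLinearMap.fst ℝ E E)) z :=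
  (H.smooth_fderiv hz.1).diffAt.hasFDerivAt.comp z hasFDerivAt_fst

lemma hasFDerivAt_tangentLift (H : IsCoordChange L U L' U' h) (hz : z ∈ slit U) :
    HasFDerivAt (tangentLift h)
      (((fderiv ℝ h z.1).comp (ContinuousLinearMap.fst ℝ E E)).prod
        ((fderiv ℝ h z.1).comp (ContinuousLinearMap.snd ℝ E E)
          + ((fderiv ℝ (fderiv ℝ h) z.1).comp (ContinuousLinearMap.fst ℝ E E)).flip z.2)) z :=
  ((H.smooth _ hz.1).diffAt.hasFDerivAt.comp z hasFDerivAt_fst).prodMk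
    ((H.hasFDerivAt_jacobian hz).clm_apply hasFDerivAt_snd)

/-- The chain rule for a function composed with the tangent map of a coordinate change. -/
lemma fderiv_comp {V : Type*} [NormedAddCommGroup V] [NormedSpace ℝ V]
    (H : IsCoordChange L U L' U' h) (hz : z ∈ slit U)
    {k : E × E → V} (hk : DifferentiableAt ℝ k (tangentLift h z)) (u v : E) :
    fderiv ℝ (fun q => k (tangentLift h q)) z (u, v)
      = xDeriv k (tangentLift h z) (fderiv ℝ h z.1 u)
        + yDeriv k (tangentLift h z) (fderiv ℝ (fderiv ℝ h) z.1 u z.2)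
        + yDeriv k (tangentLift h z) (fderiv ℝ h z.1 v) := by
  have h1 := hk.hasFDerivAt.comp z (H.hasFDerivAt_tangentLift hz)
  change fderiv ℝ (k ∘ tangentLift h) z (u, v) = _
  rw [h1.fderiv, ContinuousLinearMap.comp_apply, fderiv_eq_xDeriv_add_yDeriv]
  simp
  abel

lemma sq_eq (H : IsCoordChange L U L' U' h) (hz : z ∈ slit U) :
    L z ^ 2 = L' (tangentLift h z) ^ 2 := by
  rw [tangentLift, ← H.eq _ hz.1]

lemma ySq_eq (H : IsCoordChange L U L' U' h) (hz : z ∈ slit U) (v : E) :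
    yDeriv (fun w => L w ^ 2) z v
      = yDeriv (fun w => L' w ^ 2) (tangentLift h z) (fderiv ℝ h z.1 v) := by
  rw [yDeriv_congr (H.left.eventuallyEq hz fun q hq => H.sq_eq hq), yDeriv_apply,
    H.fderiv_comp (k := fun w => L' w ^ 2) hz (H.right.smooth_sq (H.tangentLift_mem hz)).diffAt]
  simp

lemma xSq_eq (H : IsCoordChange L U L' U' h) (hz : z ∈ slit U) (v : E) :
    xDeriv (fun w => L w ^ 2) z v
      = xDeriv (fun w => L' w ^ 2) (tangentLift h z) (fderiv ℝ h z.1 v)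
        + yDeriv (fun w => L' w ^ 2) (tangentLift h z) (fderiv ℝ (fderiv ℝ h) z.1 v z.2) := by
  rw [xDeriv_congr (H.left.eventuallyEq hz fun q hq => H.sq_eq hq), xDeriv_apply,
    H.fderiv_comp (k := fun w => L' w ^ 2) hz (H.right.smooth_sq (H.tangentLift_mem hz)).diffAt]
  simp

lemma differentiableAt_comp {V : Type*} [NormedAddCommGroup V] [NormedSpace ℝ V]
    (H : IsCoordChange L U L' U' h) (hz : z ∈ slit U)
    {k : E × E → V} (hk : DifferentiableAt ℝ k (tangentLift h z)) :
    DifferentiableAt ℝ (fun q => k (tangentLift h q)) z :=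
  hk.comp z (H.hasFDerivAt_tangentLift hz).differentiableAt

/-- The source of both transformation laws below: vertical ξ gives the one for g, and ξ = (y, 0) the
one for the spray. -/
lemma fderiv_ySq (H : IsCoordChange L U L' U' h) (hz : z ∈ slit U) (ξ : E × E) (v : E) :
    fderiv ℝ (yDeriv fun w => L w ^ 2) z ξ v
      = xDeriv (yDeriv fun w => L' w ^ 2) (tangentLift h z) (fderiv ℝ h z.1 ξ.1)
          (fderiv ℝ h z.1 v)
        + yDeriv (yDeriv fun w => L' w ^ 2) (tangentLift h z)
          (fderiv ℝ (fderiv ℝ h) z.1 ξ.1 z.2) (fderiv ℝ h z.1 v)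
        + yDeriv (yDeriv fun w => L' w ^ 2) (tangentLift h z) (fderiv ℝ h z.1 ξ.2)
          (fderiv ℝ h z.1 v)
        + yDeriv (fun w => L' w ^ 2) (tangentLift h z) (fderiv ℝ (fderiv ℝ h) z.1 ξ.1 v) := by
  have hd := (H.right.smooth_ySq (H.tangentLift_mem hz)).diffAt
  have h1 : fderiv ℝ (fun q => yDeriv (fun w => L w ^ 2) q v) z
      = fderiv ℝ (fun q => yDeriv (fun w => L' w ^ 2) (tangentLift h q) (fderiv ℝ h q.1 v)) z :=
    (H.left.eventuallyEq hz fun q hq => H.ySq_eq hq v).fderiv_eq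
  have h2 := congrArg (fun T => T ξ) h1
  have hJ := H.hasFDerivAt_jacobian hz
  rw [fderiv_lin (H.left.smooth_ySq hz).diffAt (differentiableAt_const v),
    fderiv_lin (H.differentiableAt_comp hz hd)
      (hJ.differentiableAt.clm_apply (differentiableAt_const v)),
    fderiv_lin hJ.differentiableAt (differentiableAt_const v),
    hJ.fderiv, show ξ = (ξ.1, ξ.2) from rfl, H.fderiv_comp hz hd] at h2
  simpa using h2

lemma metric_eq (H : IsCoordChange L U L' U' h) (hz : z ∈ slit U) (u v : E) :
    metric L z u v = metric L' (tangentLift h z) (fderiv ℝ h z.1 u) (fderiv ℝ h z.1 v) := by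
  have := H.fderiv_ySq hz (0, u) v
  simp only [map_zero, zero_apply, zero_add, add_zero] at this
  simp only [metric, smul_apply]
  rw [yDeriv_apply, this]

/-- The spray is not a vector. The second derivative of h measures the failure, and it cancels in
`accel_eq` against the derivative of the transformed unit tangent. -/
lemma spray_eq (H : IsCoordChange L U L' U' h) (hz : z ∈ slit U) :
    (2 : ℝ) • spray L' (tangentLift h z)
      = (2 : ℝ) • fderiv ℝ h z.1 (spray L z) - fderiv ℝ (fderiv ℝ h) z.1 z.2 z.2 := by
  have hz' := H.tangentLift_mem hz
  refine H.right.metric_ext hz' fun w => ?_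
  obtain ⟨v, rfl⟩ := H.surjective hz.1 w
  have h1 := H.left.metric_spray hz v
  have h2 := H.right.metric_spray hz' (fderiv ℝ h z.1 v)
  rw [xDeriv_apply, H.fderiv_ySq hz, H.xSq_eq hz, H.metric_eq hz,
    fderiv_fderiv_symm (H.smooth _ hz.1) v] at h1
  have h3 : yDeriv (yDeriv fun w => L' w ^ 2) (tangentLift h z)
      (fderiv ℝ (fderiv ℝ h) z.1 z.2 z.2) (fderiv ℝ h z.1 v)
      = 2 * metric L' (tangentLift h z) (fderiv ℝ (fderiv ℝ h) z.1 z.2 z.2)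
        (fderiv ℝ h z.1 v) := by
    simp [metric]
  rw [h3] at h1
  change _ = xDeriv (yDeriv fun w => L' w ^ 2) (tangentLift h z) (fderiv ℝ h z.1 z.2) _ - _ at h2
  simp only [map_zero, zero_apply, add_zero, map_sub, map_smul, sub_apply, smul_apply,
    smul_eq_mul] at h1 ⊢
  linarith

lemma nonlinConn_eq (H : IsCoordChange L U L' U' h) (hz : z ∈ slit U) (v : E) :
    nonlinConn L' (tangentLift h z) (fderiv ℝ h z.1 v)
      = fderiv ℝ h z.1 (nonlinConn L z v) - fderiv ℝ (fderiv ℝ h) z.1 z.2 v := by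
  have hz' := H.tangentLift_mem hz
  have hs := (H.right.smooth_spray hz').diffAt
  have hs0 := (H.left.smooth_spray hz).diffAt
  have hJ := H.hasFDerivAt_jacobian hz
  have h2 : ContDiffAt ℝ ∞ (fderiv ℝ (fderiv ℝ h)) z.1 :=
    (H.smooth_fderiv hz.1).fderiv_right (m := ∞) le_rfl
  have hJ2 : DifferentiableAt ℝ (fun q : E × E => fderiv ℝ (fderiv ℝ h) q.1) z :=
    h2.diffAt.comp z differentiableAt_fst
  have e0 : fderiv ℝ (fun q : E × E => fderiv ℝ (fderiv ℝ h) q.1) z (0, v) = 0 :=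
    congrArg (fun T => T v) (yDeriv_comp_fst (z := z) h2.diffAt)
  have h1 : fderiv ℝ (fun q => (2 : ℝ) • spray L' (tangentLift h q)) z
      = fderiv ℝ (fun q => (2 : ℝ) • fderiv ℝ h q.1 (spray L q)
        - fderiv ℝ (fderiv ℝ h) q.1 q.2 q.2) z :=
    (H.left.eventuallyEq hz fun q hq => H.spray_eq hq).fderiv_eq
  have h3 := congrArg (fun T => T (0, v)) h1
  have hJs : DifferentiableAt ℝ (fun q : E × E => fderiv ℝ h q.1 (spray L q)) z :=
    hJ.differentiableAt.clm_apply hs0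
  rw [fderiv_fun_const_smul (H.differentiableAt_comp hz hs), smul_apply, H.fderiv_comp hz hs,
    fderiv_fun_sub (hJs.fun_const_smul (2 : ℝ))
      ((hJ2.clm_apply differentiableAt_snd).clm_apply differentiableAt_snd), sub_apply,
    fderiv_fun_const_smul hJs, smul_apply, fderiv_lin hJ.differentiableAt hs0, hJ.fderiv,
    fderiv_bilin hJ2 differentiableAt_snd differentiableAt_snd, e0] at h3
  simp only [map_zero, zero_apply, zero_add, fderiv_snd, ContinuousLinearMap.coe_snd',
    ContinuousLinearMap.comp_apply, ContinuousLinearMap.coe_fst'] at h3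
  rw [fderiv_fderiv_symm (H.smooth _ hz.1) v] at h3
  have h4 : (2 : ℝ) • nonlinConn L' (tangentLift h z) (fderiv ℝ h z.1 v)
      = (2 : ℝ) • (fderiv ℝ h z.1 (nonlinConn L z v) - fderiv ℝ (fderiv ℝ h) z.1 z.2 v) := by
    refine h3.trans ?_
    rw [smul_sub, two_smul ℝ (fderiv ℝ (fderiv ℝ h) z.1 z.2 v)]
    rfl
  exact smul_right_injective E (two_ne_zero (α := ℝ)) h4

/-- The Jacobian of h is constant along fibres, so fibre derivatives of g transform without
inhomogeneous terms. -/
lemma cartanV_eq (H : IsCoordChange L U L' U' h) (hz : z ∈ slit U) (u v : E) :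
    cartanV L' (tangentLift h z) (fderiv ℝ h z.1 u) (fderiv ℝ h z.1 v)
      = fderiv ℝ h z.1 (cartanV L z u v) := by
  have hz' := H.tangentLift_mem hz
  refine H.right.metric_ext hz' fun a => ?_
  obtain ⟨w, rfl⟩ := H.surjective hz.1 a
  have h1 := H.left.metric_cartanV hz u v w
  have h2 := H.right.metric_cartanV hz' (fderiv ℝ h z.1 u) (fderiv ℝ h z.1 v) (fderiv ℝ h z.1 w)
  have hJ := H.hasFDerivAt_jacobian hz
  have hm := (H.right.smooth_metric hz').diffAt
  have h3 := congrArg (fun T => T v) (yDeriv_congr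
    (H.left.eventuallyEq hz fun q hq => H.metric_eq hq u w))
  rw [yDeriv_bilin (H.left.smooth_metric hz).diffAt (differentiableAt_const u)
    (differentiableAt_const w), yDeriv_bilin (H.differentiableAt_comp hz hm)
    (hJ.differentiableAt.clm_apply (differentiableAt_const u))
    (hJ.differentiableAt.clm_apply (differentiableAt_const w))] at h3
  have e (a : E) : yDeriv (fun q : E × E => fderiv ℝ h q.1 a) z v = 0 := by
    rw [yDeriv_lin hJ.differentiableAt (differentiableAt_const a), yDeriv_apply, hJ.fderiv]
    simp
  rw [e, e, yDeriv_apply (fun q => metric L' (tangentLift h q)), H.fderiv_comp hz hm] at h3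
  simp only [yDeriv_const, map_zero, zero_apply, add_apply, add_zero, zero_add] at h3
  rw [h3, H.metric_eq hz] at h1
  linarith

/-! ### Curves under a change of coordinates -/

variable {c c' : ℝ → E} {t : ℝ}

lemma hasDerivAt_push (H : IsCoordChange L U L' U' h) (hc : IsRegularAt U c t) {a : ℝ → E}
    (ha : DifferentiableAt ℝ a t) :
    HasDerivAt (fun s => fderiv ℝ h (c s) (a s))
      (fderiv ℝ h (c t) (deriv a t)
        + speed L c t • fderiv ℝ (fderiv ℝ h) (c t) (unitTangent L c t) (a t)) t := by
  have h1 : HasDerivAt (fun s => fderiv ℝ h (c s))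
      (fderiv ℝ (fderiv ℝ h) (c t) (deriv c t)) t :=
    (H.smooth_fderiv hc.mem).diffAt.hasFDerivAt.comp_hasDerivAt t
      hc.contDiffAt.diffAt.hasDerivAt
  refine (h1.clm_apply ha.hasDerivAt).congr_deriv ?_
  rw [hc.deriv_eq H.left, map_smul, smul_apply]
  abel

lemma deriv_curve (H : IsCoordChange L U L' U' h) (hc : IsRegularAt U c t)
    (e : c' =ᶠ[𝓝 t] fun s => h (c s)) : deriv c' t = fderiv ℝ h (c t) (deriv c t) := by
  rw [e.deriv_eq]
  exact ((H.smooth _ hc.mem).diffAt.hasFDerivAt.comp_hasDerivAt t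
    hc.contDiffAt.diffAt.hasDerivAt).deriv

lemma isRegularAt (H : IsCoordChange L U L' U' h) (hc : IsRegularAt U c t)
    (e : c' =ᶠ[𝓝 t] fun s => h (c s)) : IsRegularAt U' c' t := by
  refine ⟨?_, ?_, ?_⟩
  · filter_upwards [e.eventually_nhds, hc.eventually H.left.isOpen] with s hs hcs
    exact ContDiffAt.congr_of_eventuallyEq
      ((H.smooth _ hcs.mem).comp s hcs.contDiffAt) hs
  · rw [e.self_of_nhds]
    exact H.maps _ hc.mem
  · rw [H.deriv_curve hc e]
    exact fun h0 => hc.ne (H.injective hc.mem (by rw [h0, map_zero]))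

lemma speed_eq (H : IsCoordChange L U L' U' h) (hc : IsRegularAt U c t)
    (e : c' =ᶠ[𝓝 t] fun s => h (c s)) : speed L' c' t = speed L c t := by
  rw [speed, H.deriv_curve hc e, e.self_of_nhds, ← H.eq _ hc.mem, speed]

lemma unitTangent_eq (H : IsCoordChange L U L' U' h) (hc : IsRegularAt U c t)
    (e : c' =ᶠ[𝓝 t] fun s => h (c s)) :
    unitTangent L' c' t = fderiv ℝ h (c t) (unitTangent L c t) := by
  change (speed L' c' t)⁻¹ • _ = fderiv ℝ h (c t) ((speed L c t)⁻¹ • _)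
  rw [H.speed_eq hc e, H.deriv_curve hc e, map_smul]

lemma curveLift_eq (H : IsCoordChange L U L' U' h) (hc : IsRegularAt U c t)
    (e : c' =ᶠ[𝓝 t] fun s => h (c s)) :
    curveLift L' c' t = tangentLift h (curveLift L c t) := by
  rw [curveLift, H.unitTangent_eq hc e, e.self_of_nhds]
  rfl

lemma accel_eq (H : IsCoordChange L U L' U' h) (hc : IsRegularAt U c t)
    (e : c' =ᶠ[𝓝 t] fun s => h (c s)) :
    accel L' c' t = fderiv ℝ h (c t) (accel L c t) := by
  have hc' := H.isRegularAt hc e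
  have hX := (hc.contDiffAt_unitTangent H.left).diffAt
  have e1 : unitTangent L' c' =ᶠ[𝓝 t] fun s => fderiv ℝ h (c s) (unitTangent L c s) := by
    filter_upwards [e.eventually_nhds, hc.eventually H.left.isOpen] with s hs hcs
    exact H.unitTangent_eq hcs hs
  rw [hc'.accel_eq H.right, hc.accel_eq H.left, H.speed_eq hc e, H.curveLift_eq hc e,
    H.spray_eq (hc.curveLift_mem H.left), e1.deriv_eq, (H.hasDerivAt_push hc hX).deriv, smul_add,
    smul_smul, inv_mul_cancel₀ (hc.speed_pos H.left).ne', one_smul]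
  simp only [map_add, map_smul, curveLift]
  abel

/-- The second derivative of h from differentiating the pushed-forward field cancels the
inhomogeneous term in the law for N. -/
lemma covDeriv_eq (H : IsCoordChange L U L' U' h) (hc : IsRegularAt U c t)
    (e : c' =ᶠ[𝓝 t] fun s => h (c s)) {a a' : ℝ → E} (ha : DifferentiableAt ℝ a t)
    (ea : a' =ᶠ[𝓝 t] fun s => fderiv ℝ h (c s) (a s)) :
    covDeriv L' c' a' t = fderiv ℝ h (c t) (covDeriv L c a t) := by
  have hc' := H.isRegularAt hc e
  have hz := hc.curveLift_mem H.left
  have h1 := H.nonlinConn_eq hz (a t)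
  have h2 := H.cartanV_eq hz (a t) (accel L c t)
  simp only [curveLift] at h1 h2
  rw [hc'.covDeriv_eq H.right, hc.covDeriv_eq H.left, H.speed_eq hc e, H.curveLift_eq hc e,
    ea.deriv_eq, (H.hasDerivAt_push hc ha).deriv, H.accel_eq hc e, ea.self_of_nhds, smul_add,
    smul_smul, inv_mul_cancel₀ (hc.speed_pos H.left).ne', one_smul]
  simp only [map_add, map_smul, curveLift]
  rw [h1, h2]
  abel

lemma circleDefect_eq (H : IsCoordChange L U L' U' h) (hc : IsRegularAt U c t)
    (e : c' =ᶠ[𝓝 t] fun s => h (c s)) :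
    circleDefect L' c' t = fderiv ℝ h (c t) (circleDefect L c t) := by
  have e1 : accel L' c' =ᶠ[𝓝 t] fun s => fderiv ℝ h (c s) (accel L c s) := by
    filter_upwards [e.eventually_nhds, hc.eventually H.left.isOpen] with s hs hcs
    exact H.accel_eq hcs hs
  rw [circleDefect, circleDefect, H.covDeriv_eq hc e (hc.contDiffAt_accel H.left).diffAt e1,
    H.unitTangent_eq hc e, H.accel_eq hc e, H.curveLift_eq hc e, map_add, map_smul,
    H.metric_eq (hc.curveLift_mem H.left)]
  rfl

/-- The first Frenet curvature does not depend on the coordinates. -/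
lemma curvature₁_eq (H : IsCoordChange L U L' U' h) (hc : IsRegularAt U c t)
    (e : c' =ᶠ[𝓝 t] fun s => h (c s)) : curvature₁ L' c' t = curvature₁ L c t := by
  change gNorm L' _ (accel L' c' t) = gNorm L _ (accel L c t)
  rw [gNorm, gNorm, H.accel_eq hc e, H.curveLift_eq hc e, H.metric_eq (hc.curveLift_mem H.left)]
  rfl

end IsCoordChange

end CoordinateChange

/-! ### From Finsler structures on a manifold to their chart expressions. -/

section Charts

variable {E : Type*} [NormedAddCommGroup E] [NormedSpace ℝ E]
  {M : Type*} [TopologicalSpace M] [ChartedSpace E M] [IsManifold 𝓘(ℝ, E) ∞ M]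

/-- Identifies `E × E` with the tangent bundle of `E`, so that smoothness of F on the tangent bundle
becomes ordinary smoothness in coordinates. -/
lemma contMDiff_modelTangent : ContMDiff 𝓘(ℝ, E × E) 𝓘(ℝ, E).tangent ∞
    (fun z : E × E => (⟨z.1, z.2⟩ : TangentBundle 𝓘(ℝ, E) E)) := by
  have h := contMDiff_tangentBundleModelSpaceHomeomorph_symm (I := 𝓘(ℝ, E)) (n := ∞)
  have h2 : ContMDiff 𝓘(ℝ, E × E) 𝓘(ℝ, E × E) ∞ (fun z : E × E => z) := contMDiff_id
  rw [ModelWithCorners.tangent, ← modelWithCornersSelf_prod] at *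
  exact h.comp h2

lemma mdifferentiable_of_mem_maximalAtlas {e : OpenPartialHomeomorph M E}
    (he : e ∈ IsManifold.maximalAtlas 𝓘(ℝ, E) ∞ M) :
    e.MDifferentiable 𝓘(ℝ, E) 𝓘(ℝ, E) :=
  ⟨(contMDiffOn_of_mem_maximalAtlas he).mdifferentiableOn (by simp),
    (contMDiffOn_symm_of_mem_maximalAtlas he).mdifferentiableOn (by simp)⟩

lemma tangentBundle_mk_congr {p q : M} (h : p = q) {a b : E} (hab : a = b) :
    (⟨p, (a : TangentSpace 𝓘(ℝ, E) p)⟩ : TangentBundle 𝓘(ℝ, E) M)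
      = ⟨q, (b : TangentSpace 𝓘(ℝ, E) q)⟩ := by
  subst h hab
  rfl

lemma FinslerStructure.inChart_eq (F : FinslerStructure E M) (e : OpenPartialHomeomorph M E)
    (z : E × E) : F.inChart e z = F.toFun (tangentMap 𝓘(ℝ, E) 𝓘(ℝ, E) e.symm ⟨z.1, z.2⟩) := rfl

lemma mfderiv_symm_ne_zero {e : OpenPartialHomeomorph M E}
    (he : e ∈ IsManifold.maximalAtlas 𝓘(ℝ, E) ∞ M) {x : E} (hx : x ∈ e.target) {y : E}
    (hy : y ≠ 0) : mfderiv 𝓘(ℝ, E) 𝓘(ℝ, E) e.symm x y ≠ 0 := by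
  intro h
  refine hy ((mdifferentiable_of_mem_maximalAtlas he).symm.mfderiv_injective hx ?_)
  rw [h]
  exact (map_zero (mfderiv 𝓘(ℝ, E) 𝓘(ℝ, E) e.symm x)).symm

lemma FinslerStructure.contDiffAt_inChart (F : FinslerStructure E M)
    {e : OpenPartialHomeomorph M E} (he : e ∈ IsManifold.maximalAtlas 𝓘(ℝ, E) ∞ M)
    {z : E × E} (hz : z ∈ slit e.target) : ContDiffAt ℝ ∞ (F.inChart e) z := by
  have : IsManifold 𝓘(ℝ, E) 1 M := .of_le (n := ∞) (by simp)
  rw [← contMDiffAt_iff_contDiffAt]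
  have h1 := (contMDiffOn_symm_of_mem_maximalAtlas he).contMDiffOn_tangentMapWithin (m := ∞) le_rfl
    e.open_target.uniqueMDiffOn
  have hop : IsOpen ((Bundle.TotalSpace.proj : TangentBundle 𝓘(ℝ, E) E → E) ⁻¹' e.target) :=
    e.open_target.preimage (FiberBundle.continuous_proj E (TangentSpace 𝓘(ℝ, E)))
  have h2 : ContMDiffAt 𝓘(ℝ, E).tangent 𝓘(ℝ, E).tangent ∞
      (tangentMap 𝓘(ℝ, E) 𝓘(ℝ, E) e.symm) (⟨z.1, z.2⟩ : TangentBundle 𝓘(ℝ, E) E) := by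
    refine (h1.contMDiffAt (hop.mem_nhds hz.1)).congr_of_eventuallyEq ?_
    filter_upwards [hop.mem_nhds (show (⟨z.1, z.2⟩ : TangentBundle 𝓘(ℝ, E) E) ∈ _ from hz.1)]
      with p hp
    refine (tangentMapWithin_eq_tangentMap (e.open_target.uniqueMDiffOn p.1 hp) ?_).symm
    exact (mdifferentiable_of_mem_maximalAtlas he).mdifferentiableAt_symm hp
  have h3 := F.smooth (tangentMap 𝓘(ℝ, E) 𝓘(ℝ, E) e.symm ⟨z.1, z.2⟩)
    (mfderiv_symm_ne_zero he hz.1 hz.2)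
  have h4 : ContMDiffAt 𝓘(ℝ, E).tangent 𝓘(ℝ, ℝ) ∞
      (F.toFun ∘ tangentMap 𝓘(ℝ, E) 𝓘(ℝ, E) e.symm)
      (⟨z.1, z.2⟩ : TangentBundle 𝓘(ℝ, E) E) := h3.comp _ h2
  exact ContMDiffAt.comp (f := fun z : E × E => (⟨z.1, z.2⟩ : TangentBundle 𝓘(ℝ, E) E)) z h4
    (contMDiff_modelTangent z)

lemma fderiv_fderiv_comp_clm {V : Type*} [NormedAddCommGroup V] [NormedSpace ℝ V]
    {Ψ : E → V} (B : E →L[ℝ] E) {y : E}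
    (hΨ : ∀ᶠ q in 𝓝 (B y), DifferentiableAt ℝ Ψ q)
    (hΨ2 : DifferentiableAt ℝ (fderiv ℝ Ψ) (B y)) (u v : E) :
    fderiv ℝ (fderiv ℝ (fun q => Ψ (B q))) y u v = fderiv ℝ (fderiv ℝ Ψ) (B y) (B u) (B v) := by
  have h1 : fderiv ℝ (fun q => Ψ (B q)) =ᶠ[𝓝 y] fun q => (fderiv ℝ Ψ (B q)).comp B := by
    filter_upwards [B.continuous.continuousAt.eventually hΨ] with q hq
    exact (hq.hasFDerivAt.comp q B.hasFDerivAt).fderiv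
  have h2 : HasFDerivAt (fun q => fderiv ℝ Ψ (B q)) ((fderiv ℝ (fderiv ℝ Ψ) (B y)).comp B) y :=
    hΨ2.hasFDerivAt.comp y B.hasFDerivAt
  rw [h1.fderiv_eq, (h2.clm_comp (hasFDerivAt_const B y)).fderiv]
  simp

/-- Second derivatives along a fibre. -/
lemma fderiv_fderiv_fiber {V : Type*} [NormedAddCommGroup V] [NormedSpace ℝ V]
    {k : E × E → V} {U : Set E} (hk : ∀ z ∈ slit U, ContDiffAt ℝ ∞ k z)
    {z : E × E} (hz : z ∈ slit U) (u v : E) :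
    fderiv ℝ (fderiv ℝ (fun y => k (z.1, y))) z.2 u v = yDeriv (yDeriv k) z u v := by
  have hj (q : E) : HasFDerivAt (fun y : E => (z.1, y)) (ContinuousLinearMap.inr ℝ E E) q :=
    hasFDerivAt_prodMk_right z.1 q
  have h1 : fderiv ℝ (fun y => k (z.1, y)) =ᶠ[𝓝 z.2] fun q => yDeriv k (z.1, q) := by
    filter_upwards [isOpen_ne.mem_nhds hz.2] with q hq
    exact ((hk (z.1, q) ⟨hz.1, hq⟩).diffAt.hasFDerivAt.comp q (hj q)).fderiv
  have h2 := (contDiffAt_yDeriv (hk z hz)).diffAt.hasFDerivAt.comp z.2 (hj z.2)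
  rw [h1.fderiv_eq]
  change fderiv ℝ (yDeriv k ∘ fun q => (z.1, q)) z.2 u v = _
  rw [h2.fderiv]
  rfl

lemma IsLocalFinsler.mono {L : E × E → ℝ} {U V : Set E} (h : IsLocalFinsler L U) (hV : IsOpen V)
    (hVU : V ⊆ U) : IsLocalFinsler L V :=
  ⟨hV, fun z hz => h.smooth z ⟨hVU hz.1, hz.2⟩, h.nonneg,
    fun x hx => h.homogeneous x (hVU hx), fun z hz => h.posDef z ⟨hVU hz.1, hz.2⟩⟩

/-- Positive definiteness is assumed for the fibre Hessian in each tangent space. The chart acts on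
fibres by a linear isomorphism, so the coordinate metric is the pull-back of that Hessian. -/
lemma FinslerStructure.isLocalFinsler (F : FinslerStructure E M)
    {e : OpenPartialHomeomorph M E} (he : e ∈ IsManifold.maximalAtlas 𝓘(ℝ, E) ∞ M) :
    IsLocalFinsler (F.inChart e) e.target := by
  refine ⟨e.open_target, fun z hz => F.contDiffAt_inChart he hz, fun z => F.nonneg _, ?_, ?_⟩
  · intro x _ y r hr
    rw [FinslerStructure.inChart, FinslerStructure.inChart,
      ← F.homogeneous (e.symm x) (mfderiv 𝓘(ℝ, E) 𝓘(ℝ, E) e.symm x y) r hr]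
    congr 2
    exact map_smul (mfderiv 𝓘(ℝ, E) 𝓘(ℝ, E) e.symm x) r y
  · intro z hz w hw
    have hm := mdifferentiable_of_mem_maximalAtlas he
    let A : E →L[ℝ] E := mfderiv 𝓘(ℝ, E) 𝓘(ℝ, E) e.symm z.1
    let B : E →L[ℝ] E := mfderiv 𝓘(ℝ, E) 𝓘(ℝ, E) e (e.symm z.1)
    have hBA (u : E) : B (A u) = u := by
      have := hm.comp_symm_deriv hz.1
      exact congrArg (fun T : E →L[ℝ] E => T u) this
    have hAB (u : E) : A (B u) = u := by
      have := hm.symm_comp_deriv (e.map_target hz.1)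
      rw [e.right_inv hz.1] at this
      exact congrArg (fun T : E →L[ℝ] E => T u) this
    have hAy : A z.2 ≠ 0 := mfderiv_symm_ne_zero he hz.1 hz.2
    have hAw : A w ≠ 0 := mfderiv_symm_ne_zero he hz.1 hw
    have hsm : ∀ q ∈ slit e.target, ContDiffAt ℝ ∞ (fun q => F.inChart e q ^ 2) q :=
      fun q hq => (F.contDiffAt_inChart he hq).pow 2
    let Ψ : E → ℝ := fun y => F.inChart e (z.1, y) ^ 2
    have hΨ : ∀ y : E, y ≠ 0 → ContDiffAt ℝ ∞ Ψ y := fun y hy =>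
      (hsm (z.1, y) ⟨hz.1, hy⟩).comp y (contDiffAt_const.prodMk contDiffAt_id)
    have hΦ : (fun y' : E => F.toFun ⟨e.symm z.1, (y' : TangentSpace 𝓘(ℝ, E) (e.symm z.1))⟩ ^ 2)
        = fun y' => Ψ (B y') := by
      funext y'
      change _ = F.toFun ⟨e.symm z.1, (A (B y') : E)⟩ ^ 2
      rw [hAB]
    have hpos := F.posDef (e.symm z.1) (A z.2) (A w) hAy hAw
    rw [hΦ, fderiv_fderiv_comp_clm B, hBA, hBA] at hpos
    · have h3 := fderiv_fderiv_fiber hsm hz w w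
      rw [metric, smul_apply, smul_apply, ← h3]
      exact hpos
    · rw [hBA]
      filter_upwards [isOpen_ne.mem_nhds hz.2] with q hq
      exact (hΨ q hq).diffAt
    · rw [hBA]
      exact ((hΨ _ hz.2).fderiv_right (m := ∞) le_rfl).diffAt

end Charts

/-! ### Dependence on the germ of the curve only. -/

section Germs

variable {E : Type*} [NormedAddCommGroup E] [NormedSpace ℝ E]
variable {L : E × E → ℝ} {c c' : ℝ → E} {t : ℝ}

lemma unitTangent_congr (h : c =ᶠ[𝓝 t] c') : unitTangent L c =ᶠ[𝓝 t] unitTangent L c' := by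
  filter_upwards [h, h.deriv] with s h1 h2
  rw [unitTangent, unitTangent, h1, h2]

lemma curveLift_congr (h : c =ᶠ[𝓝 t] c') : curveLift L c =ᶠ[𝓝 t] curveLift L c' := by
  filter_upwards [h, unitTangent_congr (L := L) h] with s h1 h2
  rw [curveLift, curveLift, h1, h2]

lemma covDeriv_congr_curve (h : c =ᶠ[𝓝 t] c') {a a' : ℝ → E} (ha : a =ᶠ[𝓝 t] a') :
    covDeriv L c a t = covDeriv L c' a' t := by
  have h1 := curveLift_congr (L := L) h
  rw [covDeriv, covDeriv, h.self_of_nhds, h.deriv_eq, ha.self_of_nhds, ha.deriv_eq,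
    h1.self_of_nhds, h1.deriv_eq]

lemma accel_congr (h : c =ᶠ[𝓝 t] c') : accel L c =ᶠ[𝓝 t] accel L c' := by
  filter_upwards [h.eventually_nhds] with s hs
  exact covDeriv_congr_curve hs (unitTangent_congr hs)

lemma circleDefect_congr (h : c =ᶠ[𝓝 t] c') : circleDefect L c t = circleDefect L c' t := by
  have h1 := accel_congr (L := L) h
  rw [circleDefect, circleDefect, covDeriv_congr_curve h h1, h1.self_of_nhds,
    (curveLift_congr (L := L) h).self_of_nhds, (unitTangent_congr (L := L) h).self_of_nhds]

end Germs

/-! ### Geodesic circles and conformal maps on the manifold. -/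

section Charts

variable {E : Type*} [NormedAddCommGroup E] [NormedSpace ℝ E]
  {M : Type*} [TopologicalSpace M] [ChartedSpace E M] [IsManifold 𝓘(ℝ, E) ∞ M]
  {F F' : FinslerStructure E M} {e e' : OpenPartialHomeomorph M E}

lemma tangentMap_congr {f g : E → M} {x : E} (h : f =ᶠ[𝓝 x] g) (y : E) :
    tangentMap 𝓘(ℝ, E) 𝓘(ℝ, E) f (⟨x, y⟩ : TangentBundle 𝓘(ℝ, E) E)
      = tangentMap 𝓘(ℝ, E) 𝓘(ℝ, E) g ⟨x, y⟩ :=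
  tangentBundle_mk_congr h.self_of_nhds
    (congrArg (fun T : E →L[ℝ] E => T y) h.mfderiv_eq)

lemma isCoordChange [FiniteDimensional ℝ E] (F : FinslerStructure E M)
    (he : e ∈ IsManifold.maximalAtlas 𝓘(ℝ, E) ∞ M)
    (he' : e' ∈ IsManifold.maximalAtlas 𝓘(ℝ, E) ∞ M) :
    IsCoordChange (F.inChart e) (e.symm.trans e').source (F.inChart e') e'.target
      (fun x => e' (e.symm x)) := by
  have hmem : ∀ x ∈ (e.symm.trans e').source, x ∈ e.target ∧ e.symm x ∈ e'.source := by
    intro x hx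
    simpa using hx
  have hsm : ∀ x ∈ (e.symm.trans e').source,
      ContMDiffAt 𝓘(ℝ, E) 𝓘(ℝ, E) ∞ (fun x => e' (e.symm x)) x := by
    intro x hx
    exact (contMDiffAt_of_mem_maximalAtlas he' (hmem x hx).2).comp x
      (contMDiffAt_symm_of_mem_maximalAtlas he (hmem x hx).1)
  refine ⟨(F.isLocalFinsler he).mono (e.symm.trans e').open_source fun x hx => (hmem x hx).1,
    F.isLocalFinsler he', fun x hx => e'.map_source (hmem x hx).2,
    fun x hx => (hsm x hx).contDiffAt, ?_⟩
  intro x hx y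
  have h1 : e.symm =ᶠ[𝓝 x] e'.symm ∘ fun x => e' (e.symm x) := by
    filter_upwards [(e.symm.trans e').open_source.mem_nhds hx] with q hq
    exact (e'.left_inv (hmem q hq).2).symm
  have h2 : tangentMap 𝓘(ℝ, E) 𝓘(ℝ, E) (e'.symm ∘ fun x => e' (e.symm x))
      (⟨x, y⟩ : TangentBundle 𝓘(ℝ, E) E) = _ :=
    tangentMap_comp_at (I' := 𝓘(ℝ, E)) _
      ((mdifferentiable_of_mem_maximalAtlas he').mdifferentiableAt_symm
        (e'.map_source (hmem x hx).2))
      ((hsm x hx).mdifferentiableAt (by simp))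
  rw [F.inChart_eq, tangentMap_congr h1, h2, F.inChart_eq]
  simp only [tangentMap, mfderiv_eq_fderiv]
  rfl

/-- The chart obtained from `e'` by pulling back along a diffeomorphism. -/
lemma pullbackChart_mem (f : M ≃ₘ⟮𝓘(ℝ, E), 𝓘(ℝ, E)⟯ M)
    (he' : e' ∈ IsManifold.maximalAtlas 𝓘(ℝ, E) ∞ M) :
    f.toHomeomorph.transOpenPartialHomeomorph e' ∈ IsManifold.maximalAtlas 𝓘(ℝ, E) ∞ M := by
  refine OpenPartialHomeomorph.mem_maximalAtlas_of_contMDiffOn _ ?_ ?_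
  · exact (contMDiffOn_of_mem_maximalAtlas he').comp f.contMDiff.contMDiffOn fun _ hx => hx
  · exact f.symm.contMDiff.comp_contMDiffOn (contMDiffOn_symm_of_mem_maximalAtlas he')

/-- In charts matched by f the map f is the identity, so conformality reads L' = e^φ L on one open
set. -/
lemma isConformalPair [FiniteDimensional ℝ E] {f : M ≃ₘ⟮𝓘(ℝ, E), 𝓘(ℝ, E)⟯ M} {φ : M → ℝ}
    (hf : IsConformalWith F F' f φ)
    (he : e ∈ IsManifold.maximalAtlas 𝓘(ℝ, E) ∞ M)
    (he' : e' ∈ IsManifold.maximalAtlas 𝓘(ℝ, E) ∞ M) (ht : e.target = e'.target)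
    (hs : ∀ x, e'.symm x = f (e.symm x)) :
    IsConformalPair (F.inChart e) (F'.inChart e') e.target (φ ∘ e.symm) := by
  refine ⟨F.isLocalFinsler he, ht ▸ F'.isLocalFinsler he', ?_, ?_⟩
  · intro x hx
    exact ContMDiffAt.contDiffAt
      ((hf.1 (e.symm x)).comp x (contMDiffAt_symm_of_mem_maximalAtlas he hx))
  · intro x hx y
    have h1 : (e'.symm : E → M) = f ∘ e.symm := funext hs
    have h2 : tangentMap 𝓘(ℝ, E) 𝓘(ℝ, E) (f ∘ e.symm) (⟨x, y⟩ : TangentBundle 𝓘(ℝ, E) E) = _ :=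
      tangentMap_comp_at (I' := 𝓘(ℝ, E)) _ (f.mdifferentiable (by simp) _)
        ((mdifferentiable_of_mem_maximalAtlas he).mdifferentiableAt_symm hx)
    rw [F'.inChart_eq, h1, h2]
    exact hf.2 _ _

variable {c : ℝ → M} {I : Set ℝ} {t : ℝ}

lemma deriv_chart_comp (he : e ∈ IsManifold.maximalAtlas 𝓘(ℝ, E) ∞ M)
    (hc : MDifferentiableAt 𝓘(ℝ, ℝ) 𝓘(ℝ, E) c t) (ht : c t ∈ e.source) :
    deriv (e ∘ c) t = mfderiv 𝓘(ℝ, E) 𝓘(ℝ, E) e (c t) (mfderiv 𝓘(ℝ, ℝ) 𝓘(ℝ, E) c t (1 : ℝ)) := by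
  have h1 := mfderiv_comp (I' := 𝓘(ℝ, E)) t
    ((mdifferentiable_of_mem_maximalAtlas he).mdifferentiableAt ht) hc
  rw [mfderiv_eq_fderiv] at h1
  rw [← fderiv_apply_one_eq_deriv, h1]
  rfl

lemma isRegularAt_chart (he : e ∈ IsManifold.maximalAtlas 𝓘(ℝ, E) ∞ M) (hI : IsOpen I)
    (hc : ContMDiffOn 𝓘(ℝ, ℝ) 𝓘(ℝ, E) ∞ c I)
    (hne : ∀ t ∈ I, mfderiv 𝓘(ℝ, ℝ) 𝓘(ℝ, E) c t (1 : ℝ) ≠ 0) (htI : t ∈ I)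
    (ht : c t ∈ e.source) : IsRegularAt e.target (e ∘ c) t := by
  have hcs : ∀ s ∈ I, ContMDiffAt 𝓘(ℝ, ℝ) 𝓘(ℝ, E) ∞ c s :=
    fun s hs => hc.contMDiffAt (hI.mem_nhds hs)
  refine ⟨?_, e.map_source ht, ?_⟩
  · filter_upwards [hI.mem_nhds htI,
      (hcs t htI).continuousAt.eventually_mem (e.open_source.mem_nhds ht)] with s hs hs'
    exact ((contMDiffAt_of_mem_maximalAtlas he hs').comp s (hcs s hs)).contDiffAt
  · rw [deriv_chart_comp he ((hcs t htI).mdifferentiableAt (by simp)) ht]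
    intro h0
    refine hne t htI ((mdifferentiable_of_mem_maximalAtlas he).mfderiv_injective ht ?_)
    rw [h0]
    exact (map_zero (mfderiv 𝓘(ℝ, E) 𝓘(ℝ, E) e (c t))).symm

variable [FiniteDimensional ℝ E]

lemma eventuallyEq_chart_change (hct : ContinuousAt c t) (ht : c t ∈ e.source) :
    e' ∘ c =ᶠ[𝓝 t] fun s => e' (e.symm ((e ∘ c) s)) := by
  filter_upwards [hct.eventually_mem (e.open_source.mem_nhds ht)] with s hs
  simp [e.left_inv hs]

/-- Regularity in the overlap of two charts. -/
lemma isRegularAt_overlap (he : e ∈ IsManifold.maximalAtlas 𝓘(ℝ, E) ∞ M) (hI : IsOpen I)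
    (hc : ContMDiffOn 𝓘(ℝ, ℝ) 𝓘(ℝ, E) ∞ c I)
    (hne : ∀ t ∈ I, mfderiv 𝓘(ℝ, ℝ) 𝓘(ℝ, E) c t (1 : ℝ) ≠ 0) (htI : t ∈ I)
    (ht : c t ∈ e.source) (ht' : c t ∈ e'.source) :
    IsRegularAt (e.symm.trans e').source (e ∘ c) t := by
  have h := isRegularAt_chart he hI hc hne htI ht
  refine ⟨h.smooth, ?_, h.ne⟩
  simp [e.map_source ht, e.left_inv ht, ht']

/-- The third order equation characterizes geodesic circles, and it can be checked in one chart
around each point. -/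
lemma isGeodesicCircle_of_circleDefect (F : FinslerStructure E M) (hI : IsOpen I)
    (hIc : I.OrdConnected) (hc : ContMDiffOn 𝓘(ℝ, ℝ) 𝓘(ℝ, E) ∞ c I)
    (hne : ∀ t ∈ I, mfderiv 𝓘(ℝ, ℝ) 𝓘(ℝ, E) c t (1 : ℝ) ≠ 0)
    (h : ∀ t ∈ I, ∃ e ∈ IsManifold.maximalAtlas 𝓘(ℝ, E) ∞ M, c t ∈ e.source ∧
      circleDefect (F.inChart e) (e ∘ c) t = 0) : IsGeodesicCircle F c I := by
  refine ⟨hI, hIc, hc, hne, ?_⟩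
  have hcont : ∀ s ∈ I, ContinuousAt c s := fun s hs => hc.continuousOn.continuousAt (hI.mem_nhds hs)
  have hd : ∀ e ∈ IsManifold.maximalAtlas 𝓘(ℝ, E) ∞ M, ∀ t ∈ I, c t ∈ e.source →
      circleDefect (F.inChart e) (e ∘ c) t = 0 := by
    intro e he t htI ht
    obtain ⟨e₀, he₀, ht₀, h0⟩ := h t htI
    rw [(isCoordChange F he₀ he).circleDefect_eq (isRegularAt_overlap he₀ hI hc hne htI ht₀ ht)
      (eventuallyEq_chart_change (hcont t htI) ht₀), h0, map_zero]
  -- A chart-free version of κ₁. The chart used varies with s, but by invariance k agrees near each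
  -- t with the curvature in a fixed chart.
  let k : ℝ → ℝ := fun s => curvature₁ (F.inChart (chartAt E (c s))) (chartAt E (c s) ∘ c) s
  have hchart : ∀ x : M, chartAt E x ∈ IsManifold.maximalAtlas 𝓘(ℝ, E) ∞ M := fun x =>
    IsManifold.chart_mem_maximalAtlas x
  have hk : ∀ e ∈ IsManifold.maximalAtlas 𝓘(ℝ, E) ∞ M, ∀ t ∈ I, c t ∈ e.source →
      curvature₁ (F.inChart e) (e ∘ c) t = k t := by
    intro e he t htI ht
    exact (isCoordChange F (hchart (c t)) he).curvature₁_eq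
      (isRegularAt_overlap (hchart (c t)) hI hc hne htI (mem_chart_source E (c t)) ht)
      (eventuallyEq_chart_change (hcont t htI) (mem_chart_source E (c t)))
  have hk' : ∀ e ∈ IsManifold.maximalAtlas 𝓘(ℝ, E) ∞ M, ∀ t ∈ I, c t ∈ e.source →
      ∀ᶠ s in 𝓝 t, s ∈ I ∧ curvature₁ (F.inChart e) (e ∘ c) s = k s := by
    intro e he t htI ht
    filter_upwards [hI.mem_nhds htI,
      (hcont t htI).eventually_mem (e.open_source.mem_nhds ht)] with s hs hs'
    exact ⟨hs, hk e he s hs hs'⟩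
  have hder : ∀ t ∈ I, HasDerivAt (fun s => k s ^ 2) 0 t := by
    intro t htI
    have hs := mem_chart_source E (c t)
    refine ((isRegularAt_chart (hchart (c t)) hI hc hne htI hs).hasDerivAt_curvature₁_sq
      (F.isLocalFinsler (hchart (c t))) (hd _ (hchart _) t htI hs)).congr_of_eventuallyEq ?_
    filter_upwards [hk' _ (hchart _) t htI hs] with s hs
    rw [hs.2]
  have hconst : ∃ κ : ℝ, ∀ t ∈ I, k t = κ := by
    obtain ⟨a, ha⟩ := hI.exists_is_const_of_deriv_eq_zero hIc.isPreconnected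
      (fun s hs => (hder s hs).differentiableAt.differentiableWithinAt)
      (fun s hs => (hder s hs).deriv)
    -- Only k² is known to be constant; k is recovered from it because it is a square root, hence
    -- nonnegative.
    refine ⟨Real.sqrt a, fun t ht => ?_⟩
    rw [← ha t ht]
    exact (Real.sqrt_sq (Real.sqrt_nonneg _)).symm
  obtain ⟨κ, hκ⟩ := hconst
  refine ⟨κ, fun e he t htI ht => ⟨by rw [hk e he t htI ht, hκ t htI], ?_⟩⟩
  refine ((isRegularAt_chart he hI hc hne htI ht).curvature₂_eq_zero_iff (F.isLocalFinsler he)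
    (κ := κ) ?_).2 (hd e he t htI ht)
  filter_upwards [hk' e he t htI ht] with s hs
  rw [hs.2, hκ s hs.1]

lemma IsGeodesicCircle.circleDefect_eq_zero (h : IsGeodesicCircle F c I)
    (he : e ∈ IsManifold.maximalAtlas 𝓘(ℝ, E) ∞ M) (htI : t ∈ I) (ht : c t ∈ e.source) :
    circleDefect (F.inChart e) (e ∘ c) t = 0 := by
  obtain ⟨hI, _, hc, hne, κ, hκ⟩ := h
  refine ((isRegularAt_chart he hI hc hne htI ht).curvature₂_eq_zero_iff (F.isLocalFinsler he)
    (κ := κ) ?_).1 (hκ e he t htI ht).2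
  filter_upwards [hI.mem_nhds htI, (hc.continuousOn.continuousAt (hI.mem_nhds htI)).eventually_mem
    (e.open_source.mem_nhds ht)] with s hs hs'
  exact (hκ e he s hs hs').1

/-! ### Möbius transformations and geodesic circles -/

variable {f : M ≃ₘ⟮𝓘(ℝ, E), 𝓘(ℝ, E)⟯ M} {φ : M → ℝ}

/-- With D tangent to the curve, the two circle equations differ by the factor e^{-3φ}. -/
lemma mapsGeodesicCircles_of_schwarzianVanishes (hf : IsConformalWith F F' f φ)
    (hS : SchwarzianVanishes F φ) : MapsGeodesicCircles F F' f := by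
  intro c I hcirc
  obtain ⟨hI, hIc, hc, hne, -⟩ := id hcirc
  refine isGeodesicCircle_of_circleDefect F' hI hIc (f.contMDiff.comp_contMDiffOn hc) ?_ ?_
  · intro t ht h0
    have hct : MDifferentiableAt 𝓘(ℝ, ℝ) 𝓘(ℝ, E) c t :=
      (hc.contMDiffAt (hI.mem_nhds ht)).mdifferentiableAt (by simp)
    have h1 := mfderiv_comp (I' := 𝓘(ℝ, E)) t (f.mdifferentiable (by simp) (c t)) hct
    have h2 : mfderiv 𝓘(ℝ, E) 𝓘(ℝ, E) f (c t) (mfderiv 𝓘(ℝ, ℝ) 𝓘(ℝ, E) c t (1 : ℝ)) = 0 := by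
      rw [← h0, h1]
      rfl
    refine hne t ht ((f.toOpenPartialHomeomorph_mdifferentiable (by simp)).mfderiv_injective
      (Set.mem_univ (c t)) ?_)
    refine h2.trans ?_
    exact (map_zero (mfderiv 𝓘(ℝ, E) 𝓘(ℝ, E) f (c t))).symm
  · intro t ht
    have he' : chartAt E (f (c t)) ∈ IsManifold.maximalAtlas 𝓘(ℝ, E) ∞ M :=
      IsManifold.chart_mem_maximalAtlas _
    have hs : f (c t) ∈ (chartAt E (f (c t))).source := mem_chart_source E _
    refine ⟨_, he', hs, ?_⟩
    -- In the chart e' ∘ f the curve c has the same coordinate expression as f ∘ c in e'.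
    have he := pullbackChart_mem f he'
    have hp := isConformalPair hf he he' rfl fun x => (f.apply_symm_apply _).symm
    have h1 := hcirc.circleDefect_eq_zero he ht hs
    have h2 := hp.circleDefect_eq_of_schwarzian (fun z hz ξ w => hS _ he z.1 hz.1 z.2 hz.2 ξ w)
      (isRegularAt_chart he hI hc hne ht hs)
    rw [h1, smul_zero] at h2
    exact h2

/-- At time 0 a circle with unit tangent y and acceleration w tests the normal part of D at (y, w).
Since both it and its image satisfy the circle equation, that part is zero, which is the hypothesis
of `schwarzian_eq_zero`. -/
lemma schwarzianVanishes_of_mapsGeodesicCircles (hf : IsConformalWith F F' f φ)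
    (h : MapsGeodesicCircles F F' f) : SchwarzianVanishes F φ := by
  intro e he x hx y hy
  have he' := pullbackChart_mem f.symm he
  have hp := isConformalPair hf he he' rfl fun x => rfl
  refine hp.left.schwarzian_eq_zero hp.factor ?_ (z := (x, y)) ⟨hx, hy⟩
  intro z hz h1 w hw
  obtain ⟨c, hc0, hca, ε, hε, hc⟩ := hp.left.exists_circle hz h1 hw
  have h0 : (0 : ℝ) ∈ Set.Ioo (-ε) ε := ⟨by linarith, hε⟩
  have hmem : ∀ t ∈ Set.Ioo (-ε) ε, c t ∈ e.target := fun t ht => (hc t ht).1.mem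
  have hgerm : ∀ t ∈ Set.Ioo (-ε) ε, e ∘ (e.symm ∘ c) =ᶠ[𝓝 t] c := by
    intro t ht
    filter_upwards [isOpen_Ioo.mem_nhds ht] with s hs
    exact e.right_inv (hmem s hs)
  have hsm : ContMDiffOn 𝓘(ℝ, ℝ) 𝓘(ℝ, E) ∞ (e.symm ∘ c) (Set.Ioo (-ε) ε) := fun t ht =>
    ((contMDiffAt_symm_of_mem_maximalAtlas he (hmem t ht)).comp t
      (hc t ht).1.contDiffAt.contMDiffAt).contMDiffWithinAt
  have hcirc : IsGeodesicCircle F (e.symm ∘ c) (Set.Ioo (-ε) ε) := by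
    refine isGeodesicCircle_of_circleDefect F isOpen_Ioo Set.ordConnected_Ioo hsm ?_ ?_
    · intro t ht hz0
      refine (hc t ht).1.ne ?_
      have h2 := deriv_chart_comp (c := e.symm ∘ c) he
        ((hsm.contMDiffAt (isOpen_Ioo.mem_nhds ht)).mdifferentiableAt (by simp))
        (e.map_target (hmem t ht))
      rw [(hgerm t ht).deriv_eq] at h2
      rw [h2, hz0]
      exact map_zero (mfderiv 𝓘(ℝ, E) 𝓘(ℝ, E) e _)
    · intro t ht
      refine ⟨e, he, e.map_target (hmem t ht), ?_⟩
      rw [circleDefect_congr (hgerm t ht), (hc t ht).2]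
  have himg := h _ _ hcirc
  have h2 := himg.circleDefect_eq_zero he' h0 (by
    change f.symm (f (e.symm (c 0))) ∈ e.source
    rw [f.symm_apply_apply]
    exact e.map_target (hmem 0 h0))
  have h3 : (f.symm.toHomeomorph.transOpenPartialHomeomorph e) ∘ (f ∘ (e.symm ∘ c)) =ᶠ[𝓝 0] c := by
    filter_upwards [isOpen_Ioo.mem_nhds h0] with s hs
    change e (f.symm (f (e.symm (c s)))) = c s
    rw [f.symm_apply_apply, e.right_inv (hmem s hs)]
  rw [circleDefect_congr h3, hp.circleDefect_eq (hc 0 h0).1, (hc 0 h0).2, smul_eq_zero] at h2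
  have h4 := h2.resolve_left (Real.exp_pos _).ne'
  have hcx : c 0 = z.1 := congrArg Prod.fst hc0
  have hcX : unitTangent (F.inChart e) c 0 = z.2 := congrArg Prod.snd hc0
  have hgrad := (hp.left.smooth_grad hp.factor ((hc 0 h0).1.curveLift_mem hp.left)).diffAt
  have h5 : conformalDefect (F.inChart e) (φ ∘ e.symm) c 0
      = cartanDeriv (F.inChart e) (grad (F.inChart e) (φ ∘ e.symm)) z
        (z.2, w - (2 : ℝ) • spray (F.inChart e) z)
        - fderiv ℝ (φ ∘ e.symm) z.1 z.2 • grad (F.inChart e) (φ ∘ e.symm) z := by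
    rw [conformalDefect, (hc 0 h0).1.covDeriv_section hp.left hgrad, hc0, hca, hcX, hcx]
  -- The condition now reads D = g(D, X) X, and the multiple of y asked for is g(D, X).
  rw [h5, hcX, zero_sub, neg_add_eq_zero] at h4
  exact ⟨_, h4⟩

theorem isMobius_iff_mapsGeodesicCircles (hf : IsConformal F F' f) :
    IsMobius F F' f ↔ MapsGeodesicCircles F F' f := by
  constructor
  · rintro ⟨φ, hφ, hS⟩
    exact mapsGeodesicCircles_of_schwarzianVanishes hφ hS
  · intro h
    obtain ⟨φ, hφ⟩ := hf
    exact ⟨φ, hφ, schwarzianVanishes_of_mapsGeodesicCircles hφ h⟩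

end Charts

end FinslerGeom

end

/-- The second half is formal: Möbius transformations are conformal by definition, so equality of
the two groups only asks for the other inclusion. -/
theorem theorem1p2 {E : Type*} [NormedAddCommGroup E] [NormedSpace ℝ E] [FiniteDimensional ℝ E]
    {M : Type*} [TopologicalSpace M] [ChartedSpace E M] [IsManifold 𝓘(ℝ, E) ∞ M]
    (F : FinslerGeom.FinslerStructure E M) :
    (∀ (F' : FinslerGeom.FinslerStructure E M) (f : M ≃ₘ⟮𝓘(ℝ, E), 𝓘(ℝ, E)⟯ M),
      FinslerGeom.IsConformal F F' f →
        (FinslerGeom.IsMobius F F' f ↔ FinslerGeom.MapsGeodesicCircles F F' f)) ∧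
    (FinslerGeom.conformalGroup F = FinslerGeom.mobiusGroup F ↔
      ∀ f ∈ FinslerGeom.conformalGroup F, FinslerGeom.MapsGeodesicCircles F F f) := by
  refine ⟨fun F' f hf => FinslerGeom.isMobius_iff_mapsGeodesicCircles hf, ?_, ?_⟩
  · intro h f hf
    exact (FinslerGeom.isMobius_iff_mapsGeodesicCircles hf).1
      (show f ∈ FinslerGeom.mobiusGroup F from h ▸ hf)
  · intro h
    ext f
    refine ⟨fun hf => (FinslerGeom.isMobius_iff_mapsGeodesicCircles hf).2 (h f hf), ?_⟩
    rintro ⟨φ, hφ, -⟩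
    exact ⟨φ, hφ⟩
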